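/- Conventions. All manifolds and maps are smooth and "embedding" means smooth embedding. $B^d$ is the open unit ball of $\mathbb R^d$, $S^{d}$ the unit sphere of $\mathbb R^{d+1}$, $B^{d+1}_-=\{y\in B^{d+1}: y_{d+1}\le 0\}$ and $S^{d}_-=\{v\in S^{d}: v_{d+1}\le 0\}$. *Surgery.* Let $X$ be a manifold of dimension $p$, possibly with boundary, let $0\le q\le p-1$, and let $h:S^q\times B^{p-q}\to \mathring X$ be an embedding into the interior of $X$. The manifold obtained from $X$ by the (interior) $q$-dimensional surgery along $h$ is $$X^\#_h=\bigl(X\setminus h(S^q\times\{0\})\bigr)\cup\bigl(B^{q+1}\times S^{p-q-1}\bigr),\qquad h(u,\theta v)\sim(\theta u,v)\quad(u\in S^q,\ v\in S^{p-q-1},\ 0<\theta<1).$$ *Attaching handles.* Let $\Omega$ be a $p$-dimensional manifold with boundary and let $F_a:S^k\times B^{p-k}_-\to\Omega$ (finitely many indices $a$) be embeddings onto pairwise disjoint open subsets of $\Omega$, so that $F_a$ sends $S^k\times\{y_{p-k}=0\}$ into $\partial\Omega$. The manifold obtained from $\Omega$ by attaching $(k+1)$-dimensional handles along the $F_a$ is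 obtained from $\Omega\setminus\bigcup_aF_a(S^k\times\{0\})$ by gluing in, for each $a$, one copy of $B^{k+1}\times S^{p-k-1}_-$ through $F_a(u,\theta v)\sim(\theta u,v)$ for $u\in S^k$, $v\in S^{p-k-1}_-$, $0<\theta<1$. In both cases the resulting manifold is considered up to diffeomorphism. **Lemma.** Let $M,N$ be compact $n$-dimensional manifolds without boundary, let $k\in\{0,\dots,n-1\}$, and let $N$ be obtained from $M$ by a $k$-dimensional surgery along an embedding $f:S^k\times B^{n-k}\to M$. Let $\Omega'$ be the $(n+1)$-dimensional manifold with boundary obtained from $M\times[0,1]$ by attaching two $(k+1)$-dimensional handles along $f(S^k\times B^{n-k})\times\{0\}$ and $f(S^k\times B^{n-k})\times\{1\}$, that is, along $$F_0(x,(y',s))=\bigl(f(x,y'),-\tfrac s2\bigr),\qquad F_1(x,(y',s))=\bigl(f(x,y'),1+\tfrac s2\bigr)\qquad(x\in S^k,\ (y',s)\in B_-^{n+1-k},\ y'\in\mathbb R^{n-k},\ s\le 0).$$ Then $\partial\Omega'$ is diffeomorphic to the disjoint union $N\amalg N$, and $N\times[0,1]$ is obtained from $\Omega'$ by an interior $(k+1)$-dimensional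 surgery, i.e. there is an embedding $g:S^{k+1}\times B^{n-k}\to\mathring{\Omega'}$ such that $N\times[0,1]$ is diffeomorphic to $(\Omega')^\#_g$. -/

import Mathlib

open scoped Manifold ContDiff
open Set

noncomputable section

namespace SmoothSurgery

/-- Euclidean space `ℝ^d`. -/
abbrev Euc (d : ℕ) : Type := EuclideanSpace ℝ (Fin d)

/-- The standard unit sphere `S^d ⊂ ℝ^(d+1)`, with Mathlib's smooth structure. -/
abbrev Sph (d : ℕ) : Type := Metric.sphere (0 : Euc (d + 1)) 1

section Diffeo

variable {E H X E' H' Y : Type*}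
  [NormedAddCommGroup E] [NormedSpace ℝ E] [TopologicalSpace H]
  [NormedAddCommGroup E'] [NormedSpace ℝ E'] [TopologicalSpace H']
  [TopologicalSpace X] [ChartedSpace H X] [TopologicalSpace Y] [ChartedSpace H' Y]

/-- `f` restricts to a diffeomorphism of the subset `s ⊆ X` onto the subset `f '' s ⊆ Y`: it is
injective on `s`, smooth on `s`, and its inverse is smooth on `f '' s`. (Smoothness of a map on a
subset of a manifold is `ContMDiffOn`.) Only the values of `f` on `s` matter. -/
def IsDiffeoOnto (I : ModelWithCorners ℝ E H) (J : ModelWithCorners ℝ E' H')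
    (f : X → Y) (s : Set X) : Prop :=
  ∃ g : Y → X, LeftInvOn g f s ∧ ContMDiffOn I J ∞ f s ∧ ContMDiffOn J I ∞ g (f '' s)

end Diffeo

/-- For a cone `P ⊆ ℝ^(d+1)`: the product `S^k × (B ∩ P)`, with `B` the open unit ball of
`ℝ^(d+1)`. Used for `P` the whole space and for `P` a closed half-space. -/
def tube (k d : ℕ) (P : Set (Euc (d + 1))) : Set (Sph k × Euc (d + 1)) :=
  {p | ‖p.2‖ < 1 ∧ p.2 ∈ P}

/-- For a cone `P ⊆ ℝ^(d+1)`: the product `B × (S^d ∩ P)`, with `B` the open unit ball of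
`ℝ^(k+1)`. -/
def handle (k d : ℕ) (P : Set (Euc (d + 1))) : Set (Euc (k + 1) × Sph d) :=
  {q | ‖q.1‖ < 1 ∧ (q.2 : Euc (d + 1)) ∈ P}

/-- The union of the cores `f_a(S^k × {0})` of a family of tubes. -/
def cores {M ι : Type*} {k d : ℕ} (f : ι → Sph k × Euc (d + 1) → M) : Set M :=
  {x | ∃ (a : ι) (u : Sph k), x = f a (u, 0)}

/-- The closed half-space `{y ∈ ℝ^(d+1) | y_(d+1) ≤ 0}`. -/
def lowerHalf (d : ℕ) : Set (Euc (d + 1)) := {y | y (Fin.last d) ≤ 0}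

section Surgery

variable {E H M E' H' N : Type*}
  [NormedAddCommGroup E] [NormedSpace ℝ E] [TopologicalSpace H]
  [NormedAddCommGroup E'] [NormedSpace ℝ E'] [TopologicalSpace H']
  [TopologicalSpace M] [ChartedSpace H M] [TopologicalSpace N] [ChartedSpace H' N]

/-- `N` is the smooth manifold glued from `M` minus the cores `f_a(S^k × {0})` and from one copy of
`B^(k+1) × (S^d ∩ P)` for each index `a`, where the point `f_a(u, θ v)` is identified with the point
`(θ u, v)` of the `a`-th copy, for `u ∈ S^k`, `v ∈ S^d ∩ P`, `0 < θ < 1`. The maps `i` and `j_a` are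
the inclusions of the pieces, which are diffeomorphisms onto open subsets covering `N`. The `f_a`
themselves are embeddings of `S^k × (B^(d+1) ∩ P)` onto pairwise disjoint open subsets of `M`.

For `P` the whole space this is simultaneous surgery along the `f_a`; for `P` a half-space it is
simultaneous attachment of `(k+1)`-handles, viewed as "half-surgery". -/
structure IsGluing {ι : Type*} {k d : ℕ}
    (I : ModelWithCorners ℝ E H) (J : ModelWithCorners ℝ E' H')
    (P : Set (Euc (d + 1))) (f : ι → Sph k × Euc (d + 1) → M)
    (i : M → N) (j : ι → Euc (k + 1) × Sph d → N) : Prop where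
  diffeo_f : ∀ a, IsDiffeoOnto ((𝓡 k).prod 𝓘(ℝ, Euc (d + 1))) I (f a) (tube k d P)
  isOpen_f : ∀ a, IsOpen (f a '' tube k d P)
  disjoint_f : ∀ a b, a ≠ b → Disjoint (f a '' tube k d P) (f b '' tube k d P)
  diffeo_i : IsDiffeoOnto I J i (cores f)ᶜ
  isOpen_i : IsOpen (i '' (cores f)ᶜ)
  diffeo_j : ∀ a, IsDiffeoOnto (𝓘(ℝ, Euc (k + 1)).prod (𝓡 d)) J (j a) (handle k d P)
  isOpen_j : ∀ a, IsOpen (j a '' handle k d P)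
  disjoint_j : ∀ a b, a ≠ b → Disjoint (j a '' handle k d P) (j b '' handle k d P)
  cover : i '' (cores f)ᶜ ∪ ⋃ a, j a '' handle k d P = univ
  glue : ∀ (a : ι) (u : Sph k) (v : Sph d) (θ : ℝ), 0 < θ → θ < 1 → (v : Euc (d + 1)) ∈ P →
    i (f a (u, θ • (v : Euc (d + 1)))) = j a (θ • (u : Euc (k + 1)), v)
  overlap : ∀ x ∉ cores f, ∀ (a : ι), ∀ q ∈ handle k d P, i x = j a q →
    ∃ (u : Sph k) (θ : ℝ), 0 < θ ∧ θ < 1 ∧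
      x = f a (u, θ • (q.2 : Euc (d + 1))) ∧ q.1 = θ • (u : Euc (k + 1))

/-- `N` is (diffeomorphic to the manifold) obtained from `M` by a surgery of dimension `k` along the
embedding `f : S^k × B^(d+1) → interior M`, where `dim M = k + d + 1`. -/
def IsSurgeryAlong {k d : ℕ} (I : ModelWithCorners ℝ E H) (J : ModelWithCorners ℝ E' H')
    (f : Sph k × Euc (d + 1) → M) (N : Type*) [TopologicalSpace N] [ChartedSpace H' N] : Prop :=
  f '' tube k d univ ⊆ I.interior M ∧
    ∃ (i : M → N) (j : Unit → Euc (k + 1) × Sph d → N), IsGluing I J univ (fun _ => f) i j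

/-- `W` is (diffeomorphic to the manifold) obtained from `M` by simultaneously attaching
`(k+1)`-dimensional handles along the half-tubes `f_a : S^k × B_-^(d+1) → M`, where
`dim M = k + d + 1` and `B_-^(d+1) = {y ∈ B^(d+1) | y_(d+1) ≤ 0}`. The flat parts
`S^k × {y_(d+1) = 0}` are the attaching regions in `∂M`, and the pieces glued in are
`B^(k+1) × S_-^d`. -/
def IsHandleAttachment {ι : Type*} {k d : ℕ}
    (I : ModelWithCorners ℝ E H) (J : ModelWithCorners ℝ E' H')
    (f : ι → Sph k × Euc (d + 1) → M)
    (W : Type*) [TopologicalSpace W] [ChartedSpace H' W] : Prop :=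
  ∃ (i : M → W) (j : ι → Euc (k + 1) × Sph d → W), IsGluing I J (lowerHalf d) f i j

end Surgery

/-- The first `d` coordinates of a point of `ℝ^(d+1)`. -/
def dropLast {d : ℕ} (y : Euc (d + 1)) : Euc d := WithLp.toLp 2 (fun l => y l.castSucc)

/-- The half-tubes in `M × [0,1]` at the two ends `t = 0` and `t = 1` which thicken
`f : S^k × B^(m+1) → M` by means of the product collars `M × [0,1/2)` and `M × (1/2,1]`:
`(x, (y', s)) ↦ (f(x, y'), -s/2)` and `(x, (y', s)) ↦ (f(x, y'), 1 + s/2)`, for `-1 < s ≤ 0`. -/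
def endTubes {M : Type*} {k m : ℕ} (f : Sph k × Euc (m + 1) → M) :
    Fin 2 → Sph k × Euc (m + 2) → M × Icc (0 : ℝ) 1 :=
  ![fun p => (f (p.1, dropLast p.2),
      projIcc 0 1 zero_le_one (-(p.2 (Fin.last (m + 1))) / 2)),
    fun p => (f (p.1, dropLast p.2),
      projIcc 0 1 zero_le_one (1 + p.2 (Fin.last (m + 1)) / 2))]

end SmoothSurgery

end

open SmoothSurgery

/-!
Write `W` for `Ω'`. The core discs `B^(k+1) × {south pole}` of the two handles and the cylinder
`f(S^k × {0}) × [0, 1]` fit together to an embedded sphere `S^(k+1)` in the interior of `W`, with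
trivial normal bundle. Surgery along it cancels the handles against each other: its complement in
`W` is the complement of `S^m × {1/2}` in `N × [0, 1]`, where `S^m = {0} × S^m` is the centre of the
handle that the surgery of `M` has glued into `N`, and the surgery puts `S^m × {1/2}` back together
with its normal discs. All maps are given by explicit formulas.

The key is the choice of the time coordinate. The map `flat` from `W` minus the sphere to
`N × [0, 1]` is the identity of `M` in the first factor, while `t` is replaced by the `T` with
`cot (π T) = r * cot (π t)`, where `r` is the distance to the core of the surgery, cut off to `1`
away from the core (`cotScale`, `coreDist`). For `r → 0` this opens up the ends `t = 0, 1`: the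
direction in which a point of `M × {0}` is approached becomes, through `r * cot (π t)`, a time
coordinate in `[0, 1/2)`, so `flat` extends smoothly over the centres of the handles, except at the
axis that belongs to the sphere. The inverse `unflat` uses the parameter `1 / r`.

A point of the sphere `S^(k+1)` with last coordinate `cos (π t)` lies over time `t`. With fibre
coordinates scaled by `sin (π t) / 4`, this gives the embedding `bridge` of `S^(k+1) × B^(m+1)`; in
the coordinates `(x, cot (π t))` of `B^(k+1) × (0, 1)` the handle glued in by the surgery along
`bridge` is a round ball times `S^m` (`newHandle`), and the attaching relation is `flat_bridge`. The
statement on the surgery is `isGluing_bridge`.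

Smoothness has to be checked across the centres of the handles, where the formulas are written in
polar coordinates. There they become expressions in `sin z / z`, `cos z` and `arctan z / z` at norms
of vectors; these functions are analytic and even, so that their composition with a norm is smooth
(`contDiff_comp_norm_of_even`).

The boundary of `W` does not meet the sphere, so `flat` carries it onto `N × {0, 1}` (`range_ends`).
-/

noncomputable section

namespace SmoothSurgery

open Filter Topology Real

/-! ### Even analytic functions of the norm -/

/-- An even function that is analytic at `0` is, near `0`, an analytic function of the square of its
argument: its Taylor series has only even terms. -/
theorem exists_analyticAt_comp_sq {F : ℝ → ℝ} (hF : AnalyticAt ℝ F 0) (heven : ∀ x, F (-x) = F x) :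
    ∃ G : ℝ → ℝ, AnalyticAt ℝ G 0 ∧ ∀ᶠ z in 𝓝 (0 : ℝ), F z = G (z ^ 2) := by
  obtain ⟨p, hp⟩ := hF
  rw [hasFPowerSeriesAt_iff] at hp
  simp only [zero_add, smul_eq_mul] at hp
  obtain ⟨r, hr, hball⟩ := Metric.eventually_nhds_iff.1 hp
  -- Averaging the series at `z` and `-z` kills the odd terms.
  have key : ∀ z : ℝ, |z| < r → HasSum (fun n => (z ^ 2) ^ n * p.coeff (2 * n)) (F z) := by
    intro z hz
    have h1 := hball (y := z) (by simpa using hz)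
    have h2 := hball (y := -z) (by simpa using hz)
    rw [heven] at h2
    have h3 := (h1.add h2).div_const 2
    rw [add_self_div_two] at h3
    have hinj : Function.Injective (fun n : ℕ => 2 * n) := fun a b h => by simpa using h
    rw [← hinj.hasSum_iff] at h3
    · have h4 : ((fun n => (z ^ n * p.coeff n + (-z) ^ n * p.coeff n) / 2) ∘ fun n => 2 * n) =
          fun n => (z ^ 2) ^ n * p.coeff (2 * n) := by
        funext n
        simp [pow_mul]
      rwa [h4] at h3
    · intro n hn
      have : Odd n := by
        rw [← Nat.not_even_iff_odd]
        rintro ⟨k, rfl⟩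
        exact hn ⟨k, by simp; ring⟩
      rw [this.neg_pow]; ring
  refine ⟨fun w => ∑' n, w ^ n * p.coeff (2 * n),
    ⟨FormalMultilinearSeries.ofScalars ℝ (fun n => p.coeff (2 * n)), ?_⟩, ?_⟩
  · rw [hasFPowerSeriesAt_iff]
    refine Metric.eventually_nhds_iff.2 ⟨r ^ 2, by positivity, fun {w} hw => ?_⟩
    simp only [zero_add, smul_eq_mul, FormalMultilinearSeries.coeff_ofScalars]
    refine Summable.hasSum ?_
    have hw' : |w| < r ^ 2 := by simpa using hw
    have h := (key (√|w|) (by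
      rw [abs_of_nonneg (Real.sqrt_nonneg _)]
      exact (Real.sqrt_lt' hr).2 hw')).summable.abs
    refine Summable.of_abs ?_
    simpa [abs_mul, Real.sq_sqrt] using h
  · refine Metric.eventually_nhds_iff.2 ⟨r, hr, fun {z} hz => ?_⟩
    exact (key z (by simpa using hz)).tsum_eq.symm

/-- A radial function built from an even analytic function is smooth, also at the origin. -/
theorem contDiff_comp_norm_of_even {E : Type*} [NormedAddCommGroup E] [InnerProductSpace ℝ E]
    {F : ℝ → ℝ} (hF : ∀ x, AnalyticAt ℝ F x) (heven : ∀ x, F (-x) = F x) :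
    ContDiff ℝ ∞ (fun x : E => F ‖x‖) := by
  rw [contDiff_iff_contDiffAt]
  intro x
  by_cases hx : x = 0
  · subst hx
    obtain ⟨G, hG, hFG⟩ := exists_analyticAt_comp_sq (hF 0) heven
    have h1 : (fun x : E => F ‖x‖) =ᶠ[𝓝 0] fun x => G (‖x‖ ^ 2) := by
      have : Tendsto (fun x : E => ‖x‖) (𝓝 0) (𝓝 0) :=
          by simpa using (continuous_norm (E := E)).tendsto 0
      exact this.eventually hFG
    refine ContDiffAt.congr_of_eventuallyEq ?_ h1
    have h2 : ContDiffAt ℝ ∞ G (‖(0 : E)‖ ^ 2) := by simpa using hG.contDiffAt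
    exact h2.comp (0 : E) (contDiff_norm_sq ℝ).contDiffAt
  · exact (hF _).contDiffAt.comp x (contDiffAt_norm ℝ hx)

theorem analyticAt_dslope {F : ℝ → ℝ} (hF : ∀ x, AnalyticAt ℝ F x) (x : ℝ) :
    AnalyticAt ℝ (dslope F 0) x := by
  by_cases hx : x = 0
  · subst hx
    obtain ⟨p, hp⟩ := hF 0
    exact ⟨_, hp.has_fpower_series_dslope_fslope⟩
  · refine AnalyticAt.congr ?_ (dslope_eventuallyEq_slope_of_ne F hx).symm
    simp only [slope_fun_def]
    exact ((analyticAt_id.sub analyticAt_const).inv (by simpa using hx)).smul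
      ((hF x).sub analyticAt_const)

theorem contDiff_sinc_norm {E : Type*} [NormedAddCommGroup E] [InnerProductSpace ℝ E] :
    ContDiff ℝ ∞ (fun x : E => sinc ‖x‖) :=
  contDiff_comp_norm_of_even
    (fun x => by rw [sinc_eq_dslope]; exact analyticAt_dslope (fun _ => analyticAt_sin) x) sinc_neg

theorem contDiff_cos_norm {E : Type*} [NormedAddCommGroup E] [InnerProductSpace ℝ E] :
    ContDiff ℝ ∞ (fun x : E => cos ‖x‖) :=
  contDiff_comp_norm_of_even (fun _ => analyticAt_cos) cos_neg

/-- The function `arctan z / z`, with value `1` at `z = 0`. -/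
def atanc (z : ℝ) : ℝ := dslope arctan 0 z

theorem atanc_zero : atanc 0 = 1 := by
  simp [atanc, Real.deriv_arctan]

theorem mul_atanc (z : ℝ) : z * atanc z = arctan z := by
  have := sub_smul_dslope arctan 0 z
  simpa [atanc] using this

theorem atanc_neg (z : ℝ) : atanc (-z) = atanc z := by
  by_cases hz : z = 0
  · simp [hz]
  · have h1 := mul_atanc z
    have h2 := mul_atanc (-z)
    rw [arctan_neg, ← h1] at h2
    have : z * (atanc (-z) - atanc z) = 0 := by linarith
    rcases mul_eq_zero.1 this with h | h
    · exact absurd h hz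
    · linarith

theorem atanc_pos (z : ℝ) : 0 < atanc z := by
  rcases lt_trichotomy z 0 with h | h | h
  · have h1 := mul_atanc z
    have h2 := arctan_lt_zero.2 h
    by_contra hc
    nlinarith
  · rw [h, atanc_zero]; norm_num
  · have h1 := mul_atanc z
    have h2 := arctan_pos.2 h
    by_contra hc
    nlinarith

theorem contDiff_atanc_norm {E : Type*} [NormedAddCommGroup E] [InnerProductSpace ℝ E] :
    ContDiff ℝ ∞ (fun x : E => atanc ‖x‖) :=
  contDiff_comp_norm_of_even (fun x => analyticAt_dslope
    (fun y => contDiff_omega_iff_analyticOnNhd.1 contDiff_arctan y (mem_univ y)) x) atanc_neg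

theorem mul_sinc (z : ℝ) : z * sinc z = sin z := by
  by_cases hz : z = 0
  · simp [hz]
  · rw [sinc_of_ne_zero hz]; field_simp

theorem sinc_pos {z : ℝ} (h : |z| < π) : 0 < sinc z := by
  rw [abs_lt] at h
  rcases lt_trichotomy z 0 with hz | hz | hz
  · have h1 := sin_neg_of_neg_of_neg_pi_lt hz h.1
    rw [← mul_sinc] at h1
    by_contra hc
    nlinarith
  · simp [hz]
  · have h1 := sin_pos_of_pos_of_lt_pi hz h.2
    rw [← mul_sinc] at h1
    by_contra hc
    nlinarith

/-! ### A one-parameter family of diffeomorphisms of the unit interval -/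

/-- The diffeomorphism `t ↦ T` of `[0, 1]` determined by `cot (π T) = L * cot (π t)`, for `L > 0`.
The cotangent is infinite at the end points; the formula used here, which expresses `T - t` by the
addition theorem, is visibly smooth in `(L, t)` up to them. -/
def cotScale (L t : ℝ) : ℝ :=
  t + arctan ((1 - L) * (sin (π * t) * cos (π * t)) /
    (L * cos (π * t) ^ 2 + sin (π * t) ^ 2)) / π

theorem cotScale_denom_pos {L : ℝ} (hL : 0 < L) (t : ℝ) :
    0 < L * cos (π * t) ^ 2 + sin (π * t) ^ 2 := by
  by_cases hs : sin (π * t) = 0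
  · have := sin_sq_add_cos_sq (π * t)
    rw [hs] at this ⊢
    have : cos (π * t) ^ 2 = 1 := by linarith
    rw [this]; simpa
  · positivity

theorem contDiffAt_cotScale {p : ℝ × ℝ} (hp : 0 < p.1) :
    ContDiffAt ℝ ∞ (fun p : ℝ × ℝ => cotScale p.1 p.2) p := by
  unfold cotScale
  have h : p.1 * cos (π * p.2) ^ 2 + sin (π * p.2) ^ 2 ≠ 0 := (cotScale_denom_pos hp p.2).ne'
  refine ContDiffAt.add contDiffAt_snd (ContDiffAt.div_const (ContDiffAt.arctan ?_) _)
  refine ContDiffAt.div ?_ ?_ h <;> fun_prop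

theorem cotScale_zero (L : ℝ) : cotScale L 0 = 0 := by simp [cotScale]

theorem cotScale_one (L : ℝ) : cotScale L 1 = 1 := by simp [cotScale]

theorem cotScale_one_sub (L t : ℝ) : cotScale L (1 - t) = 1 - cotScale L t := by
  have h1 : π * (1 - t) = π - π * t := by ring
  unfold cotScale
  rw [h1, sin_pi_sub, cos_pi_sub]
  have : (1 - L) * (sin (π * t) * -cos (π * t)) / (L * (-cos (π * t)) ^ 2 + sin (π * t) ^ 2) =
    -((1 - L) * (sin (π * t) * cos (π * t)) / (L * (cos (π * t)) ^ 2 + sin (π * t) ^ 2)) := by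
    rw [neg_sq]; ring
  rw [this, arctan_neg]; ring

theorem sin_pi_mul_pos {t : ℝ} (h0 : 0 < t) (h1 : t < 1) : 0 < sin (π * t) :=
  sin_pos_of_pos_of_lt_pi (by positivity) (by nlinarith [pi_pos])

theorem arctan_cot {t : ℝ} (h0 : 0 < t) (h1 : t < 1) :
    arctan (cos (π * t) / sin (π * t)) = π / 2 - π * t := by
  apply arctan_eq_of_tan_eq
  · rw [tan_eq_sin_div_cos, sin_pi_div_two_sub, cos_pi_div_two_sub]
  · constructor <;> nlinarith [pi_pos]

theorem cotScale_eq_cot {L t : ℝ} (hL : 0 < L) (h0 : 0 < t) (h1 : t < 1) :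
    cotScale L t = 1 / 2 - arctan (L * (cos (π * t) / sin (π * t))) / π := by
  have hs := sin_pi_mul_pos h0 h1
  set κ := cos (π * t) / sin (π * t) with hκ
  have hc : cos (π * t) = κ * sin (π * t) := by rw [hκ]; field_simp
  have h2 : arctan κ + arctan (-(L * κ)) = arctan ((κ + -(L * κ)) / (1 - κ * -(L * κ))) :=
    arctan_add (by nlinarith [mul_nonneg hL.le (sq_nonneg κ)])
  rw [arctan_neg, arctan_cot h0 h1] at h2
  have h3 : (κ + -(L * κ)) / (1 - κ * -(L * κ)) =
      (1 - L) * (sin (π * t) * cos (π * t)) / (L * cos (π * t) ^ 2 + sin (π * t) ^ 2) := by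
    have hd : 1 - κ * -(L * κ) ≠ 0 := by nlinarith [mul_nonneg hL.le (sq_nonneg κ)]
    rw [hc]
    have hd2 : L * (κ * sin (π * t)) ^ 2 + sin (π * t) ^ 2 ≠ 0 := by
      rw [← hc]; exact (cotScale_denom_pos hL t).ne'
    rw [div_eq_div_iff hd hd2]; ring
  rw [cotScale, ← h3, ← h2]
  field_simp; ring

theorem cotScale_mem_Ioo {L t : ℝ} (hL : 0 < L) (h0 : 0 < t) (h1 : t < 1) :
    0 < cotScale L t ∧ cotScale L t < 1 := by
  rw [cotScale_eq_cot hL h0 h1]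
  have h2 := arctan_lt_pi_div_two (L * (cos (π * t) / sin (π * t)))
  have h3 := neg_pi_div_two_lt_arctan (L * (cos (π * t) / sin (π * t)))
  have hp := pi_pos
  constructor
  · have : arctan (L * (cos (π * t) / sin (π * t))) / π < 1 / 2 := by
      rw [div_lt_iff₀ hp]; linarith
    linarith
  · have : -(1 / 2) < arctan (L * (cos (π * t) / sin (π * t))) / π := by
      rw [lt_div_iff₀ hp]; linarith
    linarith

theorem cotScale_mem_Icc {L t : ℝ} (hL : 0 < L) (ht : t ∈ Icc (0 : ℝ) 1) :
    cotScale L t ∈ Icc (0 : ℝ) 1 := by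
  rcases ht.1.eq_or_lt with h | h
  · rw [← h, cotScale_zero]; simp
  rcases ht.2.eq_or_lt with h' | h'
  · rw [h', cotScale_one]; simp
  have := cotScale_mem_Ioo hL h h'
  exact ⟨this.1.le, this.2.le⟩

theorem cot_half_sub_arctan (x : ℝ) :
    cos (π * (1 / 2 - arctan x / π)) / sin (π * (1 / 2 - arctan x / π)) = x := by
  have : π * (1 / 2 - arctan x / π) = π / 2 - arctan x := by field_simp
  rw [this, cos_pi_div_two_sub, sin_pi_div_two_sub, ← tan_eq_sin_div_cos, tan_arctan]

theorem cotScale_inv_cotScale {L t : ℝ} (hL : 0 < L) (ht : t ∈ Icc (0 : ℝ) 1) :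
    cotScale L⁻¹ (cotScale L t) = t := by
  rcases ht.1.eq_or_lt with h | h
  · rw [← h, cotScale_zero, cotScale_zero]
  rcases ht.2.eq_or_lt with h' | h'
  · rw [h', cotScale_one, cotScale_one]
  have hm := cotScale_mem_Ioo hL h h'
  rw [cotScale_eq_cot (inv_pos.2 hL) hm.1 hm.2, cotScale_eq_cot hL h h', cot_half_sub_arctan,
    inv_mul_cancel_left₀ hL.ne', arctan_cot h h']
  field_simp; ring

theorem cotScale_eq_tan {L t : ℝ} (hL : 0 < L) (h0 : 0 ≤ t) (h1 : t < 1 / 2) :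
    cotScale L t = arctan (tan (π * t) / L) / π := by
  rcases h0.eq_or_lt with h | h
  · rw [← h]; simp [cotScale_zero]
  have hs := sin_pi_mul_pos h (by linarith)
  have hc : 0 < cos (π * t) := cos_pos_of_mem_Ioo ⟨by nlinarith [pi_pos], by nlinarith [pi_pos]⟩
  rw [cotScale_eq_cot hL h (by linarith)]
  have : tan (π * t) / L = (L * (cos (π * t) / sin (π * t)))⁻¹ := by
    rw [tan_eq_sin_div_cos]; field_simp
  rw [this, arctan_inv_of_pos (by positivity)]
  field_simp

/-! ### Radial cutoff -/

/-- A smooth function, positive for `r > 0`, that equals `r` for `r ≤ 1/4` and `1` for `r ≥ 1/2`. -/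
def radialCutoff (r : ℝ) : ℝ := r + (1 - r) * smoothTransition (4 * r - 1)

theorem radialCutoff_of_le {r : ℝ} (h : r ≤ 1 / 4) : radialCutoff r = r := by
  simp [radialCutoff, smoothTransition.zero_of_nonpos (x := 4 * r - 1) (by linarith)]

theorem radialCutoff_of_ge {r : ℝ} (h : 1 / 2 ≤ r) : radialCutoff r = 1 := by
  simp [radialCutoff, smoothTransition.one_of_one_le (x := 4 * r - 1) (by linarith)]

theorem radialCutoff_pos {r : ℝ} (h : 0 < r) : 0 < radialCutoff r := by
  rcases le_total (1 / 2) r with h' | h'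
  · rw [radialCutoff_of_ge h']; norm_num
  · have := smoothTransition.nonneg (4 * r - 1)
    have : 0 ≤ (1 - r) * smoothTransition (4 * r - 1) := mul_nonneg (by linarith) this
    unfold radialCutoff; linarith

theorem contDiff_radialCutoff : ContDiff ℝ ∞ radialCutoff := by
  unfold radialCutoff
  exact contDiff_id.add ((contDiff_const.sub contDiff_id).mul
    (smoothTransition.contDiff.comp (by fun_prop)))

/-! ### Maps into spheres and into the unit interval -/

/-- The direction `y / ‖y‖` of a vector, as a point of the sphere; an arbitrary point if `y = 0`. -/
def dir {d : ℕ} (y : Euc (d + 1)) : Sph d :=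
  if h : y = 0 then ⟨EuclideanSpace.single 0 1, by simp⟩
  else ⟨‖y‖⁻¹ • y, by simp [norm_smul, h]⟩

theorem coe_dir {d : ℕ} {y : Euc (d + 1)} (h : y ≠ 0) : (dir y : Euc (d + 1)) = ‖y‖⁻¹ • y := by
  simp [dir, h]

theorem norm_smul_dir {d : ℕ} (y : Euc (d + 1)) : ‖y‖ • (dir y : Euc (d + 1)) = y := by
  by_cases h : y = 0
  · simp [h]
  · rw [coe_dir h, smul_smul, mul_inv_cancel₀ (norm_ne_zero_iff.2 h), one_smul]

theorem norm_coe_sph {d : ℕ} (v : Sph d) : ‖(v : Euc (d + 1))‖ = 1 := by simp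

theorem coe_sph_ne_zero {d : ℕ} (v : Sph d) : (v : Euc (d + 1)) ≠ 0 :=
  norm_ne_zero_iff.1 (by simp)

theorem dir_smul_coe {d : ℕ} {θ : ℝ} (hθ : 0 < θ) (v : Sph d) : dir (θ • (v : Euc (d + 1))) = v :=
    by
  apply Subtype.ext
  rw [coe_dir (smul_ne_zero hθ.ne' (coe_sph_ne_zero v)), norm_smul, norm_coe_sph,
    Real.norm_of_nonneg hθ.le, mul_one, smul_smul, inv_mul_cancel₀ hθ.ne', one_smul]

theorem dir_coe {d : ℕ} (v : Sph d) : dir (v : Euc (d + 1)) = v := by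
  simpa using dir_smul_coe one_pos v

theorem dir_smul {d : ℕ} {θ : ℝ} (hθ : 0 < θ) (y : Euc (d + 1)) : dir (θ • y) = dir y := by
  by_cases h : y = 0
  · simp [h]
  · conv_lhs => rw [← norm_smul_dir y, smul_smul]
    exact dir_smul_coe (mul_pos hθ (norm_pos_iff.2 h)) _

theorem contMDiff_coe_sph {d : ℕ} :
    ContMDiff (𝓡 d) 𝓘(ℝ, Euc (d + 1)) ∞ (fun v : Sph d => (v : Euc (d + 1))) := by
  have := Fact.mk (@finrank_euclideanSpace_fin ℝ _ (d + 1))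
  exact contMDiff_coe_sphere

theorem contMDiff_codRestrict_sph {d : ℕ} {F : Euc (d + 1) → Euc (d + 1)} (hF : ContDiff ℝ ∞ F)
    (hS : ∀ z, F z ∈ Metric.sphere (0 : Euc (d + 1)) 1) :
    ContMDiff 𝓘(ℝ, Euc (d + 1)) (𝓡 d) ∞ (fun z => (⟨F z, hS z⟩ : Sph d)) := by
  have := Fact.mk (@finrank_euclideanSpace_fin ℝ _ (d + 1))
  exact hF.contMDiff.codRestrict_sphere hS

/-- Near a given `y₀ ≠ 0` the direction agrees with a map that is smooth on all of `ℝ^(d+1)`, to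
which the criterion for maps into spheres applies. -/
theorem contMDiffAt_dir {d : ℕ} {y : Euc (d + 1)} (h : y ≠ 0) :
    ContMDiffAt 𝓘(ℝ, Euc (d + 1)) (𝓡 d) ∞ (dir : Euc (d + 1) → Sph d) y := by
  have hy : 0 < ‖y‖ := norm_pos_iff.2 h
  let χ : ContDiffBump y := ⟨‖y‖ / 4, ‖y‖ / 2, by positivity, by linarith⟩
  let F : Euc (d + 1) → Euc (d + 1) := fun z => y + χ z • (z - y)
  have hF0 : ∀ z, F z ≠ 0 := by
    intro z hz
    have h1 : ‖χ z • (z - y)‖ ≤ ‖y‖ / 2 := by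
      by_cases hd : dist z y < ‖y‖ / 2
      · rw [norm_smul, Real.norm_of_nonneg χ.nonneg, ← dist_eq_norm]
        exact (mul_le_of_le_one_left dist_nonneg χ.le_one).trans hd.le
      · rw [χ.zero_of_le_dist (not_lt.1 hd), zero_smul, norm_zero]; positivity
    have h2 : χ z • (z - y) = -y := eq_neg_of_add_eq_zero_right hz
    rw [h2, norm_neg] at h1
    linarith
  have hF : ContDiff ℝ ∞ F := contDiff_const.add (χ.contDiff.smul (contDiff_id.sub contDiff_const))
  have hG : ContDiff ℝ ∞ (fun z => ‖F z‖⁻¹ • F z) :=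
    ((hF.norm ℝ hF0).inv fun z => norm_ne_zero_iff.2 (hF0 z)).smul hF
  have hS : ∀ z, ‖F z‖⁻¹ • F z ∈ Metric.sphere (0 : Euc (d + 1)) 1 := fun z => by
    simp [norm_smul, hF0 z]
  refine (contMDiff_codRestrict_sph hG hS y).congr_of_eventuallyEq ?_
  filter_upwards [Metric.ball_mem_nhds y (show 0 < ‖y‖ / 4 by positivity)] with z hz
  have hFz : F z = z := by
    have : χ z = 1 := χ.one_of_mem_closedBall (Metric.ball_subset_closedBall hz)
    simp [F, this]
  apply Subtype.ext
  have hz0 : z ≠ 0 := by rw [← hFz]; exact hF0 z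
  rw [coe_dir hz0]
  simp [hFz]

section

variable {E H X : Type*} [NormedAddCommGroup E] [NormedSpace ℝ E] [TopologicalSpace H]
  [TopologicalSpace X] [ChartedSpace H X] {I : ModelWithCorners ℝ E H}

theorem contMDiffWithinAt_of_contDiffAt {V V' : Type*} [NormedAddCommGroup V] [NormedSpace ℝ V]
    [NormedAddCommGroup V'] [NormedSpace ℝ V'] (F : V → V') {c : X → V} {s : Set X} {x : X}
    (hF : ContDiffAt ℝ ∞ F (c x)) (hc : ContMDiffWithinAt I 𝓘(ℝ, V) ∞ c s x) :
    ContMDiffWithinAt I 𝓘(ℝ, V') ∞ (fun p => F (c p)) s x :=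
  hF.contMDiffAt.comp_contMDiffWithinAt x hc

theorem contMDiffWithinAt_dir_comp {d : ℕ} {F : X → Euc (d + 1)} {s : Set X} {x : X}
    (hF : ContMDiffWithinAt I 𝓘(ℝ, Euc (d + 1)) ∞ F s x) (h0 : F x ≠ 0) :
    ContMDiffWithinAt I (𝓡 d) ∞ (fun p => dir (F p)) s x :=
  (contMDiffAt_dir h0).comp_contMDiffWithinAt x hF

theorem contMDiffWithinAt_unitInterval {F : X → Icc (0 : ℝ) 1} {s : Set X} {x : X}
    (hF : ContMDiffWithinAt I 𝓘(ℝ, ℝ) ∞ (fun p => (F p : ℝ)) s x) :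
    ContMDiffWithinAt I (𝓡∂ 1) ∞ F s x := by
  have h1 : ContMDiffOn 𝓘(ℝ, ℝ) (𝓡∂ 1) ∞ (projIcc (0 : ℝ) 1 zero_le_one) (Icc 0 1) :=
    contMDiffOn_projIcc
  have h := (h1 _ (F x).2).comp x hF (fun p _ => (F p).2)
  have h2 : F = projIcc (0 : ℝ) 1 zero_le_one ∘ fun p => (F p : ℝ) := by
    ext p; simp
  rwa [← h2] at h

theorem contMDiff_coe_unitInterval :
    ContMDiff (𝓡∂ 1) 𝓘(ℝ, ℝ) ∞ (fun t : Icc (0 : ℝ) 1 => (t : ℝ)) :=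
  contMDiff_subtypeVal_Icc

end

/-! ### Diffeomorphisms between subsets -/

section Diffeo

variable {E H X E' H' Y E'' H'' Z : Type*}
  [NormedAddCommGroup E] [NormedSpace ℝ E] [TopologicalSpace H]
  [NormedAddCommGroup E'] [NormedSpace ℝ E'] [TopologicalSpace H']
  [NormedAddCommGroup E''] [NormedSpace ℝ E''] [TopologicalSpace H'']
  [TopologicalSpace X] [ChartedSpace H X] [TopologicalSpace Y] [ChartedSpace H' Y]
  [TopologicalSpace Z] [ChartedSpace H'' Z]
  {I : ModelWithCorners ℝ E H} {J : ModelWithCorners ℝ E' H'} {K : ModelWithCorners ℝ E'' H''}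
  {φ : X → Y} {s : Set X}

theorem IsDiffeoOnto.injOn (h : IsDiffeoOnto I J φ s) : InjOn φ s := by
  obtain ⟨g, hg, -⟩ := h
  exact hg.injOn

theorem IsDiffeoOnto.contMDiffOn (h : IsDiffeoOnto I J φ s) : ContMDiffOn I J ∞ φ s := by
  obtain ⟨g, -, hg, -⟩ := h
  exact hg

/-- A map out of `Y` is smooth at `φ x` once its composition with `φ` is smooth at `x`. -/
theorem IsDiffeoOnto.contMDiffAt_of_comp (h : IsDiffeoOnto I J φ s) (ho : IsOpen (φ '' s))
    {x : X} (hx : x ∈ s) {F : Y → Z} (hF : ContMDiffWithinAt I K ∞ (fun p => F (φ p)) s x) :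
    ContMDiffAt J K ∞ F (φ x) := by
  obtain ⟨g, hg, -, hg'⟩ := h
  have hm : MapsTo g (φ '' s) s := by
    rintro _ ⟨p, hp, rfl⟩
    rwa [hg hp]
  have h1 : ContMDiffWithinAt J K ∞ ((fun p => F (φ p)) ∘ g) (φ '' s) (φ x) :=
    ContMDiffWithinAt.comp (φ x) (by rwa [hg hx]) (hg' _ (mem_image_of_mem _ hx)) hm
  refine (h1.congr_of_mem ?_ (mem_image_of_mem _ hx)).contMDiffAt
      (ho.mem_nhds (mem_image_of_mem _ hx))
  rintro _ ⟨p, hp, rfl⟩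
  simp [hg hp]

theorem IsDiffeoOnto.prodMap {E₂ H₂ X₂ E₂' H₂' Y₂ : Type*}
    [NormedAddCommGroup E₂] [NormedSpace ℝ E₂] [TopologicalSpace H₂]
    [NormedAddCommGroup E₂'] [NormedSpace ℝ E₂'] [TopologicalSpace H₂']
    [TopologicalSpace X₂] [ChartedSpace H₂ X₂] [TopologicalSpace Y₂] [ChartedSpace H₂' Y₂]
    {I₂ : ModelWithCorners ℝ E₂ H₂} {J₂ : ModelWithCorners ℝ E₂' H₂'}
    {φ₂ : X₂ → Y₂} {s₂ : Set X₂} (h : IsDiffeoOnto I J φ s) (h₂ : IsDiffeoOnto I₂ J₂ φ₂ s₂) :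
    IsDiffeoOnto (I.prod I₂) (J.prod J₂) (Prod.map φ φ₂) (s ×ˢ s₂) := by
  obtain ⟨g, hg, h1, h1'⟩ := h
  obtain ⟨g₂, hg₂, h2, h2'⟩ := h₂
  refine ⟨Prod.map g g₂, ?_, h1.prodMap h2, ?_⟩
  · rintro ⟨a, b⟩ ⟨ha, hb⟩
    exact Prod.ext (hg ha) (hg₂ hb)
  · rw [prodMap_image_prod]
    exact h1'.prodMap h2'

/-- Two mutually inverse smooth maps between subsets. -/
theorem isDiffeoOnto_of_inverse {ψ : Y → X} {V : Set Y}
    (hφ : ∀ x ∈ s, φ x ∈ V) (hψ : ∀ y ∈ V, ψ y ∈ s) (hl : ∀ x ∈ s, ψ (φ x) = x)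
    (hr : ∀ y ∈ V, φ (ψ y) = y) (h1 : ContMDiffOn I J ∞ φ s) (h2 : ContMDiffOn J I ∞ ψ V) :
    IsDiffeoOnto I J φ s ∧ φ '' s = V := by
  have : φ '' s = V := by
    apply Subset.antisymm
    · rintro _ ⟨x, hx, rfl⟩
      exact hφ x hx
    · exact fun y hy => ⟨ψ y, hψ y hy, hr y hy⟩
  exact ⟨⟨ψ, hl, h1, this ▸ h2⟩, this⟩

theorem IsDiffeoOnto.isOpen_image (h : IsDiffeoOnto I J φ s) (ho : IsOpen (φ '' s))
    {u : Set X} (hu : IsOpen u) : IsOpen (φ '' (s ∩ u)) := by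
  obtain ⟨g, hg, -, hg'⟩ := h
  have : φ '' (s ∩ u) = φ '' s ∩ g ⁻¹' u := by
    ext y
    constructor
    · rintro ⟨x, ⟨hx, hxu⟩, rfl⟩
      exact ⟨mem_image_of_mem _ hx, by simpa [hg hx] using hxu⟩
    · rintro ⟨⟨x, hx, rfl⟩, hxu⟩
      exact ⟨x, ⟨hx, by simpa [hg hx] using hxu⟩, rfl⟩
  rw [this]
  exact hg'.continuousOn.isOpen_inter_preimage ho hu

theorem IsDiffeoOnto.isInteriorPoint_iff [IsManifold I ∞ X] [IsManifold J ∞ Y]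
    (h : IsDiffeoOnto I J φ s) (hs : IsOpen s)
    (ho : IsOpen (φ '' s)) {x : X} (hx : x ∈ s) :
    I.IsInteriorPoint x ↔ J.IsInteriorPoint (φ x) := by
  obtain ⟨g, hg, h1, h2⟩ := h
  let Φ : PartialDiffeomorph I J X Y ∞ :=
    { toFun := φ
      invFun := g
      source := s
      target := φ '' s
      map_source' := fun p hp => mem_image_of_mem _ hp
      map_target' := by
        rintro _ ⟨p, hp, rfl⟩
        rwa [hg hp]
      left_inv' := hg
      right_inv' := by
        rintro _ ⟨p, hp, rfl⟩
        rw [hg hp]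
      open_source := hs
      open_target := ho
      contMDiffOn_toFun := h1
      contMDiffOn_invFun := h2 }
  have hl : IsLocalDiffeomorphAt I J ∞ φ x := ⟨Φ, hx, fun _ _ => rfl⟩
  exact hl.isInteriorPoint_iff (by simp)

end Diffeo

section

variable {E H X E' H' Y E'' H'' Z E₁ H₁ T : Type*}
  [NormedAddCommGroup E] [NormedSpace ℝ E] [TopologicalSpace H]
  [NormedAddCommGroup E'] [NormedSpace ℝ E'] [TopologicalSpace H']
  [NormedAddCommGroup E''] [NormedSpace ℝ E''] [TopologicalSpace H'']
  [NormedAddCommGroup E₁] [NormedSpace ℝ E₁] [TopologicalSpace H₁]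
  [TopologicalSpace X] [ChartedSpace H X] [TopologicalSpace Y] [ChartedSpace H' Y]
  [TopologicalSpace Z] [ChartedSpace H'' Z] [TopologicalSpace T] [ChartedSpace H₁ T]
  {I : ModelWithCorners ℝ E H} {J : ModelWithCorners ℝ E' H'} {K : ModelWithCorners ℝ E'' H''}
  {I₁ : ModelWithCorners ℝ E₁ H₁} {φ : X → Y} {s : Set X}

/-- A smooth map with a smooth left inverse defined on an open set `V`, which is a right inverse
where this makes sense, has open image. -/
theorem isDiffeoOnto_and_isOpen_image {ψ : Y → X} {V : Set Y} (hs : IsOpen s) (hV : IsOpen V)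
    (hφ : ∀ x ∈ s, φ x ∈ V) (hl : ∀ x ∈ s, ψ (φ x) = x) (hr : ∀ y ∈ V, φ (ψ y) = y)
    (h1 : ContMDiffOn I J ∞ φ s) (h2 : ContMDiffOn J I ∞ ψ V) :
    IsDiffeoOnto I J φ s ∧ IsOpen (φ '' s) := by
  have : φ '' s = V ∩ ψ ⁻¹' s := by
    apply Subset.antisymm
    · rintro _ ⟨x, hx, rfl⟩
      exact ⟨hφ x hx, by simpa [hl x hx] using hx⟩
    · exact fun y hy => ⟨ψ y, hy.2, hr y hy.1⟩
  exact ⟨⟨ψ, hl, h1, h2.mono (this ▸ inter_subset_left)⟩,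
    this ▸ h2.continuousOn.isOpen_inter_preimage hV hs⟩

theorem isDiffeoOnto_id : IsDiffeoOnto I I (id : X → X) univ :=
  ⟨id, fun _ _ => rfl, contMDiff_id.contMDiffOn, contMDiff_id.contMDiffOn⟩

theorem IsDiffeoOnto.contMDiffAt_prod_of_comp (h : IsDiffeoOnto I J φ s) (ho : IsOpen (φ '' s))
    {x : X} (hx : x ∈ s) {t : T} {F : Y × T → Z}
    (hF : ContMDiffWithinAt (I.prod I₁) K ∞ (fun q : X × T => F (φ q.1, q.2)) (s ×ˢ univ) (x, t)) :
    ContMDiffAt (J.prod I₁) K ∞ F (φ x, t) := by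
  have ho' : IsOpen (Prod.map φ id '' (s ×ˢ (univ : Set T))) := by
    rw [prodMap_image_prod, image_id]
    exact ho.prod isOpen_univ
  exact (h.prodMap (isDiffeoOnto_id (I := I₁))).contMDiffAt_of_comp ho' (x := (x, t))
    ⟨hx, mem_univ _⟩ hF

end

/-! ### Splitting off the last coordinate -/

/-- The vector `(y, s)` of `ℝ^(d+1)` with `y ∈ ℝ^d` and last coordinate `s`. -/
def appendLast {d : ℕ} (y : Euc d) (s : ℝ) : Euc (d + 1) :=
    WithLp.toLp 2 (Fin.snoc (α := fun _ => ℝ) y s)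

@[simp] theorem dropLast_appendLast {d : ℕ} (y : Euc d) (s : ℝ) : dropLast (appendLast y s) = y :=
    by
  ext l; simp [dropLast, appendLast]

@[simp] theorem appendLast_last {d : ℕ} (y : Euc d) (s : ℝ) : appendLast y s (Fin.last d) = s := by
  simp [appendLast]

theorem appendLast_dropLast {d : ℕ} (y : Euc (d + 1)) : appendLast (dropLast y) (y (Fin.last d))
    = y := by
  ext l
  refine Fin.lastCases ?_ (fun i => ?_) l <;> simp [dropLast, appendLast]

theorem norm_sq_appendLast {d : ℕ} (y : Euc d) (s : ℝ) : ‖appendLast y s‖ ^ 2 = ‖y‖ ^ 2 + s ^ 2 :=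
    by
  simp [EuclideanSpace.norm_sq_eq, Fin.sum_univ_castSucc, appendLast]

theorem norm_sq_eq_dropLast {d : ℕ} (y : Euc (d + 1)) :
    ‖y‖ ^ 2 = ‖dropLast y‖ ^ 2 + y (Fin.last d) ^ 2 := by
  rw [← norm_sq_appendLast, appendLast_dropLast]

theorem norm_dropLast_le {d : ℕ} (y : Euc (d + 1)) : ‖dropLast y‖ ≤ ‖y‖ := by
  have := norm_sq_eq_dropLast y
  exact le_of_sq_le_sq (by nlinarith [sq_nonneg (y (Fin.last d))]) (norm_nonneg _)

@[simp] theorem dropLast_smul {d : ℕ} (θ : ℝ) (y : Euc (d + 1)) : dropLast (θ • y)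
    = θ • dropLast y := by
  ext l; simp [dropLast]

@[simp] theorem dropLast_zero {d : ℕ} : dropLast (0 : Euc (d + 1)) = 0 := by
  ext l; simp [dropLast]

theorem smul_appendLast {d : ℕ} (θ : ℝ) (y : Euc d) (s : ℝ) :
    θ • appendLast y s = appendLast (θ • y) (θ * s) := by
  rw [← appendLast_dropLast (θ • appendLast y s)]; simp

@[fun_prop] theorem contDiff_dropLast {d : ℕ} : ContDiff ℝ ∞ (dropLast : Euc (d + 1) → Euc d) := by
  rw [contDiff_euclidean]
  intro i
  simp only [dropLast]
  fun_prop

theorem contDiff_appendLast {d : ℕ} : ContDiff ℝ ∞ (fun p : Euc d × ℝ => appendLast p.1 p.2) := by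
  rw [contDiff_euclidean]
  intro i
  refine Fin.lastCases ?_ (fun i => ?_) i <;> simp only
      [appendLast, Fin.snoc_last, Fin.snoc_castSucc] <;> fun_prop

/-! ### Maps defined by cases on the pieces of a gluing -/

/-- The map that is `A` on `s`, transported along `φ`, and `B` outside `φ '' s`. -/
def extendOn {X Y Z : Type*} (φ : X → Y) (s : Set X) (A : X → Z) (B : Y → Z) (y : Y) : Z :=
  open Classical in if h : ∃ x ∈ s, φ x = y then A h.choose else B y

theorem extendOn_apply {X Y Z : Type*} {φ : X → Y} {s : Set X} (hφ : InjOn φ s) {A : X → Z}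
    {B : Y → Z} {x : X} (hx : x ∈ s) : extendOn φ s A B (φ x) = A x := by
  have h : ∃ x' ∈ s, φ x' = φ x := ⟨x, hx, rfl⟩
  rw [extendOn, dif_pos h, hφ h.choose_spec.1 hx h.choose_spec.2]

theorem extendOn_of_notMem {X Y Z : Type*} {φ : X → Y} {s : Set X} {A : X → Z}
    {B : Y → Z} {y : Y} (hy : ∀ x ∈ s, φ x ≠ y) : extendOn φ s A B y = B y := by
  rw [extendOn, dif_neg]
  rintro ⟨x, hx, h⟩
  exact hy x hx h

/-! ### The two ends of the unit interval -/

/-- The identity of `[0, 1]` for `a = 0`, and the reflection `t ↦ 1 - t` for `a = 1`. -/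
def flipEnd (a : Fin 2) (t : Icc (0 : ℝ) 1) : Icc (0 : ℝ) 1 :=
    if a = 0 then t else unitInterval.symm t

/-- `1` for `a = 0` and `-1` for `a = 1`. -/
def endSign (a : Fin 2) : ℝ := if a = 0 then 1 else -1

/-- The nearest-point projection of `ℝ` onto `[0, 1]`. -/
def clamp (t : ℝ) : Icc (0 : ℝ) 1 := projIcc 0 1 zero_le_one t

theorem coe_clamp {t : ℝ} (h : t ∈ Icc (0 : ℝ) 1) : (clamp t : ℝ) = t := by
  simp [clamp, projIcc_of_mem zero_le_one h]

@[simp] theorem clamp_coe (t : Icc (0 : ℝ) 1) : clamp t = t := by simp [clamp]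

theorem clamp_one_sub (t : ℝ) : clamp (1 - t) = unitInterval.symm (clamp t) := by
  apply Subtype.ext
  simp only [clamp, coe_projIcc, unitInterval.coe_symm_eq]
  rcases le_total t 0 with h | h
  · rw [min_eq_left (by linarith), min_eq_right (by linarith), max_eq_left h]; norm_num
  · rcases le_total t 1 with h' | h'
    · rw [min_eq_right (by linarith), min_eq_right h', max_eq_right (by linarith), max_eq_right h]
    · rw [min_eq_right (by linarith), min_eq_left h', max_eq_left (by linarith)]; norm_num

@[simp] theorem flipEnd_flipEnd (a : Fin 2) (t : Icc (0 : ℝ) 1) : flipEnd a (flipEnd a t) = t := by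
  unfold flipEnd; split_ifs <;> simp

theorem coe_flipEnd_sub (a : Fin 2) (t : Icc (0 : ℝ) 1) :
    (flipEnd a t : ℝ) - 1 / 2 = endSign a * (t - 1 / 2) := by
  unfold flipEnd endSign; split_ifs <;> simp; ring

theorem endSign_mul_self (a : Fin 2) : endSign a * endSign a = 1 := by
  unfold endSign; split_ifs <;> norm_num

theorem abs_endSign (a : Fin 2) : |endSign a| = 1 := by
  unfold endSign; split_ifs <;> simp

theorem clamp_cotScale_flipEnd (a : Fin 2) (L : ℝ) (t : Icc (0 : ℝ) 1) :
    clamp (cotScale L (flipEnd a t)) = flipEnd a (clamp (cotScale L t)) := by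
  unfold flipEnd
  split_ifs
  · rfl
  · rw [unitInterval.coe_symm_eq, cotScale_one_sub, clamp_one_sub]

theorem sin_pi_flipEnd (a : Fin 2) (t : Icc (0 : ℝ) 1) : sin (π * flipEnd a t) = sin (π * t) := by
  unfold flipEnd
  split_ifs
  · rfl
  · rw [unitInterval.coe_symm_eq, mul_sub, mul_one, sin_pi_sub]

theorem cos_pi_flipEnd (a : Fin 2) (t : Icc (0 : ℝ) 1) :
    cos (π * flipEnd a t) = endSign a * cos (π * t) := by
  unfold flipEnd endSign
  split_ifs
  · simp
  · rw [unitInterval.coe_symm_eq, mul_sub, mul_one, cos_pi_sub]; ring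

theorem flipEnd_mem_Ioo (a : Fin 2) {t : Icc (0 : ℝ) 1} (h : 0 < (t : ℝ) ∧ (t : ℝ) < 1) :
    0 < (flipEnd a t : ℝ) ∧ (flipEnd a t : ℝ) < 1 := by
  unfold flipEnd
  split_ifs
  · exact h
  · rw [unitInterval.coe_symm_eq]; constructor <;> linarith [h.1, h.2]

theorem exists_flipEnd {t : Icc (0 : ℝ) 1} (h : (t : ℝ) ≠ 1 / 2) :
    ∃ (a : Fin 2) (t' : Icc (0 : ℝ) 1), t = flipEnd a t' ∧ (t' : ℝ) < 1 / 2 := by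
  rcases lt_or_gt_of_ne h with h | h
  · exact ⟨0, t, by simp [flipEnd], h⟩
  · refine ⟨1, unitInterval.symm t, by simp [flipEnd], ?_⟩
    rw [unitInterval.coe_symm_eq]; linarith

theorem contMDiff_flipEnd (a : Fin 2) : ContMDiff (𝓡∂ 1) (𝓡∂ 1) ∞ (flipEnd a) := by
  intro t
  refine contMDiffWithinAt_unitInterval ?_
  have : (fun t : Icc (0 : ℝ) 1 => (flipEnd a t : ℝ)) = fun t : Icc (0 : ℝ) 1 =>
      1 / 2 + endSign a * ((t : ℝ) - 1 / 2) := by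
    funext t; rw [← coe_flipEnd_sub]; ring
  rw [this]
  exact contMDiffWithinAt_of_contDiffAt (fun t : ℝ => 1 / 2 + endSign a * (t - 1 / 2))
    (by fun_prop) (contMDiff_coe_unitInterval t)

theorem isDiffeoOnto_flipEnd (a : Fin 2) : IsDiffeoOnto (𝓡∂ 1) (𝓡∂ 1) (flipEnd a) univ :=
  ⟨flipEnd a, fun t _ => by simp, (contMDiff_flipEnd a).contMDiffOn,
      (contMDiff_flipEnd a).contMDiffOn⟩

theorem endTubes_apply {M : Type*} {k m : ℕ} (f : Sph k × Euc (m + 1) → M) (a : Fin 2)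
    (p : Sph k × Euc (m + 2)) :
    endTubes f a p = (f (p.1, dropLast p.2), flipEnd a (clamp (-(p.2 (Fin.last (m + 1))) / 2))) :=
        by
  fin_cases a
  · rfl
  · simp only [endTubes, flipEnd, ← clamp_one_sub, Fin.mk_one, Matrix.cons_val_one]
    refine Prod.ext rfl ?_
    simp [clamp, neg_div]

/-! ### Surgery on `M`, with handles attached to `M × [0, 1]` -/

/-- A surgery producing `N` from `M` along `f`, together with a manifold `W` obtained from
`M × [0, 1]` by attaching handles at both ends along the thickenings of `f`. The gluing maps are
part of the data: `iN`, `iW` on the old pieces, `jN`, `jW a` on the handles. -/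
structure DoubleTrace {E H E' H' E'' H'' : Type*}
    [NormedAddCommGroup E] [NormedSpace ℝ E] [TopologicalSpace H]
    [NormedAddCommGroup E'] [NormedSpace ℝ E'] [TopologicalSpace H']
    [NormedAddCommGroup E''] [NormedSpace ℝ E''] [TopologicalSpace H'']
    (I : ModelWithCorners ℝ E H) (I' : ModelWithCorners ℝ E' H') (J : ModelWithCorners ℝ E'' H'')
    (M N W : Type*) [TopologicalSpace M] [ChartedSpace H M] [TopologicalSpace N] [ChartedSpace H' N]
    [TopologicalSpace W] [ChartedSpace H'' W] (k m : ℕ) where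
  f : Sph k × Euc (m + 1) → M
  iN : M → N
  jN : Euc (k + 1) × Sph m → N
  iW : M × Icc (0 : ℝ) 1 → W
  jW : Fin 2 → Euc (k + 1) × Sph (m + 1) → W
  gluingN : IsGluing I I' univ (fun _ : Unit => f) iN (fun _ => jN)
  gluingW : IsGluing (I.prod (𝓡∂ 1)) J (lowerHalf (m + 1)) (endTubes f) iW jW

namespace DoubleTrace

variable {E H E' H' E'' H'' : Type*}
    [NormedAddCommGroup E] [NormedSpace ℝ E] [TopologicalSpace H]
    [NormedAddCommGroup E'] [NormedSpace ℝ E'] [TopologicalSpace H']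
    [NormedAddCommGroup E''] [NormedSpace ℝ E''] [TopologicalSpace H'']
    {I : ModelWithCorners ℝ E H} {I' : ModelWithCorners ℝ E' H'} {J : ModelWithCorners ℝ E'' H''}
    {M N W : Type*} [TopologicalSpace M] [ChartedSpace H M] [TopologicalSpace N] [ChartedSpace H' N]
    [TopologicalSpace W] [ChartedSpace H'' W] {k m : ℕ} (D : DoubleTrace I I' J M N W k m)

/-- The core `f(S^k × {0})` of the surgery. -/
def core : Set M := cores (fun _ : Unit => D.f)

/-- The two cores in `M × [0, 1]`, one at each end. -/
def endCores : Set (M × Icc (0 : ℝ) 1) := cores (endTubes D.f)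

theorem mem_core {x : M} : x ∈ D.core ↔ ∃ u, x = D.f (u, 0) := by
  simp [core, cores]

theorem mem_endCores {q : M × Icc (0 : ℝ) 1} :
    q ∈ D.endCores ↔ q.1 ∈ D.core ∧ ((q.2 : ℝ) = 0 ∨ (q.2 : ℝ) = 1) := by
  have h0 : clamp (-0 / 2) = 0 := by
    apply Subtype.ext; rw [coe_clamp (by simp)]; simp
  simp only [endCores, cores, mem_ofPred_eq, endTubes_apply, Prod.ext_iff, dropLast_zero,
    PiLp.zero_apply, h0, mem_core]
  constructor
  · rintro ⟨a, u, h1, h2⟩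
    refine ⟨⟨u, h1⟩, ?_⟩
    rw [h2]; unfold flipEnd; split_ifs <;> simp
  · rintro ⟨⟨u, hu⟩, h | h⟩
    · exact ⟨0, u, hu, Subtype.ext (by simp [flipEnd, h])⟩
    · exact ⟨1, u, hu, Subtype.ext (by simp [flipEnd, h])⟩

theorem notMem_endCores_of_notMem {x : M} (hx : x ∉ D.core) (t : Icc (0 : ℝ) 1) :
    (x, t) ∈ D.endCoresᶜ := fun h => hx (D.mem_endCores.1 h).1

theorem notMem_endCores_of_Ioo (x : M) {t : Icc (0 : ℝ) 1} (ht : 0 < (t : ℝ) ∧ (t : ℝ) < 1) :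
    (x, t) ∈ D.endCoresᶜ := fun h => by
  rcases (D.mem_endCores.1 h).2 with h | h <;> simp only at h <;> linarith [ht.1, ht.2]

theorem diffeo_f : IsDiffeoOnto ((𝓡 k).prod 𝓘(ℝ, Euc (m + 1))) I D.f (tube k m univ) :=
  D.gluingN.diffeo_f ()

theorem isOpen_f : IsOpen (D.f '' tube k m univ) := D.gluingN.isOpen_f ()

theorem diffeo_jN : IsDiffeoOnto (𝓘(ℝ, Euc (k + 1)).prod (𝓡 m)) I' D.jN (handle k m univ) :=
  D.gluingN.diffeo_j ()

theorem isOpen_jN : IsOpen (D.jN '' handle k m univ) := D.gluingN.isOpen_j ()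

theorem diffeo_iN : IsDiffeoOnto I I' D.iN D.coreᶜ := D.gluingN.diffeo_i

theorem diffeo_iW : IsDiffeoOnto (I.prod (𝓡∂ 1)) J D.iW D.endCoresᶜ := D.gluingW.diffeo_i

theorem mem_tube {u : Sph k} {y : Euc (m + 1)} (h : ‖y‖ < 1) : (u, y) ∈ tube k m univ :=
  ⟨h, mem_univ _⟩

theorem mem_handle {x : Euc (k + 1)} {v : Sph m} (h : ‖x‖ < 1) : (x, v) ∈ handle k m univ :=
  ⟨h, mem_univ _⟩

theorem f_notMem_core {u : Sph k} {y : Euc (m + 1)} (h : ‖y‖ < 1) (h0 : y ≠ 0) :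
    D.f (u, y) ∉ D.core := by
  rw [mem_core]
  rintro ⟨u', h'⟩
  have := D.diffeo_f.injOn (mem_tube h) (mem_tube (by simp)) h'
  exact h0 (Prod.ext_iff.1 this).2

theorem iN_f {u : Sph k} {y : Euc (m + 1)} (h : ‖y‖ < 1) (h0 : y ≠ 0) :
    D.iN (D.f (u, y)) = D.jN (‖y‖ • (u : Euc (k + 1)), dir y) := by
  have := D.gluingN.glue () u (dir y) ‖y‖ (norm_pos_iff.2 h0) h (mem_univ _)
  rwa [norm_smul_dir] at this

theorem jN_eq_iN {x : Euc (k + 1)} (v : Sph m) (hx : x ≠ 0) (h : ‖x‖ < 1) :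
    D.jN (x, v) = D.iN (D.f (dir x, ‖x‖ • (v : Euc (m + 1)))) := by
  have := D.gluingN.glue () (dir x) v ‖x‖ (norm_pos_iff.2 hx) h (mem_univ _)
  rwa [norm_smul_dir, eq_comm] at this

theorem exists_N (y : N) : (∃ x ∉ D.core, y = D.iN x) ∨ ∃ v, y = D.jN (0, v) := by
  have hy : y ∈ D.iN '' D.coreᶜ ∪ ⋃ _ : Unit, D.jN '' handle k m univ :=
    D.gluingN.cover ▸ mem_univ y
  simp only [iUnion_const] at hy
  rcases hy with ⟨x, hx, rfl⟩ | ⟨⟨x, v⟩, hx, rfl⟩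
  · exact Or.inl ⟨x, hx, rfl⟩
  · by_cases h0 : x = 0
    · exact Or.inr ⟨v, by rw [h0]⟩
    · refine Or.inl ⟨_, ?_, D.jN_eq_iN v h0 hx.1⟩
      have h1 : ‖x‖ ≠ 0 := norm_ne_zero_iff.2 h0
      exact D.f_notMem_core (by simpa [norm_smul] using hx.1) (smul_ne_zero h1 (coe_sph_ne_zero v))

theorem iN_ne_jN_zero {x : M} (hx : x ∉ D.core) (v : Sph m) : D.iN x ≠ D.jN (0, v) := by
  intro h
  obtain ⟨u, θ, h0, -, -, h2⟩ := D.gluingN.overlap x hx () (0, v) (mem_handle (by simp)) h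
  exact smul_ne_zero h0.ne' (coe_sph_ne_zero u) h2.symm

/-- The attaching relation at the end `a`, in homogeneous coordinates: the point of the handle in
the direction `Y`, at `‖Y‖ • x`, is the point of `M × [0, 1]` at distance `‖x‖ * ‖Y‖` from the core.
-/
theorem jW_eq_iW (a : Fin 2) {x : Euc (k + 1)} {Y : Euc (m + 2)} (hx : x ≠ 0) (hY : Y ≠ 0)
    (hl : Y (Fin.last (m + 1)) ≤ 0) (h1 : ‖x‖ * ‖Y‖ < 1) :
    D.jW a (‖Y‖ • x, dir Y) = D.iW (D.f (dir x, ‖x‖ • dropLast Y),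
      flipEnd a (clamp (-(‖x‖ * Y (Fin.last (m + 1))) / 2))) := by
  have hY' := norm_pos_iff.2 hY
  have := D.gluingW.glue a (dir x) (dir Y) (‖x‖ * ‖Y‖) (mul_pos (norm_pos_iff.2 hx) hY') h1 (by
    rw [coe_dir hY]
    exact mul_nonpos_of_nonneg_of_nonpos (inv_nonneg.2 hY'.le) hl)
  rw [mul_smul, norm_smul_dir, endTubes_apply, mul_comm, mul_smul, norm_smul_dir, eq_comm] at this
  simpa using this

theorem jW_eq_iW' (a : Fin 2) {x : Euc (k + 1)} {v : Sph (m + 1)} (hx : x ≠ 0)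
    (hq : (x, v) ∈ handle k (m + 1) (lowerHalf (m + 1))) :
    D.jW a (x, v) = D.iW (D.f (dir x, ‖x‖ • dropLast (v : Euc (m + 2))),
      flipEnd a (clamp (-(‖x‖ * (v : Euc (m + 2)) (Fin.last (m + 1))) / 2))) := by
  have := D.jW_eq_iW a hx (coe_sph_ne_zero v) hq.2 (by simpa using hq.1)
  rwa [dir_coe, norm_coe_sph, one_smul] at this

theorem neg_last_le_one (v : Sph (m + 1)) : -((v : Euc (m + 2)) (Fin.last (m + 1))) ≤ 1 := by
  have h := norm_sq_eq_dropLast (v : Euc (m + 2))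
  rw [norm_coe_sph] at h
  nlinarith [sq_nonneg ‖dropLast (v : Euc (m + 2))‖]

theorem norm_dropLast_coe_le_one (v : Sph (m + 1)) : ‖dropLast (v : Euc (m + 2))‖ ≤ 1 := by
  simpa using norm_dropLast_le (v : Euc (m + 2))

theorem last_ne_zero_of_dropLast {d : ℕ} {v : Sph d} (h : dropLast (v : Euc (d + 1)) = 0) :
    (v : Euc (d + 1)) (Fin.last d) ^ 2 = 1 := by
  have h' := norm_sq_eq_dropLast (v : Euc (d + 1))
  rw [norm_coe_sph, h] at h'
  simpa using h'.symm

/-- The time coordinate of a point of the handle lies in `[0, 1/2)`. -/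
theorem time_mem {x : Euc (k + 1)} {v : Sph (m + 1)}
    (hq : (x, v) ∈ handle k (m + 1) (lowerHalf (m + 1))) :
    0 ≤ -(‖x‖ * (v : Euc (m + 2)) (Fin.last (m + 1))) / 2 ∧
      -(‖x‖ * (v : Euc (m + 2)) (Fin.last (m + 1))) / 2 < 1 / 2 := by
  have h1 : ‖x‖ < 1 := hq.1
  have h2 : (v : Euc (m + 2)) (Fin.last (m + 1)) ≤ 0 := hq.2
  have h3 := neg_last_le_one v
  have h4 := norm_nonneg x
  constructor <;> nlinarith

theorem clamp_time {x : Euc (k + 1)} {v : Sph (m + 1)}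
    (hq : (x, v) ∈ handle k (m + 1) (lowerHalf (m + 1))) :
    (clamp (-(‖x‖ * (v : Euc (m + 2)) (Fin.last (m + 1))) / 2) : ℝ) =
      -(‖x‖ * (v : Euc (m + 2)) (Fin.last (m + 1))) / 2 :=
  coe_clamp ⟨(time_mem hq).1, by linarith [(time_mem hq).2]⟩

/-- Off the centres `{0} × S_-^(m+1)` of the handles a point of a handle comes from `M × [0, 1]`. -/
theorem jW_source_notMem (a : Fin 2) {x : Euc (k + 1)} {v : Sph (m + 1)} (hx : x ≠ 0)
    (hq : (x, v) ∈ handle k (m + 1) (lowerHalf (m + 1))) :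
    (D.f (dir x, ‖x‖ • dropLast (v : Euc (m + 2))),
      flipEnd a (clamp (-(‖x‖ * (v : Euc (m + 2)) (Fin.last (m + 1))) / 2))) ∈ D.endCoresᶜ := by
  have h1 : ‖x‖ < 1 := hq.1
  have h0 := norm_pos_iff.2 hx
  by_cases hv : dropLast (v : Euc (m + 2)) = 0
  · apply D.notMem_endCores_of_Ioo
    apply flipEnd_mem_Ioo
    rw [clamp_time hq]
    have h2 := last_ne_zero_of_dropLast hv
    have h3 : (v : Euc (m + 2)) (Fin.last (m + 1)) ≤ 0 := hq.2
    have h4 := time_mem hq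
    refine ⟨?_, by linarith⟩
    have : (v : Euc (m + 2)) (Fin.last (m + 1)) < 0 := lt_of_le_of_ne h3 (by
      intro h; rw [h] at h2; norm_num at h2)
    nlinarith
  · apply D.notMem_endCores_of_notMem
    apply D.f_notMem_core
    · rw [norm_smul, norm_norm]
      nlinarith [norm_dropLast_coe_le_one v, norm_nonneg (dropLast (v : Euc (m + 2)))]
    · exact smul_ne_zero h0.ne' hv

theorem exists_W (p : W) : (∃ q ∈ D.endCoresᶜ, p = D.iW q) ∨
    ∃ (a : Fin 2) (v : Sph (m + 1)), (v : Euc (m + 2)) (Fin.last (m + 1)) ≤ 0 ∧ p = D.jW a (0, v) :=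
        by
  have hp : p ∈ D.iW '' D.endCoresᶜ ∪ ⋃ a, D.jW a '' handle k (m + 1) (lowerHalf (m + 1)) :=
    D.gluingW.cover ▸ mem_univ p
  rcases hp with ⟨x, hx, rfl⟩ | hp
  · exact Or.inl ⟨x, hx, rfl⟩
  · obtain ⟨a, ⟨x, v⟩, hx, rfl⟩ := mem_iUnion.1 hp
    by_cases h0 : x = 0
    · exact Or.inr ⟨a, v, hx.2, by rw [h0]⟩
    · exact Or.inl ⟨_, D.jW_source_notMem a h0 hx, D.jW_eq_iW' a h0 hx⟩

theorem iW_ne_jW_zero {q : M × Icc (0 : ℝ) 1} (hq : q ∈ D.endCoresᶜ) (a : Fin 2) {v : Sph (m + 1)}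
    (hv : (v : Euc (m + 2)) (Fin.last (m + 1)) ≤ 0) : D.iW q ≠ D.jW a (0, v) := by
  intro h
  obtain ⟨u, θ, h0, -, -, h2⟩ := D.gluingW.overlap q hq a (0, v) ⟨by simp, hv⟩ h
  exact smul_ne_zero h0.ne' (coe_sph_ne_zero u) h2.symm

theorem jW_injective {a b : Fin 2} {p q : Euc (k + 1) × Sph (m + 1)}
    (hp : p ∈ handle k (m + 1) (lowerHalf (m + 1))) (hq : q ∈ handle k (m + 1) (lowerHalf (m + 1)))
    (h : D.jW a p = D.jW b q) : a = b := by
  by_contra hab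
  exact Set.disjoint_left.1 (D.gluingW.disjoint_j a b hab) (mem_image_of_mem _ hp)
    (h ▸ mem_image_of_mem _ hq)

/-- The map out of `W` that is `A` on the part coming from `M × [0, 1]`, and `B a` on the centre of
the handle at the end `a`. -/
def glued {Z : Type*} (A : M × Icc (0 : ℝ) 1 → Z) (B : Fin 2 → Euc (k + 1) × Sph (m + 1) → Z) :
    W → Z :=
  extendOn D.iW D.endCoresᶜ A (extendOn (D.jW 0) (handle k (m + 1) (lowerHalf (m + 1))) (B 0)
    (extendOn (D.jW 1) (handle k (m + 1) (lowerHalf (m + 1))) (B 1)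
      fun _ => B 0 (0, ⟨EuclideanSpace.single 0 1, by simp⟩)))

theorem glued_iW {Z : Type*} {A : M × Icc (0 : ℝ) 1 → Z} {B : Fin 2 → Euc (k + 1) × Sph (m + 1) → Z}
    {q : M × Icc (0 : ℝ) 1} (hq : q ∈ D.endCoresᶜ) : D.glued A B (D.iW q) = A q :=
  extendOn_apply D.diffeo_iW.injOn hq

theorem glued_jW_zero {Z : Type*} {A : M × Icc (0 : ℝ) 1 → Z}
    {B : Fin 2 → Euc (k + 1) × Sph (m + 1) → Z} (a : Fin 2) {v : Sph (m + 1)}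
    (hv : (v : Euc (m + 2)) (Fin.last (m + 1)) ≤ 0) : D.glued A B (D.jW a (0, v)) = B a (0, v) := by
  have hm : ((0, v) : Euc (k + 1) × Sph (m + 1)) ∈ handle k (m + 1) (lowerHalf (m + 1)) :=
      ⟨by simp, hv⟩
  rw [glued, extendOn_of_notMem fun q hq => D.iW_ne_jW_zero hq a hv]
  fin_cases a
  · exact extendOn_apply (D.gluingW.diffeo_j 0).injOn hm
  · rw [extendOn_of_notMem fun q hq h => absurd (D.jW_injective hq hm h) (by simp)]
    exact extendOn_apply (D.gluingW.diffeo_j 1).injOn hm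

/-! ### The comparison of `W` with `N × [0, 1]` -/

/-- The cut-off distance to the core: a positive smooth function on the complement of the core. In
the tube it is a function of the norm of the second coordinate, equal to it near the core; outside
the tube it is `1`. -/
def coreDist : M → ℝ := extendOn D.f (tube k m univ) (fun p => radialCutoff ‖p.2‖) (fun _ => 1)

theorem coreDist_f {u : Sph k} {y : Euc (m + 1)} (h : ‖y‖ < 1) :
    D.coreDist (D.f (u, y)) = radialCutoff ‖y‖ :=
  extendOn_apply D.diffeo_f.injOn (mem_tube h)

theorem coreDist_pos {x : M} (hx : x ∉ D.core) : 0 < D.coreDist x := by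
  by_cases h : ∃ p ∈ tube k m univ, D.f p = x
  · obtain ⟨⟨u, y⟩, hp, rfl⟩ := h
    rw [D.coreDist_f hp.1]
    refine radialCutoff_pos (norm_pos_iff.2 ?_)
    rintro rfl
    exact hx (D.mem_core.2 ⟨u, rfl⟩)
  · push Not at h
    rw [coreDist, extendOn_of_notMem h]
    norm_num

/-- The time coordinate in `N × [0, 1]` of the point `(x, Y)` of a handle. For `x ≠ 0` this is
`cotScale` with parameter `‖x‖ * ‖dropLast Y‖` at the time `-‖x‖ * Y_last / 2`; dividing numerator
and denominator of the tangent by `‖x‖` gives a formula that is smooth also at `x = 0`. -/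
def capTime (p : Euc (k + 1) × Euc (m + 2)) : ℝ :=
  arctan (-(π * p.2 (Fin.last (m + 1)) / 2) * sinc ‖(-(π * p.2 (Fin.last (m + 1)) / 2)) • p.1‖ /
    (cos ‖(-(π * p.2 (Fin.last (m + 1)) / 2)) • p.1‖ * ‖dropLast p.2‖)) / π

/-- The map `flat` on a handle, off the axis `dropLast v = 0` and near the centre. -/
def capFlat (a : Fin 2) (q : Euc (k + 1) × Sph (m + 1)) : N × Icc (0 : ℝ) 1 :=
  (D.jN (‖dropLast (q.2 : Euc (m + 2))‖ • q.1, dir (dropLast (q.2 : Euc (m + 2)))),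
    flipEnd a (clamp (capTime (q.1, (q.2 : Euc (m + 2))))))

/-- The map from `W`, minus the core sphere, to `N × [0, 1]`. Over `M` minus the core it rescales
the time coordinate by means of `cotScale`, with the distance `r` to the core as parameter: near the
core the half-plane with coordinates `r > 0` and `κ = cot (π t)` is mapped to the points
`(r, r * κ)`, which makes room for the fibre `r = 0` of `N × [0, 1]`. -/
def flat : W → N × Icc (0 : ℝ) 1 :=
  D.glued (fun q => (D.iN q.1, clamp (cotScale (D.coreDist q.1) q.2))) D.capFlat

theorem flat_iW {q : M × Icc (0 : ℝ) 1} (hq : q ∈ D.endCoresᶜ) :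
    D.flat (D.iW q) = (D.iN q.1, clamp (cotScale (D.coreDist q.1) q.2)) := D.glued_iW hq

theorem flat_jW (a : Fin 2) {x : Euc (k + 1)} {v : Sph (m + 1)}
    (hq : (x, v) ∈ handle k (m + 1) (lowerHalf (m + 1))) (hv : dropLast (v : Euc (m + 2)) ≠ 0)
    (h4 : ‖x‖ * ‖dropLast (v : Euc (m + 2))‖ ≤ 1 / 4) :
    D.flat (D.jW a (x, v)) = D.capFlat a (x, v) := by
  by_cases hx : x = 0
  · subst hx
    exact D.glued_jW_zero a hq.2
  have hx0 := norm_pos_iff.2 hx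
  have hv0 := norm_pos_iff.2 hv
  have ht := time_mem hq
  have hn : ‖‖x‖ • dropLast (v : Euc (m + 2))‖ = ‖x‖ * ‖dropLast (v : Euc (m + 2))‖ := by
    rw [norm_smul, norm_norm]
  have h1 : ‖‖x‖ • dropLast (v : Euc (m + 2))‖ < 1 := by rw [hn]; linarith
  have h0 : ‖x‖ • dropLast (v : Euc (m + 2)) ≠ 0 := smul_ne_zero hx0.ne' hv
  rw [D.jW_eq_iW' a hx hq, D.flat_iW (D.jW_source_notMem a hx hq)]
  simp only
  rw [D.iN_f h1 h0, D.coreDist_f h1, hn, radialCutoff_of_le h4, clamp_cotScale_flipEnd,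
    clamp_time hq, cotScale_eq_tan (by positivity) ht.1 ht.2, capFlat]
  refine Prod.ext ?_ ?_
  · simp only
    rw [dir_smul hx0, mul_comm, mul_smul, norm_smul_dir]
  · simp only [capTime]
    set s := (v : Euc (m + 2)) (Fin.last (m + 1)) with hs
    have hs0 : s ≤ 0 := hq.2
    have hβ : 0 ≤ -(π * s / 2) := by nlinarith [pi_pos]
    have e1 : ‖(-(π * s / 2)) • x‖ = -(π * s / 2) * ‖x‖ := by
      rw [norm_smul, Real.norm_of_nonneg hβ]
    have e2 : π * (-(‖x‖ * s) / 2) = -(π * s / 2) * ‖x‖ := by ring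
    rw [e1, e2, tan_eq_sin_div_cos, ← mul_sinc]
    congr 4
    field_simp

/-- The vector `Y` for which `polar a (x, Y)` is the point of `W` that `flat` sends to
`(jN (x, v), flipEnd a t)`, for `t < 1/2` and `x` near `0`. -/
def unflatVec (p : (Euc (k + 1) × Euc (m + 1)) × ℝ) : Euc (m + 2) :=
  appendLast p.1.2 (-(2 * (tan (π * p.2) * atanc ‖tan (π * p.2) • p.1.1‖ / π)))

/-- The point of the handle at the end `a` with homogeneous coordinates `(x, Y)`, where `Y ≠ 0` need
not be a unit vector: `(x, Y)` and `(c⁻¹ • x, c • Y)` give the same point for `c > 0`. -/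
def polar (a : Fin 2) (p : Euc (k + 1) × Euc (m + 2)) : W := D.jW a (‖p.2‖ • p.1, dir p.2)

/-- The inverse of `flat`, on the complement of `middle`. -/
def unflat (q : N × Icc (0 : ℝ) 1) : W :=
  extendOn D.iN D.coreᶜ (fun x => D.iW (x, clamp (cotScale (D.coreDist x)⁻¹ q.2)))
    (extendOn D.jN (handle k m univ)
      (fun p => if (q.2 : ℝ) < 1 / 2 then D.polar 0
          (p.1, unflatVec ((p.1, (p.2 : Euc (m + 1))), q.2))
        else D.polar 1 (p.1, unflatVec ((p.1, (p.2 : Euc (m + 1))), unitInterval.symm q.2)))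
      (fun _ => D.jW 0 (0, ⟨EuclideanSpace.single 0 1, by simp⟩))) q.1

theorem unflat_iN {x : M} (hx : x ∉ D.core) (t : Icc (0 : ℝ) 1) :
    D.unflat (D.iN x, t) = D.iW (x, clamp (cotScale (D.coreDist x)⁻¹ t)) :=
  extendOn_apply D.diffeo_iN.injOn hx

theorem appendLast_ne_zero {d : ℕ} {y : Euc d} (hy : y ≠ 0) (s : ℝ) : appendLast y s ≠ 0 := by
  intro h
  apply hy
  rw [← dropLast_appendLast y s, h, dropLast_zero]

theorem appendLast_ne_zero' {d : ℕ} (y : Euc d) {s : ℝ} (hs : s ≠ 0) : appendLast y s ≠ 0 := by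
  intro h
  apply hs
  rw [← appendLast_last y s, h, PiLp.zero_apply]

theorem tan_pi_nonneg {t : ℝ} (h0 : 0 ≤ t) (h1 : t < 1 / 2) : 0 ≤ tan (π * t) :=
  tan_nonneg_of_nonneg_of_le_pi_div_two (by positivity) (by nlinarith [pi_pos])

theorem unflatVec_last_nonpos (x : Euc (k + 1)) (v : Euc (m + 1)) {t : ℝ} (h0 : 0 ≤ t)
    (h1 : t < 1 / 2) : unflatVec ((x, v), t) (Fin.last (m + 1)) ≤ 0 := by
  have h2 := tan_pi_nonneg h0 h1
  have h3 := (atanc_pos ‖tan (π * t) • x‖).le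
  simp only [unflatVec, appendLast_last, Left.neg_nonpos_iff]
  positivity

theorem unflatVec_ne_zero (x : Euc (k + 1)) (v : Sph m) (t : ℝ) :
    unflatVec ((x, (v : Euc (m + 1))), t) ≠ 0 :=
  appendLast_ne_zero (coe_sph_ne_zero v) _

theorem unflat_jN (a : Fin 2) {x : Euc (k + 1)} (v : Sph m) {t : Icc (0 : ℝ) 1}
    (ht : (t : ℝ) < 1 / 2) (hx4 : ‖x‖ ≤ 1 / 4)
    (hY : ‖x‖ * ‖unflatVec ((x, (v : Euc (m + 1))), (t : ℝ))‖ < 1) :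
    D.unflat (D.jN (x, v), flipEnd a t) =
      D.polar a (x, unflatVec ((x, (v : Euc (m + 1))), (t : ℝ))) := by
  have hx1 : ‖x‖ < 1 := by linarith
  by_cases hx : x = 0
  · subst hx
    rw [unflat, extendOn_of_notMem (φ := D.iN) (s := D.coreᶜ) fun x hx => D.iN_ne_jN_zero hx v]
    simp only
    rw [extendOn_apply D.diffeo_jN.injOn (mem_handle hx1)]
    fin_cases a
    · simp only [flipEnd, Fin.zero_eta, ↓reduceIte, ht]
    · have : ¬ (1 - (t : ℝ) < 1 / 2) := by linarith
      simp only [flipEnd, Fin.mk_one, one_ne_zero, ↓reduceIte, unitInterval.coe_symm_eq,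
        unitInterval.symm_symm, this, Fin.isValue]
  · have hx0 := norm_pos_iff.2 hx
    have hxv : ‖‖x‖ • (v : Euc (m + 1))‖ = ‖x‖ := by rw [norm_smul, norm_norm]; simp
    have hf := D.f_notMem_core (u := dir x) (y := ‖x‖ • (v : Euc (m + 1))) (by rwa [hxv])
      (smul_ne_zero hx0.ne' (coe_sph_ne_zero v))
    rw [D.jN_eq_iN v hx hx1, D.unflat_iN hf, polar]
    simp only
    rw [D.jW_eq_iW a hx (unflatVec_ne_zero x v t)
      (unflatVec_last_nonpos _ _ t.2.1 ht) hY, clamp_cotScale_flipEnd, D.coreDist_f (by rwa [hxv]),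
      hxv, radialCutoff_of_le hx4, cotScale_eq_tan (by positivity) t.2.1 ht]
    have h1 : ‖tan (π * t) • x‖ = tan (π * t) * ‖x‖ := by
      rw [norm_smul, Real.norm_of_nonneg (tan_pi_nonneg t.2.1 ht)]
    have h2 : tan (π * t) / ‖x‖⁻¹ = tan (π * t) * ‖x‖ := by field_simp
    rw [unflatVec, dropLast_appendLast, appendLast_last]
    simp only
    rw [h1, h2, ← mul_atanc]
    congr 4
    ring

/-! ### The embedded sphere -/

/-- The vector `Y` for which `polar a (dropLast w, Y)` is the image under `bridge` of `(w, y)`, for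
`w` near the pole of `S^(k+1)` at the end `a`. -/
def bridgeVec (p : Euc (k + 2) × Euc (m + 1)) : Euc (m + 2) :=
  appendLast ((1 / 4 : ℝ) • p.2)
    (-(2 * (atanc ‖(p.1 (Fin.last (k + 1)))⁻¹ • dropLast p.1‖ / (π * |p.1 (Fin.last (k + 1))|))))

/-- The embedding of `S^(k+1) × B^(m+1)` into `W` along which surgery is performed. Its restriction
to `S^(k+1) × {0}` consists of the cylinder `core × (0, 1)`, closed at the two ends by the core
discs of the handles. Off the poles, `w = (sin (π t) u, cos (π t))` corresponds to the point `u` of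
`S^k` at time `t`, and the fibre coordinate `y` is scaled by `sin (π t) / 4`. -/
def bridge (p : Sph (k + 1) × Euc (m + 1)) : W :=
  open Classical in
  if dropLast (p.1 : Euc (k + 2)) = 0 then
    if 0 < (p.1 : Euc (k + 2)) (Fin.last (k + 1)) then
      D.polar 0 (dropLast (p.1 : Euc (k + 2)), bridgeVec ((p.1 : Euc (k + 2)), p.2))
    else D.polar 1 (dropLast (p.1 : Euc (k + 2)), bridgeVec ((p.1 : Euc (k + 2)), p.2))
  else D.iW (D.f (dir (dropLast (p.1 : Euc (k + 2))), (‖dropLast (p.1 : Euc (k + 2))‖ / 4) • p.2),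
    clamp (arccos ((p.1 : Euc (k + 2)) (Fin.last (k + 1))) / π))

theorem bridge_of_ne {w : Sph (k + 1)} (hw : dropLast (w : Euc (k + 2)) ≠ 0) (y : Euc (m + 1)) :
    D.bridge (w, y) = D.iW (D.f (dir (dropLast (w : Euc (k + 2))),
      (‖dropLast (w : Euc (k + 2))‖ / 4) • y),
      clamp (arccos ((w : Euc (k + 2)) (Fin.last (k + 1))) / π)) := by
  simp [bridge, hw]

theorem arccos_div_pi_mem (c : ℝ) : arccos c / π ∈ Icc (0 : ℝ) 1 :=
  ⟨div_nonneg (arccos_nonneg c) pi_pos.le, (div_le_one pi_pos).2 (arccos_le_pi c)⟩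

theorem sphere_coords {d : ℕ} (w : Sph d) :
    ‖dropLast (w : Euc (d + 1))‖ = √(1 - (w : Euc (d + 1)) (Fin.last d) ^ 2) := by
  have h := norm_sq_eq_dropLast (w : Euc (d + 1))
  rw [norm_coe_sph] at h
  rw [show 1 - (w : Euc (d + 1)) (Fin.last d) ^ 2 = ‖dropLast (w : Euc (d + 1))‖ ^ 2 by linarith,
    sqrt_sq (norm_nonneg _)]

theorem clamp_arccos (a : Fin 2) (c : ℝ) (hc : 0 < endSign a * c) :
    clamp (arccos c / π) = flipEnd a (clamp (arctan (√(1 - c ^ 2) / |c|) / π)) := by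
  unfold endSign at hc
  unfold flipEnd
  split_ifs at hc ⊢ with h
  · rw [one_mul] at hc
    rw [arccos_eq_arctan hc, abs_of_pos hc]
  · have hc' : 0 < -c := by linarith
    rw [← clamp_one_sub, abs_of_neg (by linarith), ← neg_sq c, ← arccos_eq_arctan hc', arccos_neg]
    congr 1
    field_simp; ring

theorem bridgeVec_ne_zero {w : Euc (k + 2)} (hw : w (Fin.last (k + 1)) ≠ 0) (y : Euc (m + 1)) :
    bridgeVec (w, y) ≠ 0 := by
  refine appendLast_ne_zero' _ (neg_ne_zero.2 ?_)
  have := atanc_pos ‖(w (Fin.last (k + 1)))⁻¹ • dropLast w‖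
  have := abs_pos.2 hw
  positivity

theorem bridgeVec_last_nonpos (w : Euc (k + 2)) (y : Euc (m + 1)) :
    bridgeVec (w, y) (Fin.last (m + 1)) ≤ 0 := by
  have := (atanc_pos ‖(w (Fin.last (k + 1)))⁻¹ • dropLast w‖).le
  simp only [bridgeVec, appendLast_last, Left.neg_nonpos_iff]
  positivity

theorem bridge_pole (a : Fin 2) {w : Sph (k + 1)}
    (hw : 0 < endSign a * (w : Euc (k + 2)) (Fin.last (k + 1))) {y : Euc (m + 1)}
    (h1 : ‖dropLast (w : Euc (k + 2))‖ * ‖bridgeVec ((w : Euc (k + 2)), y)‖ < 1) :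
    D.bridge (w, y) = D.polar a (dropLast (w : Euc (k + 2)), bridgeVec ((w : Euc (k + 2)), y)) := by
  have hc : (w : Euc (k + 2)) (Fin.last (k + 1)) ≠ 0 := by
    intro h; rw [h, mul_zero] at hw; exact hw.false
  by_cases hw0 : dropLast (w : Euc (k + 2)) = 0
  · unfold endSign at hw
    fin_cases a
    · have : 0 < (w : Euc (k + 2)) (Fin.last (k + 1)) := by simpa using hw
      simp [bridge, hw0, this]
    · have : ¬ 0 < (w : Euc (k + 2)) (Fin.last (k + 1)) := by simpa using hw.le
      simp [bridge, hw0, this]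
  · rw [D.bridge_of_ne hw0, polar]
    simp only
    rw [D.jW_eq_iW a hw0 (bridgeVec_ne_zero hc y) (bridgeVec_last_nonpos _ _) h1, bridgeVec,
      dropLast_appendLast, appendLast_last, clamp_arccos a _ hw, ← sphere_coords]
    simp only
    set c := (w : Euc (k + 2)) (Fin.last (k + 1))
    set r := ‖dropLast (w : Euc (k + 2))‖
    have h2 : ‖c⁻¹ • dropLast (w : Euc (k + 2))‖ = r / |c| := by
      rw [norm_smul, norm_inv, Real.norm_eq_abs]; ring
    have hc' := abs_pos.2 hc
    have h3 : -(r * -(2 * (atanc (r / |c|) / (π * |c|)))) / 2 = r / |c| * atanc (r / |c|) / π := by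
      field_simp
    rw [h2, h3, ← mul_atanc, smul_smul, mul_one_div]

theorem pole_sign {w : Sph (k + 1)} (hw : dropLast (w : Euc (k + 2)) = 0) :
    ∃ a, (w : Euc (k + 2)) (Fin.last (k + 1)) = endSign a := by
  have h := last_ne_zero_of_dropLast hw
  rcases sq_eq_one_iff.1 h with h | h
  · exact ⟨0, by simp [endSign, h]⟩
  · exact ⟨1, by simp [endSign, h]⟩

theorem bridge_of_eq (a : Fin 2) {w : Sph (k + 1)} (hw : dropLast (w : Euc (k + 2)) = 0)
    (ha : (w : Euc (k + 2)) (Fin.last (k + 1)) = endSign a) (y : Euc (m + 1)) :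
    D.bridge (w, y) = D.jW a (0, dir (appendLast ((1 / 4 : ℝ) • y) (-(2 / π)))) := by
  rw [D.bridge_pole a (by rw [ha, endSign_mul_self]; norm_num) (by simp [hw]), polar, bridgeVec]
  simp [hw, ha, abs_endSign, atanc_zero, div_eq_mul_inv]

/-- The inverse of `bridge` on a handle. -/
def capUnbridge (a : Fin 2) (q : Euc (k + 1) × Sph (m + 1)) : Sph (k + 1) × Euc (m + 1) :=
  (dir (appendLast ((-(π * (q.2 : Euc (m + 2)) (Fin.last (m + 1)) / 2) *
      sinc ‖(-(π * (q.2 : Euc (m + 2)) (Fin.last (m + 1)) / 2)) • q.1‖) • q.1)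
      (endSign a * cos ‖(-(π * (q.2 : Euc (m + 2)) (Fin.last (m + 1)) / 2)) • q.1‖)),
    (4 / (-(π * (q.2 : Euc (m + 2)) (Fin.last (m + 1)) / 2) *
      sinc ‖(-(π * (q.2 : Euc (m + 2)) (Fin.last (m + 1)) / 2)) • q.1‖)) •
      dropLast (q.2 : Euc (m + 2)))

/-- The inverse of `bridge`. -/
def unbridge : W → Sph (k + 1) × Euc (m + 1) :=
  D.glued (fun q => extendOn D.f (tube k m univ)
    (fun p => (dir (appendLast (sin (π * q.2) • (p.1 : Euc (k + 1))) (cos (π * q.2))),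
      (4 / sin (π * q.2)) • p.2)) (fun _ => (dir 0, 0)) q.1) capUnbridge

theorem unbridge_iW {u : Sph k} {y : Euc (m + 1)} (hy : ‖y‖ < 1) {t : Icc (0 : ℝ) 1}
    (hq : (D.f (u, y), t) ∈ D.endCoresᶜ) : D.unbridge (D.iW (D.f (u, y), t)) =
      (dir (appendLast (sin (π * t) • (u : Euc (k + 1))) (cos (π * t))), (4 / sin (π * t)) • y) :=
          by
  rw [unbridge, D.glued_iW hq, extendOn_apply D.diffeo_f.injOn (mem_tube hy)]

theorem unbridge_jW (a : Fin 2) {x : Euc (k + 1)} {v : Sph (m + 1)}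
    (hq : (x, v) ∈ handle k (m + 1) (lowerHalf (m + 1)))  :
    D.unbridge (D.jW a (x, v)) = capUnbridge a (x, v) := by
  by_cases hx : x = 0
  · subst hx
    exact D.glued_jW_zero a hq.2
  have hx0 := norm_pos_iff.2 hx
  have hx1 : ‖x‖ < 1 := hq.1
  have hn : ‖‖x‖ • dropLast (v : Euc (m + 2))‖ < 1 := by
    rw [norm_smul, norm_norm]
    nlinarith [norm_dropLast_coe_le_one v, norm_nonneg (dropLast (v : Euc (m + 2)))]
  rw [D.jW_eq_iW' a hx hq, D.unbridge_iW hn (D.jW_source_notMem a hx hq), sin_pi_flipEnd,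
    cos_pi_flipEnd, clamp_time hq, capUnbridge]
  simp only
  set s := (v : Euc (m + 2)) (Fin.last (m + 1)) with hs
  have hs0 : s ≤ 0 := hq.2
  have hβ : 0 ≤ -(π * s / 2) := by nlinarith [pi_pos]
  have e1 : ‖(-(π * s / 2)) • x‖ = -(π * s / 2) * ‖x‖ := by
    rw [norm_smul, Real.norm_of_nonneg hβ]
  have e2 : π * (-(‖x‖ * s) / 2) = -(π * s / 2) * ‖x‖ := by ring
  rw [e1, e2, ← mul_sinc]
  refine Prod.ext ?_ ?_
  · simp only
    congr 2
    rw [mul_assoc, mul_comm ‖x‖, ← mul_assoc, mul_smul, norm_smul_dir]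
  · simp only
    rw [smul_smul]
    congr 1
    field_simp

theorem last_dir {d : ℕ} {Y : Euc (d + 1)} (hY : Y ≠ 0) :
    (dir Y : Euc (d + 1)) (Fin.last d) = ‖Y‖⁻¹ * Y (Fin.last d) := by
  rw [coe_dir hY]; simp

theorem dropLast_dir {d : ℕ} {Y : Euc (d + 1)} (hY : Y ≠ 0) :
    dropLast (dir Y : Euc (d + 1)) = ‖Y‖⁻¹ • dropLast Y := by
  rw [coe_dir hY]; simp

theorem last_dir_nonpos {d : ℕ} {Y : Euc (d + 1)} (hY : Y ≠ 0) (h : Y (Fin.last d) ≤ 0) :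
    (dir Y : Euc (d + 1)) (Fin.last d) ≤ 0 := by
  rw [last_dir hY]
  exact mul_nonpos_of_nonneg_of_nonpos (by positivity) h

theorem zero_mem_handle {v : Sph (m + 1)} (hv : (v : Euc (m + 2)) (Fin.last (m + 1)) ≤ 0) :
    ((0, v) : Euc (k + 1) × Sph (m + 1)) ∈ handle k (m + 1) (lowerHalf (m + 1)) :=
  ⟨by simp, hv⟩

/-- At the centre of a handle the time coordinate depends only on the direction. -/
theorem capTime_zero_dir {Y : Euc (m + 2)} (hY : Y ≠ 0) :
    capTime ((0 : Euc (k + 1)), (dir Y : Euc (m + 2))) =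
      arctan (-(π * Y (Fin.last (m + 1)) / 2) / ‖dropLast Y‖) / π := by
  have h := norm_pos_iff.2 hY
  simp only [capTime, smul_zero, norm_zero, sinc_zero, cos_zero, mul_one, one_mul, last_dir hY,
    dropLast_dir hY, norm_smul, norm_inv, norm_norm]
  congr 2
  by_cases h0 : ‖dropLast Y‖ = 0
  · simp [h0]
  · field_simp

/-! ### Inverse maps between the pieces -/

/-- The embedded sphere `bridge (S^(k+1) × {0})` that is surgered. -/
def coreSphere : Set W := cores (fun _ : Unit => D.bridge)

theorem mem_coreSphere {p : W} : p ∈ D.coreSphere ↔ ∃ w, p = D.bridge (w, 0) := by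
  simp [coreSphere, cores]

/-- The part of `W` that contains the image of `bridge`: the points of the tube at interior times,
and the interiors of the handles. -/
def bridgeZone : Set W :=
  D.iW '' {q | q.1 ∈ D.f '' tube k m univ ∧ 0 < (q.2 : ℝ) ∧ (q.2 : ℝ) < 1} ∪
    ⋃ a, D.jW a '' {q | q ∈ handle k (m + 1) (lowerHalf (m + 1)) ∧
      (q.2 : Euc (m + 2)) (Fin.last (m + 1)) < 0}

theorem iW_mem_bridgeZone {u : Sph k} {y : Euc (m + 1)} (hy : ‖y‖ < 1) {t : Icc (0 : ℝ) 1}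
    (h : 0 < (t : ℝ) ∧ (t : ℝ) < 1) : D.iW (D.f (u, y), t) ∈ D.bridgeZone :=
  Or.inl ⟨_, ⟨⟨_, mem_tube hy, rfl⟩, h⟩, rfl⟩

theorem jW_mem_bridgeZone (a : Fin 2) {v : Sph (m + 1)}
    (hv : (v : Euc (m + 2)) (Fin.last (m + 1)) < 0) : D.jW a (0, v) ∈ D.bridgeZone :=
  Or.inr (mem_iUnion.2 ⟨a, _, ⟨zero_mem_handle hv.le, hv⟩, rfl⟩)

theorem bridgeZone_cases {p : W} (hp : p ∈ D.bridgeZone) :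
    (∃ u y t, ‖y‖ < 1 ∧ (0 < ((t : Icc (0 : ℝ) 1) : ℝ) ∧ (t : ℝ) < 1) ∧ p = D.iW (D.f (u, y), t)) ∨
      ∃ (a : Fin 2) (v : Sph (m + 1)), (v : Euc (m + 2)) (Fin.last (m + 1)) < 0 ∧
        p = D.jW a (0, v) := by
  rcases hp with ⟨⟨x, t⟩, ⟨⟨⟨u, y⟩, hy, rfl⟩, ht⟩, rfl⟩ | hp
  · exact Or.inl ⟨u, y, t, hy.1, ht, rfl⟩
  · obtain ⟨a, ⟨x, v⟩, ⟨hq, hv⟩, rfl⟩ := mem_iUnion.1 hp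
    by_cases hx : x = 0
    · exact Or.inr ⟨a, v, hv, by rw [hx]⟩
    · have h0 := norm_pos_iff.2 hx
      have hx1 : ‖x‖ < 1 := hq.1
      simp only at hv
      refine Or.inl ⟨_, _, _, ?_, ?_, D.jW_eq_iW' a hx hq⟩
      · rw [norm_smul, norm_norm]
        nlinarith [norm_dropLast_coe_le_one v, norm_nonneg (dropLast (v : Euc (m + 2)))]
      · apply flipEnd_mem_Ioo
        rw [clamp_time hq]
        refine ⟨?_, by linarith [(time_mem hq).2]⟩
        nlinarith

theorem sphere_coords_sq {d : ℕ} (w : Sph d) :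
    ‖dropLast (w : Euc (d + 1))‖ ^ 2 + (w : Euc (d + 1)) (Fin.last d) ^ 2 = 1 := by
  rw [← norm_sq_eq_dropLast, norm_coe_sph, one_pow]

/-- A point of the sphere off the poles has its last coordinate in `(-1, 1)`. -/
theorem arccos_last_mem {w : Sph (k + 1)} (hw : dropLast (w : Euc (k + 2)) ≠ 0) :
    0 < arccos ((w : Euc (k + 2)) (Fin.last (k + 1))) / π ∧
      arccos ((w : Euc (k + 2)) (Fin.last (k + 1))) / π < 1 := by
  have h0 := norm_pos_iff.2 hw
  have h := sphere_coords_sq w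
  have h1 : (w : Euc (k + 2)) (Fin.last (k + 1)) < 1 := by nlinarith
  have h2 : -1 < (w : Euc (k + 2)) (Fin.last (k + 1)) := by nlinarith
  refine ⟨div_pos (arccos_pos.2 h1) pi_pos, (div_lt_one pi_pos).2 ?_⟩
  exact lt_of_le_of_ne (arccos_le_pi _) fun h => by rw [arccos_eq_pi] at h; linarith

theorem last_mem_Icc {d : ℕ} (w : Sph d) :
    -1 ≤ (w : Euc (d + 1)) (Fin.last d) ∧ (w : Euc (d + 1)) (Fin.last d) ≤ 1 := by
  have h := sphere_coords_sq w
  constructor <;> nlinarith [sq_nonneg ‖dropLast (w : Euc (d + 1))‖]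

theorem norm_scaled_lt {w : Sph (k + 1)} {y : Euc (m + 1)} (hy : ‖y‖ < 1) :
    ‖(‖dropLast (w : Euc (k + 2))‖ / 4) • y‖ < 1 := by
  rw [norm_smul, norm_div, norm_norm, Real.norm_of_nonneg (by norm_num : (0 : ℝ) ≤ 4)]
  have h1 := norm_dropLast_le (w : Euc (k + 2))
  rw [norm_coe_sph] at h1
  nlinarith [norm_nonneg y, norm_nonneg (dropLast (w : Euc (k + 2)))]

theorem coe_clamp_arccos (c : ℝ) : (clamp (arccos c / π) : ℝ) = arccos c / π :=
  coe_clamp (arccos_div_pi_mem c)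

theorem poleVec_ne_zero (y : Euc (m + 1)) : appendLast ((1 / 4 : ℝ) • y) (-(2 / π)) ≠ 0 :=
  appendLast_ne_zero' _ (by simp)

theorem poleVec_last_neg (y : Euc (m + 1)) :
    (dir (appendLast ((1 / 4 : ℝ) • y) (-(2 / π))) : Euc (m + 2)) (Fin.last (m + 1)) < 0 := by
  rw [last_dir (poleVec_ne_zero y), appendLast_last]
  have := norm_pos_iff.2 (poleVec_ne_zero y)
  have := pi_pos
  rw [mul_neg, Left.neg_neg_iff]
  positivity

theorem bridge_mem {w : Sph (k + 1)} {y : Euc (m + 1)} (hy : ‖y‖ < 1) :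
    D.bridge (w, y) ∈ D.bridgeZone := by
  by_cases hw : dropLast (w : Euc (k + 2)) = 0
  · obtain ⟨a, ha⟩ := pole_sign hw
    rw [D.bridge_of_eq a hw ha]
    exact D.jW_mem_bridgeZone a (poleVec_last_neg y)
  · rw [D.bridge_of_ne hw]
    refine D.iW_mem_bridgeZone (norm_scaled_lt hy) ?_
    rw [coe_clamp_arccos]
    exact arccos_last_mem hw

theorem unbridge_bridge {w : Sph (k + 1)} {y : Euc (m + 1)} (hy : ‖y‖ < 1) :
    D.unbridge (D.bridge (w, y)) = (w, y) := by
  have hpi := pi_pos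
  by_cases hw : dropLast (w : Euc (k + 2)) = 0
  · obtain ⟨a, ha⟩ := pole_sign hw
    have hY := poleVec_ne_zero y
    have hY0 := norm_pos_iff.2 hY
    rw [D.bridge_of_eq a hw ha, D.unbridge_jW a (zero_mem_handle (poleVec_last_neg y).le),
        capUnbridge]
    simp only [smul_zero, norm_zero, sinc_zero, cos_zero, mul_one, last_dir hY, dropLast_dir hY,
      appendLast_last, dropLast_appendLast]
    refine Prod.ext ?_ ?_
    · simp only
      rw [← ha, ← hw, appendLast_dropLast, dir_coe]
    · simp only
      rw [smul_smul, smul_smul]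
      convert one_smul ℝ y using 2
      field_simp
  · have ht := arccos_last_mem hw
    have hw0 := norm_pos_iff.2 hw
    have hc := last_mem_Icc w
    rw [D.bridge_of_ne hw, D.unbridge_iW (norm_scaled_lt hy) (D.notMem_endCores_of_Ioo _ (by
      rw [coe_clamp_arccos]; exact ht)), coe_clamp_arccos, mul_div_cancel₀ _ hpi.ne',
      cos_arccos hc.1 hc.2, sin_arccos, ← sphere_coords, norm_smul_dir, appendLast_dropLast,
          dir_coe,
      smul_smul]
    refine Prod.ext rfl ?_
    convert one_smul ℝ y using 2
    field_simp

theorem coe_dir_of_norm {d : ℕ} {y : Euc (d + 1)} (h : ‖y‖ = 1) : (dir y : Euc (d + 1)) = y := by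
  have := norm_smul_dir y
  rwa [h, one_smul] at this

theorem norm_cylinder (u : Sph k) (α : ℝ) :
    ‖appendLast (sin α • (u : Euc (k + 1))) (cos α)‖ = 1 := by
  have h := norm_sq_appendLast (sin α • (u : Euc (k + 1))) (cos α)
  rw [norm_smul, norm_coe_sph, mul_one, Real.norm_eq_abs, sq_abs, sin_sq_add_cos_sq] at h
  exact (pow_eq_one_iff_of_nonneg (norm_nonneg _) two_ne_zero).1 h

theorem bridge_unbridge {p : W} (hp : p ∈ D.bridgeZone) : D.bridge (D.unbridge p) = p := by
  have hpi := pi_pos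
  rcases D.bridgeZone_cases hp with ⟨u, y, t, hy, ht, rfl⟩ | ⟨a, v, hv, rfl⟩
  · have hs := sin_pi_mul_pos ht.1 ht.2
    have hw := coe_dir_of_norm (norm_cylinder u (π * t))
    rw [D.unbridge_iW hy (D.notMem_endCores_of_Ioo _ ht), D.bridge_of_ne (by
      rw [hw, dropLast_appendLast]; exact smul_ne_zero hs.ne' (coe_sph_ne_zero u)), hw,
      dropLast_appendLast, appendLast_last, dir_smul_coe hs, norm_smul, norm_coe_sph, mul_one,
      Real.norm_of_nonneg hs.le, arccos_cos (by nlinarith [t.2.1]) (by nlinarith [t.2.2]),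
      mul_div_cancel_left₀ _ hpi.ne', clamp_coe, smul_smul]
    have : sin (π * t) / 4 * (4 / sin (π * t)) = 1 := by field_simp
    rw [this, one_smul]
  · have hw : (dir (appendLast (0 : Euc (k + 1)) (endSign a)) : Euc (k + 2)) =
        appendLast 0 (endSign a) := by
      apply coe_dir_of_norm
      have h := norm_sq_appendLast (0 : Euc (k + 1)) (endSign a)
      rw [norm_zero, ← sq_abs (endSign a), abs_endSign] at h
      exact (pow_eq_one_iff_of_nonneg (norm_nonneg _) two_ne_zero).1 (by simpa using h)
    rw [D.unbridge_jW a (zero_mem_handle hv.le), capUnbridge]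
    simp only [smul_zero, norm_zero, sinc_zero, cos_zero, mul_one]
    rw [D.bridge_of_eq a (by rw [hw, dropLast_appendLast]) (by rw [hw, appendLast_last])]
    congr 2
    set s := (v : Euc (m + 2)) (Fin.last (m + 1)) with hs
    have h1 : appendLast ((1 / 4 : ℝ) • (4 / -(π * s / 2)) • dropLast (v : Euc (m + 2))) (-(2 / π))
        =
        (2 / (π * -s)) • (v : Euc (m + 2)) := by
      have hsn : s ≠ 0 := hv.ne
      conv_rhs => rw [← appendLast_dropLast (v : Euc (m + 2)), smul_appendLast, ← hs]
      rw [smul_smul]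
      congr 1
      · congr 1
        field_simp
      · field_simp
    rw [h1]
    have : 0 < -s := by linarith
    exact dir_smul_coe (by positivity) v

theorem notMem_coreSphere_iff {p : W} : p ∉ D.coreSphere ↔ (∃ x ∉ D.core, ∃ t, p = D.iW (x, t)) ∨
    ∃ (a : Fin 2) (v : Sph (m + 1)), (v : Euc (m + 2)) (Fin.last (m + 1)) ≤ 0 ∧
      dropLast (v : Euc (m + 2)) ≠ 0 ∧ p = D.jW a (0, v) := by
  constructor
  · intro hp
    rcases D.exists_W p with ⟨⟨x, t⟩, hq, rfl⟩ | ⟨a, v, hv, rfl⟩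
    · by_cases hx : x ∈ D.core
      · refine absurd ?_ hp
        obtain ⟨u, rfl⟩ := D.mem_core.1 hx
        have ht : 0 < (t : ℝ) ∧ (t : ℝ) < 1 := by
          have h := fun h => hq (D.mem_endCores.2 ⟨hx, h⟩)
          obtain ⟨h1, h2⟩ := not_or.1 h
          exact ⟨lt_of_le_of_ne t.2.1 (Ne.symm h1), lt_of_le_of_ne t.2.2 h2⟩
        have h := D.bridge_unbridge (D.iW_mem_bridgeZone (u := u) (y := 0) (by simp) ht)
        rw [D.unbridge_iW (by simp) hq, smul_zero] at h
        exact D.mem_coreSphere.2 ⟨_, h.symm⟩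
      · exact Or.inl ⟨x, hx, t, rfl⟩
    · by_cases hv0 : dropLast (v : Euc (m + 2)) = 0
      · refine absurd ?_ hp
        have hv' : (v : Euc (m + 2)) (Fin.last (m + 1)) < 0 := lt_of_le_of_ne hv (by
          intro h
          have := last_ne_zero_of_dropLast hv0
          rw [h] at this; norm_num at this)
        have h := D.bridge_unbridge (D.jW_mem_bridgeZone a hv')
        rw [D.unbridge_jW a (zero_mem_handle hv), capUnbridge] at h
        simp only [hv0, smul_zero] at h
        exact D.mem_coreSphere.2 ⟨_, h.symm⟩
      · exact Or.inr ⟨a, v, hv, hv0, rfl⟩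
  · intro hp hb
    obtain ⟨w, hw⟩ := D.mem_coreSphere.1 hb
    by_cases hw0 : dropLast (w : Euc (k + 2)) = 0
    · obtain ⟨b, hb'⟩ := pole_sign hw0
      rw [D.bridge_of_eq b hw0 hb'] at hw
      have hl := poleVec_last_neg (0 : Euc (m + 1))
      rcases hp with ⟨x, hx, t, rfl⟩ | ⟨a, v, hv, hv0, rfl⟩
      · exact D.iW_ne_jW_zero (D.notMem_endCores_of_notMem hx t) b hl.le hw
      · obtain rfl := D.jW_injective (zero_mem_handle hv) (zero_mem_handle hl.le) hw
        have h := (D.gluingW.diffeo_j a).injOn (zero_mem_handle hv) (zero_mem_handle hl.le) hw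
        have hv' : v = dir (appendLast ((1 / 4 : ℝ) • 0) (-(2 / π))) := (Prod.ext_iff.1 h).2
        apply hv0
        rw [hv', dropLast_dir (poleVec_ne_zero _)]
        simp
    · rw [D.bridge_of_ne hw0, smul_zero] at hw
      have hq := D.notMem_endCores_of_Ioo (D.f (dir (dropLast (w : Euc (k + 2))), 0))
        (t := clamp (arccos ((w : Euc (k + 2)) (Fin.last (k + 1))) / π))
        (by rw [coe_clamp_arccos]; exact arccos_last_mem hw0)
      rcases hp with ⟨x, hx, t, rfl⟩ | ⟨a, v, hv, hv0, rfl⟩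
      · have := D.diffeo_iW.injOn (D.notMem_endCores_of_notMem hx t) hq hw
        exact hx (D.mem_core.2 ⟨_, (Prod.ext_iff.1 this).1⟩)
      · exact D.iW_ne_jW_zero hq a hv hw.symm

/-- The centre `{0} × S^m` of the handle of `N`, at the level `1/2`; also the centre of `newHandle`.
-/
def middle : Set (N × Icc (0 : ℝ) 1) := {q | (∃ v, q.1 = D.jN (0, v)) ∧ (q.2 : ℝ) = 1 / 2}

theorem notMem_middle_iff {q : N × Icc (0 : ℝ) 1} : q ∉ D.middle ↔
    (∃ x ∉ D.core, ∃ t, q = (D.iN x, t)) ∨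
    ∃ (a : Fin 2) (v : Sph m) (t : Icc (0 : ℝ) 1), (t : ℝ) < 1 / 2 ∧
      q = (D.jN (0, v), flipEnd a t) := by
  obtain ⟨y, t⟩ := q
  constructor
  · intro h
    rcases D.exists_N y with ⟨x, hx, rfl⟩ | ⟨v, rfl⟩
    · exact Or.inl ⟨x, hx, t, rfl⟩
    · have ht : (t : ℝ) ≠ 1 / 2 := fun ht => h ⟨⟨v, rfl⟩, ht⟩
      obtain ⟨a, t', rfl, ht'⟩ := exists_flipEnd ht
      exact Or.inr ⟨a, v, t', ht', rfl⟩
  · rintro (⟨x, hx, t, h⟩ | ⟨a, v, t, ht, h⟩) ⟨⟨v', hv'⟩, ht'⟩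
    · rw [(Prod.ext_iff.1 h).1] at hv'
      exact D.iN_ne_jN_zero hx _ hv'
    · rw [(Prod.ext_iff.1 h).2] at ht'
      have := coe_flipEnd_sub a t
      rw [ht', sub_self, eq_comm] at this
      rcases mul_eq_zero.1 this with h0 | h0
      · have := abs_endSign a
        rw [h0] at this; simp at this
      · linarith

theorem coe_clamp_cotScale {x : M} (hx : x ∉ D.core) (t : Icc (0 : ℝ) 1) :
    (clamp (cotScale (D.coreDist x) t) : ℝ) = cotScale (D.coreDist x) t :=
  coe_clamp (cotScale_mem_Icc (D.coreDist_pos hx) t.2)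

theorem coe_clamp_cotScale_inv {x : M} (hx : x ∉ D.core) (t : Icc (0 : ℝ) 1) :
    (clamp (cotScale (D.coreDist x)⁻¹ t) : ℝ) = cotScale (D.coreDist x)⁻¹ t :=
  coe_clamp (cotScale_mem_Icc (inv_pos.2 (D.coreDist_pos hx)) t.2)

theorem arctan_div_pi_mem {z : ℝ} (hz : 0 ≤ z) : 0 ≤ arctan z / π ∧ arctan z / π < 1 / 2 := by
  refine ⟨div_nonneg (arctan_nonneg.2 hz) pi_pos.le, ?_⟩
  rw [div_lt_iff₀ pi_pos]
  linarith [arctan_lt_pi_div_two z]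

theorem flat_jW_zero (a : Fin 2) {v : Sph (m + 1)}
    (hv : (v : Euc (m + 2)) (Fin.last (m + 1)) ≤ 0) (hv0 : dropLast (v : Euc (m + 2)) ≠ 0) :
    D.flat (D.jW a (0, v)) = (D.jN (0, dir (dropLast (v : Euc (m + 2)))),
      flipEnd a (clamp (arctan (-(π * (v : Euc (m + 2)) (Fin.last (m + 1)) / 2) /
        ‖dropLast (v : Euc (m + 2))‖) / π))) := by
  rw [D.flat_jW a (zero_mem_handle hv) hv0 (by simp), capFlat]
  have := capTime_zero_dir (k := k) (coe_sph_ne_zero v)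
  rw [dir_coe] at this
  simp only [this, smul_zero]

theorem unflat_jN_zero (a : Fin 2) (v : Sph m) {t : Icc (0 : ℝ) 1} (ht : (t : ℝ) < 1 / 2) :
    D.unflat (D.jN (0, v), flipEnd a t) =
      D.jW a (0, dir (appendLast (v : Euc (m + 1)) (-(2 * (tan (π * t) / π))))) := by
  rw [D.unflat_jN a v ht (by simp) (by simp), polar, unflatVec]
  simp [atanc_zero]

theorem unflatVec_zero_last_nonpos (v : Euc (m + 1)) {t : ℝ} (h0 : 0 ≤ t) (h1 : t < 1 / 2) :
    appendLast v (-(2 * (tan (π * t) / π))) (Fin.last (m + 1)) ≤ 0 := by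
  have := tan_pi_nonneg h0 h1
  have := pi_pos
  rw [appendLast_last, Left.neg_nonpos_iff]
  positivity

theorem flat_notMem_middle {p : W} (hp : p ∉ D.coreSphere) : D.flat p ∉ D.middle := by
  rw [D.notMem_middle_iff]
  rcases D.notMem_coreSphere_iff.1 hp with ⟨x, hx, t, rfl⟩ | ⟨a, v, hv, hv0, rfl⟩
  · rw [D.flat_iW (D.notMem_endCores_of_notMem hx t)]
    exact Or.inl ⟨x, hx, _, rfl⟩
  · rw [D.flat_jW_zero a hv hv0]
    have h := arctan_div_pi_mem (z := -(π * (v : Euc (m + 2)) (Fin.last (m + 1)) / 2) /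
        ‖dropLast (v : Euc (m + 2))‖) (div_nonneg (by nlinarith [pi_pos]) (norm_nonneg _))
    exact Or.inr ⟨a, _, _, by rw [coe_clamp ⟨h.1, by linarith [h.2]⟩]; exact h.2, rfl⟩

theorem unflat_notMem_coreSphere {q : N × Icc (0 : ℝ) 1} (hq : q ∉ D.middle) :
    D.unflat q ∉ D.coreSphere := by
  rw [D.notMem_coreSphere_iff]
  rcases D.notMem_middle_iff.1 hq with ⟨x, hx, t, rfl⟩ | ⟨a, v, t, ht, rfl⟩
  · rw [D.unflat_iN hx]
    exact Or.inl ⟨x, hx, _, rfl⟩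
  · rw [D.unflat_jN_zero a v ht]
    have hY := appendLast_ne_zero (coe_sph_ne_zero v) (-(2 * (tan (π * t) / π)))
    refine Or.inr ⟨a, _, last_dir_nonpos hY (unflatVec_zero_last_nonpos _ t.2.1 ht), ?_, rfl⟩
    rw [dropLast_dir hY, dropLast_appendLast]
    exact smul_ne_zero (inv_ne_zero (norm_ne_zero_iff.2 hY)) (coe_sph_ne_zero v)

theorem unflat_flat {p : W} (hp : p ∉ D.coreSphere) : D.unflat (D.flat p) = p := by
  rcases D.notMem_coreSphere_iff.1 hp with ⟨x, hx, t, rfl⟩ | ⟨a, v, hv, hv0, rfl⟩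
  · rw [D.flat_iW (D.notMem_endCores_of_notMem hx t), D.unflat_iN hx, D.coe_clamp_cotScale hx,
      cotScale_inv_cotScale (D.coreDist_pos hx) t.2, clamp_coe]
  · have hn := norm_pos_iff.2 hv0
    have hpi := pi_pos
    set s := (v : Euc (m + 2)) (Fin.last (m + 1)) with hs
    have hz : 0 ≤ -(π * s / 2) / ‖dropLast (v : Euc (m + 2))‖ :=
      div_nonneg (by nlinarith) (norm_nonneg _)
    have h := arctan_div_pi_mem hz
    have hc := coe_clamp ⟨h.1, h.2.le.trans (by norm_num)⟩
    rw [D.flat_jW_zero a hv hv0, D.unflat_jN_zero a _ (by rw [hc]; exact h.2), hc,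
      mul_div_cancel₀ _ hpi.ne', tan_arctan]
    have h1 : appendLast (dir (dropLast (v : Euc (m + 2))) : Euc (m + 1))
        (-(2 * (-(π * s / 2) / ‖dropLast (v : Euc (m + 2))‖ / π))) =
        ‖dropLast (v : Euc (m + 2))‖⁻¹ • (v : Euc (m + 2)) := by
      conv_rhs => arg 2; rw [← appendLast_dropLast (v : Euc (m + 2))]
      rw [smul_appendLast, ← hs, coe_dir hv0]
      congr 1
      field_simp
    rw [h1, dir_smul_coe (by positivity)]

theorem flat_unflat {q : N × Icc (0 : ℝ) 1} (hq : q ∉ D.middle) : D.flat (D.unflat q) = q := by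
  rcases D.notMem_middle_iff.1 hq with ⟨x, hx, t, rfl⟩ | ⟨a, v, t, ht, rfl⟩
  · have h := cotScale_inv_cotScale (inv_pos.2 (D.coreDist_pos hx)) t.2
    rw [inv_inv] at h
    rw [D.unflat_iN hx, D.flat_iW (D.notMem_endCores_of_notMem hx _)]
    simp only
    rw [D.coe_clamp_cotScale_inv hx, h, clamp_coe]
  · have hpi := pi_pos
    have hY := appendLast_ne_zero (coe_sph_ne_zero v) (-(2 * (tan (π * t) / π)))
    have hY0 := norm_pos_iff.2 hY
    rw [D.unflat_jN_zero a v ht, D.flat_jW_zero a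
      (last_dir_nonpos hY (unflatVec_zero_last_nonpos _ t.2.1 ht)) (by
        rw [dropLast_dir hY, dropLast_appendLast]
        exact smul_ne_zero (inv_ne_zero hY0.ne') (coe_sph_ne_zero v)),
      dropLast_dir hY, last_dir hY, dropLast_appendLast, appendLast_last,
          dir_smul_coe (by positivity),
      norm_smul, norm_coe_sph, mul_one, norm_inv, norm_norm]
    set r := ‖appendLast (v : Euc (m + 1)) (-(2 * (tan (π * t) / π)))‖
    have h1 : -(π * (r⁻¹ * -(2 * (tan (π * t) / π))) / 2) / r⁻¹ = tan (π * t) := by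
      field_simp
    rw [h1, arctan_tan (by nlinarith [t.2.1]) (by nlinarith), mul_div_cancel_left₀ _ hpi.ne',
        clamp_coe]

/-! ### The handle of `N × [0, 1]` -/

/-- The handle `B^(k+2) × S^m` glued into `N × [0, 1]`: the product of `S^m` with the ball of radius
`1/4` around `(0, 0)` in the coordinates `(x, cot (π t))` of `B^(k+1) × (0, 1)`. -/
def newHandle (q : Euc (k + 2) × Sph m) : N × Icc (0 : ℝ) 1 :=
  (D.jN ((1 / 4 : ℝ) • dropLast q.1, q.2), clamp (1 / 2 - arctan (q.1 (Fin.last (k + 1)) / 4) / π))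

theorem flipEnd_clamp (a : Fin 2) (z : ℝ) :
    flipEnd a (clamp (1 / 2 - arctan z / π)) = clamp (1 / 2 - arctan (endSign a * z) / π) := by
  unfold flipEnd endSign
  split_ifs
  · rw [one_mul]
  · rw [← clamp_one_sub, neg_one_mul, arctan_neg]
    congr 1
    ring

/-- The gluing relation of the surgery. In the coordinates `(x, cot (π t))` the map `flat ∘ bridge`
is linear along the radii of `B^(m+1)`, because `flat` multiplies `cot (π t)` by the distance to the
core. -/
theorem flat_bridge (w : Sph (k + 1)) (v : Sph m) {θ : ℝ} (h0 : 0 < θ) (h1 : θ < 1) :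
    D.flat (D.bridge (w, θ • (v : Euc (m + 1)))) = D.newHandle (θ • (w : Euc (k + 2)), v) := by
  have hpi := pi_pos
  by_cases hw : dropLast (w : Euc (k + 2)) = 0
  · obtain ⟨a, ha⟩ := pole_sign hw
    have hY := poleVec_ne_zero (θ • (v : Euc (m + 1)))
    have hY0 := norm_pos_iff.2 hY
    rw [D.bridge_of_eq a hw ha, D.flat_jW_zero a (poleVec_last_neg _).le (by
      rw [dropLast_dir hY, dropLast_appendLast]
      exact smul_ne_zero (inv_ne_zero hY0.ne')
        (smul_ne_zero (by norm_num) (smul_ne_zero h0.ne' (coe_sph_ne_zero v)))),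
      dropLast_dir hY, last_dir hY, dropLast_appendLast, appendLast_last, smul_smul, smul_smul,
      dir_smul_coe (by positivity), norm_smul, norm_coe_sph, mul_one,
          Real.norm_of_nonneg (by positivity),
      newHandle]
    simp only [dropLast_smul, hw, smul_zero, PiLp.smul_apply, ha, smul_eq_mul]
    set r := ‖appendLast ((1 / 4 : ℝ) • θ • (v : Euc (m + 1))) (-(2 / π))‖
    have h2 : -(π * (r⁻¹ * -(2 / π)) / 2) / (r⁻¹ * (1 / 4) * θ) = (θ / 4)⁻¹ := by field_simp
    have h3 : arctan (θ / 4)⁻¹ / π = 1 / 2 - arctan (θ / 4) / π := by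
      rw [arctan_inv_of_pos (by positivity)]; field_simp
    rw [h2, h3, flipEnd_clamp]
    congr 5
    ring
  · have hr := norm_pos_iff.2 hw
    have ht := arccos_last_mem hw
    have hc := last_mem_Icc w
    have hr1 := norm_dropLast_le (w : Euc (k + 2))
    rw [norm_coe_sph] at hr1
    have hn : ‖(‖dropLast (w : Euc (k + 2))‖ / 4) • θ • (v : Euc (m + 1))‖ =
        ‖dropLast (w : Euc (k + 2))‖ / 4 * θ := by
      rw [smul_smul, norm_smul, norm_coe_sph, mul_one, Real.norm_of_nonneg (by positivity)]
    have hlt : ‖(‖dropLast (w : Euc (k + 2))‖ / 4) • θ • (v : Euc (m + 1))‖ < 1 := by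
      rw [hn]; nlinarith
    rw [D.bridge_of_ne hw, D.flat_iW (D.notMem_endCores_of_Ioo _
        (by rw [coe_clamp_arccos]; exact ht))]
    simp only
    rw [D.iN_f hlt (smul_ne_zero (by positivity) (smul_ne_zero h0.ne' (coe_sph_ne_zero v))),
      D.coreDist_f hlt, hn, radialCutoff_of_le (by nlinarith), coe_clamp_arccos,
      cotScale_eq_cot (by positivity) ht.1 ht.2, mul_div_cancel₀ _ hpi.ne', cos_arccos hc.1 hc.2,
      sin_arccos, ← sphere_coords, newHandle, smul_smul, dir_smul_coe (by positivity)]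
    have h2 : ‖dropLast (w : Euc (k + 2))‖ / 4 * θ * ((w : Euc (k + 2)) (Fin.last (k + 1)) /
        ‖dropLast (w : Euc (k + 2))‖) = θ * (w : Euc (k + 2)) (Fin.last (k + 1)) / 4 := by
      field_simp
    have h3 : (‖dropLast (w : Euc (k + 2))‖ / 4 * θ) •
        (dir (dropLast (w : Euc (k + 2))) : Euc (k + 1)) =
        (1 / 4 : ℝ) • dropLast (θ • (w : Euc (k + 2))) := by
      conv_rhs => rw [dropLast_smul, ← norm_smul_dir (dropLast (w : Euc (k + 2)))]
      rw [smul_smul, smul_smul]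
      congr 1
      ring
    rw [h2, h3]
    simp

/-! ### Smoothness of the explicit formulas -/

theorem contDiff_halfAngle {a d : ℕ} :
    ContDiff ℝ ∞ (fun p : Euc a × Euc (d + 1) => -(π * p.2 (Fin.last d) / 2)) := by
  fun_prop

theorem contDiff_halfAngle_smul {a d : ℕ} :
    ContDiff ℝ ∞ (fun p : Euc a × Euc (d + 1) => (-(π * p.2 (Fin.last d) / 2)) • p.1) :=
  contDiff_halfAngle.smul contDiff_fst

theorem contDiff_sinc_halfAngle {a d : ℕ} :
    ContDiff ℝ ∞ (fun p : Euc a × Euc (d + 1) => sinc ‖(-(π * p.2 (Fin.last d) / 2)) • p.1‖) :=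
  contDiff_sinc_norm.comp contDiff_halfAngle_smul

theorem contDiff_cos_halfAngle {a d : ℕ} :
    ContDiff ℝ ∞ (fun p : Euc a × Euc (d + 1) => cos ‖(-(π * p.2 (Fin.last d) / 2)) • p.1‖) :=
  contDiff_cos_norm.comp contDiff_halfAngle_smul

theorem contDiffAt_capTime {p : Euc (k + 1) × Euc (m + 2)} (hY : dropLast p.2 ≠ 0)
    (hc : cos ‖(-(π * p.2 (Fin.last (m + 1)) / 2)) • p.1‖ ≠ 0) : ContDiffAt ℝ ∞ capTime p := by
  unfold capTime
  refine ContDiffAt.div_const (ContDiffAt.arctan (ContDiffAt.div ?_ ?_ ?_)) _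
  · exact (contDiff_halfAngle.mul contDiff_sinc_halfAngle).contDiffAt
  · exact contDiff_cos_halfAngle.contDiffAt.mul
      (ContDiffAt.norm ℝ (contDiff_dropLast.comp contDiff_snd).contDiffAt hY)
  · exact mul_ne_zero hc (norm_ne_zero_iff.2 hY)

theorem contDiffAt_unflatVec {p : (Euc (k + 1) × Euc (m + 1)) × ℝ} (hc : cos (π * p.2) ≠ 0) :
    ContDiffAt ℝ ∞ unflatVec p := by
  have htan : ContDiffAt ℝ ∞ (fun p : (Euc (k + 1) × Euc (m + 1)) × ℝ => tan (π * p.2)) p :=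
    ContDiffAt.comp (g := tan) p (contDiffAt_tan.2 hc) (by fun_prop)
  have hat : ContDiffAt ℝ ∞
      (fun p : (Euc (k + 1) × Euc (m + 1)) × ℝ => atanc ‖tan (π * p.2) • p.1.1‖) p :=
    ContDiffAt.comp (g := fun x : Euc (k + 1) => atanc ‖x‖) p contDiff_atanc_norm.contDiffAt
      (htan.smul (by fun_prop))
  have h : ContDiffAt ℝ ∞ (fun p : (Euc (k + 1) × Euc (m + 1)) × ℝ => (p.1.2,
      -(2 * (tan (π * p.2) * atanc ‖tan (π * p.2) • p.1.1‖ / π)))) p :=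
    ContDiffAt.prodMk (by fun_prop)
      ((contDiffAt_const.mul ((htan.mul hat).div_const _)).neg)
  exact ContDiffAt.comp (g := fun p : Euc (m + 1) × ℝ => appendLast p.1 p.2) p
    contDiff_appendLast.contDiffAt h

theorem contDiffAt_bridgeVec {p : Euc (k + 2) × Euc (m + 1)} (hc : p.1 (Fin.last (k + 1)) ≠ 0) :
    ContDiffAt ℝ ∞ bridgeVec p := by
  have hl : ContDiffAt ℝ ∞ (fun p : Euc (k + 2) × Euc (m + 1) => p.1 (Fin.last (k + 1))) p := by
    fun_prop
  have hat : ContDiffAt ℝ ∞ (fun p : Euc (k + 2) × Euc (m + 1) =>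
      atanc ‖(p.1 (Fin.last (k + 1)))⁻¹ • dropLast p.1‖) p :=
    ContDiffAt.comp (g := fun x : Euc (k + 1) => atanc ‖x‖) p contDiff_atanc_norm.contDiffAt
      ((hl.inv hc).smul (contDiff_dropLast.comp contDiff_fst).contDiffAt)
  have h : ContDiffAt ℝ ∞ (fun p : Euc (k + 2) × Euc (m + 1) => ((1 / 4 : ℝ) • p.2,
      -(2 * (atanc ‖(p.1 (Fin.last (k + 1)))⁻¹ • dropLast p.1‖ /
        (π * |p.1 (Fin.last (k + 1))|))))) p :=
    ContDiffAt.prodMk (by fun_prop) ((contDiffAt_const.mul (hat.div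
      (contDiffAt_const.mul (hl.abs hc)) (mul_ne_zero pi_pos.ne' (abs_ne_zero.2 hc)))).neg)
  exact ContDiffAt.comp (g := fun p : Euc (m + 1) × ℝ => appendLast p.1 p.2) p
    contDiff_appendLast.contDiffAt h

theorem contMDiff_handle_coe {a d : ℕ} : ContMDiff (𝓘(ℝ, Euc a).prod (𝓡 d))
    𝓘(ℝ, Euc a × Euc (d + 1)) ∞
    (fun q : Euc a × Sph d => (q.1, (q.2 : Euc (d + 1)))) :=
  contMDiff_fst.prodMk_space (contMDiff_coe_sph.comp contMDiff_snd)

theorem contMDiff_tube_coe {a d : ℕ} :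
    ContMDiff ((𝓡 d).prod 𝓘(ℝ, Euc a)) 𝓘(ℝ, Euc (d + 1) × Euc a) ∞
    (fun q : Sph d × Euc a => ((q.1 : Euc (d + 1)), q.2)) :=
  (contMDiff_coe_sph.comp contMDiff_fst).prodMk_space contMDiff_snd

theorem isOpen_handle_univ : IsOpen (handle k m univ) := by
  have : handle k m univ = {q : Euc (k + 1) × Sph m | ‖q.1‖ < 1} := by ext; simp [handle]
  rw [this]
  exact isOpen_lt (by fun_prop) continuous_const

theorem isOpen_tube_univ : IsOpen (tube k m univ) := by
  have : tube k m univ = {q : Sph k × Euc (m + 1) | ‖q.2‖ < 1} := by ext; simp [tube]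
  rw [this]
  exact isOpen_lt (by fun_prop) continuous_const

/-- Inside a handle the angle `π * t` is less than a right angle. -/
theorem halfAngle_mem {x : Euc (k + 1)} {v : Sph (m + 1)}
    (hq : (x, v) ∈ handle k (m + 1) (lowerHalf (m + 1))) :
    0 ≤ -(π * (v : Euc (m + 2)) (Fin.last (m + 1)) / 2) ∧
      ‖(-(π * (v : Euc (m + 2)) (Fin.last (m + 1)) / 2)) • x‖ < π / 2 := by
  have ht := time_mem hq
  have hpi := pi_pos
  have hv : (v : Euc (m + 2)) (Fin.last (m + 1)) ≤ 0 := hq.2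
  have h0 : 0 ≤ -(π * (v : Euc (m + 2)) (Fin.last (m + 1)) / 2) := by nlinarith
  refine ⟨h0, ?_⟩
  rw [norm_smul, Real.norm_of_nonneg h0]
  nlinarith

theorem capTime_mem {x : Euc (k + 1)} {v : Sph (m + 1)}
    (hq : (x, v) ∈ handle k (m + 1) (lowerHalf (m + 1))) :
    capTime (x, (v : Euc (m + 2))) ∈ Icc (0 : ℝ) 1 := by
  have h := halfAngle_mem hq
  have hn := norm_nonneg ((-(π * (v : Euc (m + 2)) (Fin.last (m + 1)) / 2)) • x)
  have hs : 0 < sinc ‖(-(π * (v : Euc (m + 2)) (Fin.last (m + 1)) / 2)) • x‖ :=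
    sinc_pos (by rw [abs_of_nonneg hn]; linarith [pi_pos])
  have hc : 0 < cos ‖(-(π * (v : Euc (m + 2)) (Fin.last (m + 1)) / 2)) • x‖ :=
    cos_pos_of_mem_Ioo ⟨by linarith [pi_pos], h.2⟩
  have := arctan_div_pi_mem (div_nonneg (mul_nonneg h.1 hs.le)
    (mul_nonneg hc.le (norm_nonneg (dropLast (v : Euc (m + 2))))))
  exact ⟨this.1, by unfold capTime; linarith [this.2]⟩

/-! ### Smoothness of `flat` and `unflat` -/

theorem isCompact_core : IsCompact D.core := by
  have : D.core = D.f '' (univ ×ˢ {0}) := by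
    ext x
    rw [mem_core]
    constructor
    · rintro ⟨u, rfl⟩
      exact ⟨(u, 0), by simp, rfl⟩
    · rintro ⟨⟨u, y⟩, ⟨-, rfl : y = 0⟩, rfl⟩
      exact ⟨u, rfl⟩
  rw [this]
  refine (isCompact_univ.prod isCompact_singleton).image_of_continuousOn
    (D.diffeo_f.contMDiffOn.continuousOn.mono ?_)
  rintro ⟨u, y⟩ ⟨-, rfl : y = 0⟩
  exact mem_tube (by simp)

theorem isOpen_compl_core [T2Space M] : IsOpen D.coreᶜ := D.isCompact_core.isClosed.isOpen_compl

theorem compl_endCores_mem_nhds [T2Space M] {q : M × Icc (0 : ℝ) 1} (hq : q ∈ D.endCoresᶜ) :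
    D.endCoresᶜ ∈ 𝓝 q := by
  by_cases h : q.1 ∈ D.core
  · have h' := fun h' => hq (D.mem_endCores.2 ⟨h, h'⟩)
    obtain ⟨h1, h2⟩ := not_or.1 h'
    have ho : IsOpen {q : M × Icc (0 : ℝ) 1 | 0 < (q.2 : ℝ) ∧ (q.2 : ℝ) < 1} :=
      (isOpen_lt continuous_const (continuous_subtype_val.comp continuous_snd)).and
        (isOpen_lt (continuous_subtype_val.comp continuous_snd) continuous_const)
    filter_upwards [ho.mem_nhds ⟨lt_of_le_of_ne q.2.2.1 (Ne.symm h1), lt_of_le_of_ne q.2.2.2 h2⟩]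
      with q' hq'
    exact D.notMem_endCores_of_Ioo q'.1 hq'
  · filter_upwards [continuous_fst.continuousAt.preimage_mem_nhds (D.isOpen_compl_core.mem_nhds h)]
      with q' hq'
    exact D.notMem_endCores_of_notMem hq' q'.2

theorem contMDiffAt_iW [T2Space M] {q : M × Icc (0 : ℝ) 1} (hq : q ∈ D.endCoresᶜ) :
    ContMDiffAt (I.prod (𝓡∂ 1)) J ∞ D.iW q :=
  (D.diffeo_iW.contMDiffOn q hq).contMDiffAt (D.compl_endCores_mem_nhds hq)

theorem contMDiffAt_f {u : Sph k} {y : Euc (m + 1)} (hy : ‖y‖ < 1) :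
    ContMDiffAt ((𝓡 k).prod 𝓘(ℝ, Euc (m + 1))) I ∞ D.f (u, y) :=
  (D.diffeo_f.contMDiffOn _ (mem_tube hy)).contMDiffAt (isOpen_tube_univ.mem_nhds (mem_tube hy))

theorem contMDiffAt_jN {x : Euc (k + 1)} {v : Sph m} (hx : ‖x‖ < 1) :
    ContMDiffAt (𝓘(ℝ, Euc (k + 1)).prod (𝓡 m)) I' ∞ D.jN (x, v) :=
  (D.diffeo_jN.contMDiffOn _ (mem_handle hx)).contMDiffAt
      (isOpen_handle_univ.mem_nhds (mem_handle hx))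

theorem contMDiffAt_coreDist [T2Space M] {x : M} (hx : x ∉ D.core) :
    ContMDiffAt I 𝓘(ℝ, ℝ) ∞ D.coreDist x := by
  by_cases h : x ∈ D.f '' tube k m univ
  · obtain ⟨⟨u, y⟩, hy, rfl⟩ := h
    have hy0 : y ≠ 0 := by
      rintro rfl
      exact hx (D.mem_core.2 ⟨u, rfl⟩)
    refine D.diffeo_f.contMDiffAt_of_comp D.isOpen_f hy ?_
    have h1 : ContDiffAt ℝ ∞ (fun y : Euc (m + 1) => radialCutoff ‖y‖) y :=
      ContDiffAt.comp y contDiff_radialCutoff.contDiffAt (contDiffAt_norm ℝ hy0)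
    refine (contMDiffWithinAt_of_contDiffAt (c := fun p : Sph k × Euc (m + 1) => p.2)
      (fun y : Euc (m + 1) => radialCutoff ‖y‖) h1 contMDiffAt_snd.contMDiffWithinAt).congr_of_mem
          ?_ hy
    rintro ⟨u', y'⟩ hy'
    exact D.coreDist_f hy'.1
  · have hK : IsCompact (D.f '' (univ ×ˢ Metric.closedBall 0 (1 / 2))) := by
      refine (isCompact_univ.prod (isCompact_closedBall _ _)).image_of_continuousOn
        (D.diffeo_f.contMDiffOn.continuousOn.mono ?_)
      rintro ⟨u, y⟩ ⟨-, hy⟩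
      rw [mem_closedBall_zero_iff] at hy
      exact mem_tube (by linarith)
    have hxK : x ∉ D.f '' (univ ×ˢ Metric.closedBall 0 (1 / 2)) := by
      rintro ⟨⟨u, y⟩, ⟨-, hy⟩, rfl⟩
      rw [mem_closedBall_zero_iff] at hy
      exact h ⟨_, mem_tube (by linarith), rfl⟩
    refine (contMDiffAt_const (c := (1 : ℝ))).congr_of_eventuallyEq ?_
    filter_upwards [hK.isClosed.isOpen_compl.mem_nhds hxK] with x' hx'
    by_cases h' : ∃ p ∈ tube k m univ, D.f p = x'
    · obtain ⟨⟨u, y⟩, hy, rfl⟩ := h'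
      rw [D.coreDist_f hy.1, radialCutoff_of_ge]
      by_contra hlt
      exact hx' ⟨(u, y), ⟨mem_univ _, by rw [mem_closedBall_zero_iff]; exact (not_le.1 hlt).le⟩,
          rfl⟩
    · push Not at h'
      rw [coreDist, extendOn_of_notMem h']

/-- Rescaling of time by a smooth positive parameter. -/
theorem contMDiffAt_clamp_cotScale {L : M → ℝ} {x : M} (hL : ContMDiffAt I 𝓘(ℝ, ℝ) ∞ L x)
    (h0 : ∀ᶠ x' in 𝓝 x, 0 < L x') (t : Icc (0 : ℝ) 1) :
    ContMDiffAt (I.prod (𝓡∂ 1)) (𝓡∂ 1) ∞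
      (fun q : M × Icc (0 : ℝ) 1 => clamp (cotScale (L q.1) q.2)) (x, t) := by
  refine contMDiffWithinAt_unitInterval (contMDiffWithinAt_univ.2 ?_)
  have h1 : ContMDiffAt (I.prod (𝓡∂ 1)) 𝓘(ℝ, ℝ × ℝ) ∞
      (fun q : M × Icc (0 : ℝ) 1 => (L q.1, (q.2 : ℝ))) (x, t) :=
    ContMDiffAt.prodMk_space (hL.comp (x, t) contMDiffAt_fst)
      (contMDiff_coe_unitInterval.contMDiffAt.comp (x, t) contMDiffAt_snd)
  have h2 : ContMDiffAt (I.prod (𝓡∂ 1)) 𝓘(ℝ, ℝ) ∞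
      (fun q : M × Icc (0 : ℝ) 1 => cotScale (L q.1) q.2) (x, t) :=
    contMDiffWithinAt_of_contDiffAt (fun p : ℝ × ℝ => cotScale p.1 p.2)
      (contDiffAt_cotScale h0.self_of_nhds) h1
  refine h2.congr_of_eventuallyEq ?_
  filter_upwards [continuous_fst.continuousAt.eventually h0] with q hq
  exact coe_clamp (cotScale_mem_Icc hq q.2.2)

theorem contMDiff_dropLast_coe {a d : ℕ} : ContMDiff (𝓘(ℝ, Euc a).prod (𝓡 d)) 𝓘(ℝ, Euc d) ∞
    (fun q : Euc a × Sph d => dropLast (q.2 : Euc (d + 1))) :=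
  contDiff_dropLast.contMDiff.comp (contMDiff_coe_sph.comp contMDiff_snd)

theorem contMDiffAt_smul_dropLast {v : Sph (m + 1)} (hv0 : dropLast (v : Euc (m + 2)) ≠ 0) :
    ContMDiffAt (𝓘(ℝ, Euc (k + 1)).prod (𝓡 (m + 1))) 𝓘(ℝ, Euc (k + 1)) ∞
      (fun q : Euc (k + 1) × Sph (m + 1) => ‖dropLast (q.2 : Euc (m + 2))‖ • q.1)
      ((0 : Euc (k + 1)), v) := by
  have hF : ContDiffAt ℝ ∞ (fun p : Euc (k + 1) × Euc (m + 2) => ‖dropLast p.2‖ • p.1)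
      ((0 : Euc (k + 1)), (v : Euc (m + 2))) := by
    have hd : ContDiffAt ℝ ∞ (fun p : Euc (k + 1) × Euc (m + 2) => dropLast p.2)
        ((0 : Euc (k + 1)), (v : Euc (m + 2))) := (contDiff_dropLast.comp contDiff_snd).contDiffAt
    exact (hd.norm ℝ hv0).smul contDiffAt_fst
  exact contMDiffWithinAt_of_contDiffAt (fun p : Euc (k + 1) × Euc (m + 2) => ‖dropLast p.2‖ • p.1)
    (c := fun q : Euc (k + 1) × Sph (m + 1) => (q.1, (q.2 : Euc (m + 2))))
        (x := ((0 : Euc (k + 1)), v))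
    hF contMDiff_handle_coe.contMDiffAt

theorem contMDiffAt_dir_dropLast {v : Sph (m + 1)} (hv0 : dropLast (v : Euc (m + 2)) ≠ 0) :
    ContMDiffAt (𝓘(ℝ, Euc (k + 1)).prod (𝓡 (m + 1))) (𝓡 m) ∞
      (fun q : Euc (k + 1) × Sph (m + 1) => dir (dropLast (q.2 : Euc (m + 2))))
      ((0 : Euc (k + 1)), v) :=
  contMDiffWithinAt_dir_comp contMDiff_dropLast_coe.contMDiffAt hv0

theorem contMDiffAt_jN_capFlat {v : Sph (m + 1)} (hv0 : dropLast (v : Euc (m + 2)) ≠ 0) :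
    ContMDiffAt (𝓘(ℝ, Euc (k + 1)).prod (𝓡 (m + 1))) I' ∞
      (fun q : Euc (k + 1) × Sph (m + 1) => D.jN (‖dropLast (q.2 : Euc (m + 2))‖ • q.1,
        dir (dropLast (q.2 : Euc (m + 2))))) ((0 : Euc (k + 1)), v) := by
  have h := (contMDiffAt_smul_dropLast (k := k) hv0).prodMk (contMDiffAt_dir_dropLast hv0)
  have hj : ContMDiffAt (𝓘(ℝ, Euc (k + 1)).prod (𝓡 m)) I' ∞ D.jN
      (‖dropLast (v : Euc (m + 2))‖ • (0 : Euc (k + 1)), dir (dropLast (v : Euc (m + 2)))) :=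
    D.contMDiffAt_jN (by simp)
  exact ContMDiffAt.comp ((0 : Euc (k + 1)), v) hj h

theorem contMDiffWithinAt_clamp_capTime (a : Fin 2) {v : Sph (m + 1)}
    (hv : (v : Euc (m + 2)) (Fin.last (m + 1)) ≤ 0) (hv0 : dropLast (v : Euc (m + 2)) ≠ 0) :
    ContMDiffWithinAt (𝓘(ℝ, Euc (k + 1)).prod (𝓡 (m + 1))) (𝓡∂ 1) ∞
      (fun q : Euc (k + 1) × Sph (m + 1) => flipEnd a (clamp (capTime (q.1, (q.2 : Euc (m + 2))))))
      (handle k (m + 1) (lowerHalf (m + 1))) ((0 : Euc (k + 1)), v) := by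
  have h : ContMDiffWithinAt (𝓘(ℝ, Euc (k + 1)).prod (𝓡 (m + 1))) (𝓡∂ 1) ∞
      (fun q : Euc (k + 1) × Sph (m + 1) => clamp (capTime (q.1, (q.2 : Euc (m + 2)))))
      (handle k (m + 1) (lowerHalf (m + 1))) ((0 : Euc (k + 1)), v) := by
    refine contMDiffWithinAt_unitInterval ?_
    refine ContMDiffWithinAt.congr_of_mem (contMDiffWithinAt_of_contDiffAt capTime
      (contDiffAt_capTime hv0 (by simp)) contMDiff_handle_coe.contMDiffAt.contMDiffWithinAt) ?_
      (zero_mem_handle hv)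
    exact fun q hq => coe_clamp (capTime_mem hq)
  exact (contMDiff_flipEnd a).contMDiffAt.comp_contMDiffWithinAt _ h

theorem contMDiffWithinAt_capFlat (a : Fin 2) {v : Sph (m + 1)}
    (hv : (v : Euc (m + 2)) (Fin.last (m + 1)) ≤ 0) (hv0 : dropLast (v : Euc (m + 2)) ≠ 0) :
    ContMDiffWithinAt (𝓘(ℝ, Euc (k + 1)).prod (𝓡 (m + 1))) (I'.prod (𝓡∂ 1)) ∞ (D.capFlat a)
      (handle k (m + 1) (lowerHalf (m + 1))) ((0 : Euc (k + 1)), v) :=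
  (D.contMDiffAt_jN_capFlat hv0).contMDiffWithinAt.prodMk (contMDiffWithinAt_clamp_capTime a hv hv0)

/-- Each point has a neighbourhood in one of the pieces of `W` on which `flat` has an explicit
smooth formula. -/
theorem contMDiffOn_flat [T2Space M] : ContMDiffOn J (I'.prod (𝓡∂ 1)) ∞ D.flat D.coreSphereᶜ := by
  intro p hp
  refine ContMDiffAt.contMDiffWithinAt ?_
  rcases D.notMem_coreSphere_iff.1 hp with ⟨x, hx, t, rfl⟩ | ⟨a, v, hv, hv0, rfl⟩
  · have hq := D.notMem_endCores_of_notMem hx t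
    refine D.diffeo_iW.contMDiffAt_of_comp D.gluingW.isOpen_i hq ?_
    have h1 : ContMDiffAt I I' ∞ D.iN x :=
      (D.diffeo_iN.contMDiffOn x hx).contMDiffAt (D.isOpen_compl_core.mem_nhds hx)
    have h2 := contMDiffAt_clamp_cotScale (D.contMDiffAt_coreDist hx)
      (by filter_upwards [D.isOpen_compl_core.mem_nhds hx] with x' hx'; exact D.coreDist_pos hx') t
    have h3 := (ContMDiffAt.comp (x, t) h1 contMDiffAt_fst).prodMk h2
    exact h3.contMDiffWithinAt.congr_of_mem (fun q hq => D.flat_iW hq) hq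
  · have hq := zero_mem_handle (k := k) hv
    refine (D.gluingW.diffeo_j a).contMDiffAt_of_comp (D.gluingW.isOpen_j a) hq ?_
    have hcont : Continuous fun q : Euc (k + 1) × Sph (m + 1) => dropLast (q.2 : Euc (m + 2)) :=
      contDiff_dropLast.continuous.comp (by fun_prop)
    have hev : ∀ᶠ q in 𝓝[handle k (m + 1) (lowerHalf (m + 1))] ((0 : Euc (k + 1)), v),
        D.flat (D.jW a q) = D.capFlat a q := by
      have hn : ContinuousAt (fun q : Euc (k + 1) × Sph (m + 1) =>
        ‖q.1‖ * ‖dropLast (q.2 : Euc (m + 2))‖) ((0 : Euc (k + 1)), v) := by fun_prop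
      filter_upwards [self_mem_nhdsWithin, nhdsWithin_le_nhds
          (hcont.continuousAt.eventually_ne hv0),
        nhdsWithin_le_nhds (hn.eventually_lt (continuousAt_const (y := (1 / 4 : ℝ))) (by simp))]
        with q h1 h2 h3
      exact D.flat_jW a h1 h2 h3.le
    refine ContMDiffWithinAt.congr_of_eventuallyEq_of_mem ?_ hev hq
    exact D.contMDiffWithinAt_capFlat a hv hv0

/-- Smoothness of the homogeneous coordinates on a handle. -/
theorem contMDiffWithinAt_polar {E₁ H₁ X : Type*} [NormedAddCommGroup E₁] [NormedSpace ℝ E₁]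
    [TopologicalSpace H₁] [TopologicalSpace X] [ChartedSpace H₁ X] {I₁ : ModelWithCorners ℝ E₁ H₁}
    (a : Fin 2) {c : X → Euc (k + 1) × Euc (m + 2)} {s : Set X} {x : X} (hx : x ∈ s)
    (hc : ContMDiffWithinAt I₁ 𝓘(ℝ, Euc (k + 1) × Euc (m + 2)) ∞ c s x) (hY : (c x).2 ≠ 0)
    (h1 : ‖(c x).1‖ * ‖(c x).2‖ < 1) (hl : ∀ᶠ p in 𝓝[s] x, (c p).2 (Fin.last (m + 1)) ≤ 0) :
    ContMDiffWithinAt I₁ J ∞ (fun p => D.polar a (c p)) s x := by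
  have hn : ContMDiffWithinAt I₁ 𝓘(ℝ, Euc (k + 1)) ∞ (fun p => ‖(c p).2‖ • (c p).1) s x :=
    contMDiffWithinAt_of_contDiffAt (fun q : Euc (k + 1) × Euc (m + 2) => ‖q.2‖ • q.1)
      ((ContDiffAt.norm ℝ contDiffAt_snd hY).smul contDiffAt_fst) hc
  have hd : ContMDiffWithinAt I₁ (𝓡 (m + 1)) ∞ (fun p => dir (c p).2) s x :=
    contMDiffWithinAt_dir_comp (contMDiffWithinAt_of_contDiffAt
      (fun q : Euc (k + 1) × Euc (m + 2) => q.2) contDiffAt_snd hc) hY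
  have hev : ∀ᶠ p in 𝓝[s] x, (‖(c p).2‖ • (c p).1, dir (c p).2) ∈
      handle k (m + 1) (lowerHalf (m + 1)) := by
    have h2 : ∀ᶠ p in 𝓝[s] x, (c p).2 ≠ 0 := hc.continuousWithinAt.snd.eventually_ne hY
    have h3 : ∀ᶠ p in 𝓝[s] x, ‖‖(c p).2‖ • (c p).1‖ < 1 := by
      refine hn.continuousWithinAt.norm.eventually_lt continuousWithinAt_const ?_
      show ‖‖(c x).2‖ • (c x).1‖ < 1
      rwa [norm_smul, norm_norm, mul_comm]
    filter_upwards [hl, h2, h3] with p hp1 hp2 hp3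
    exact ⟨hp3, last_dir_nonpos hp2 hp1⟩
  have hmem := hev.self_of_nhdsWithin hx
  set t : Set X := {p | (‖(c p).2‖ • (c p).1, dir (c p).2) ∈ handle k (m + 1) (lowerHalf (m + 1))}
  have h : ContMDiffWithinAt I₁ (𝓘(ℝ, Euc (k + 1)).prod (𝓡 (m + 1))) ∞
      (fun p => (‖(c p).2‖ • (c p).1, dir (c p).2)) (s ∩ t) x :=
    (hn.prodMk hd).mono inter_subset_left
  have h' : ContMDiffWithinAt I₁ J ∞ (D.jW a ∘ fun p => (‖(c p).2‖ • (c p).1, dir (c p).2))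
      (s ∩ t) x :=
    ContMDiffWithinAt.comp x ((D.gluingW.diffeo_j a).contMDiffOn _ hmem) h (fun p hp => hp.2)
  exact h'.mono_of_mem_nhdsWithin (inter_mem self_mem_nhdsWithin hev)

theorem contMDiffOn_unflat [T2Space M] :
    ContMDiffOn (I'.prod (𝓡∂ 1)) J ∞ D.unflat D.middleᶜ := by
  intro q hq
  refine ContMDiffAt.contMDiffWithinAt ?_
  have himg : ∀ a, flipEnd a '' univ = univ := fun a =>
    eq_univ_of_forall fun t => ⟨flipEnd a t, mem_univ _, by simp⟩
  rcases D.notMem_middle_iff.1 hq with ⟨x, hx, t, rfl⟩ | ⟨a, v, t, ht, rfl⟩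
  · have h0 := D.diffeo_iN.prodMap (isDiffeoOnto_flipEnd 0)
    have ho : IsOpen (Prod.map D.iN (flipEnd 0) '' (D.coreᶜ ×ˢ univ)) := by
      rw [prodMap_image_prod, himg]
      exact D.gluingN.isOpen_i.prod isOpen_univ
    have hf0 : ∀ t, flipEnd 0 t = t := fun t => by simp [flipEnd]
    have h := h0.contMDiffAt_of_comp (K := J) ho (x := (x, t)) ⟨hx, mem_univ _⟩ (F := D.unflat) ?_
    · simpa [hf0] using h
    have h1 := contMDiffAt_clamp_cotScale (L := fun x => (D.coreDist x)⁻¹)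
      (contMDiffWithinAt_of_contDiffAt (fun z : ℝ => z⁻¹)
        (contDiffAt_inv ℝ (D.coreDist_pos hx).ne') (D.contMDiffAt_coreDist hx))
      (by filter_upwards [D.isOpen_compl_core.mem_nhds hx] with x' hx'
          exact inv_pos.2 (D.coreDist_pos hx')) t
    have h2 := ContMDiffAt.comp (x, t) (D.contMDiffAt_iW (D.notMem_endCores_of_notMem hx _))
      (contMDiffAt_fst.prodMk h1)
    refine h2.contMDiffWithinAt.congr_of_mem ?_ ⟨hx, mem_univ _⟩
    rintro ⟨x', t'⟩ ⟨hx', -⟩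
    simp only [Prod.map, hf0]
    exact D.unflat_iN hx' t'
  · have h0 := D.diffeo_jN.prodMap (isDiffeoOnto_flipEnd a)
    have ho : IsOpen (Prod.map D.jN (flipEnd a) '' (handle k m univ ×ˢ univ)) := by
      rw [prodMap_image_prod, himg]
      exact D.isOpen_jN.prod isOpen_univ
    have hmem : ((0 : Euc (k + 1)), v) ∈ handle k m univ := mem_handle (by simp)
    refine h0.contMDiffAt_of_comp (K := J) ho (x := ((0, v), t)) ⟨hmem, mem_univ _⟩ ?_
    have hc : ContMDiff ((𝓘(ℝ, Euc (k + 1)).prod (𝓡 m)).prod (𝓡∂ 1))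
        𝓘(ℝ, (Euc (k + 1) × Euc (m + 1)) × ℝ) ∞
        (fun q : (Euc (k + 1) × Sph m) × Icc (0 : ℝ) 1 =>
          ((q.1.1, (q.1.2 : Euc (m + 1))), (q.2 : ℝ))) :=
      (contMDiff_handle_coe.comp contMDiff_fst).prodMk_space
        (contMDiff_coe_unitInterval.comp contMDiff_snd)
    have hcos : cos (π * t) ≠ 0 :=
      (cos_pos_of_mem_Ioo ⟨by nlinarith [pi_pos, t.2.1], by nlinarith [pi_pos]⟩).ne'
    have hV : ContMDiffAt ((𝓘(ℝ, Euc (k + 1)).prod (𝓡 m)).prod (𝓡∂ 1))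
        𝓘(ℝ, Euc (k + 1) × Euc (m + 2)) ∞
        (fun q : (Euc (k + 1) × Sph m) × Icc (0 : ℝ) 1 =>
          (q.1.1, unflatVec ((q.1.1, (q.1.2 : Euc (m + 1))), (q.2 : ℝ)))) ((0, v), t) :=
      contMDiffWithinAt_of_contDiffAt
        (fun p : (Euc (k + 1) × Euc (m + 1)) × ℝ => (p.1.1, unflatVec p))
        (ContDiffAt.prodMk (by fun_prop) (contDiffAt_unflatVec hcos)) hc.contMDiffAt
    have htev : ∀ᶠ q : (Euc (k + 1) × Sph m) × Icc (0 : ℝ) 1 in 𝓝 ((0, v), t),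
        (q.2 : ℝ) < 1 / 2 :=
      ContinuousAt.eventually_lt (by fun_prop) continuousAt_const ht
    have hP : ContMDiffAt ((𝓘(ℝ, Euc (k + 1)).prod (𝓡 m)).prod (𝓡∂ 1)) J ∞
        (fun q : (Euc (k + 1) × Sph m) × Icc (0 : ℝ) 1 =>
          D.polar a (q.1.1, unflatVec ((q.1.1, (q.1.2 : Euc (m + 1))), (q.2 : ℝ)))) ((0, v), t) :=
              by
      refine D.contMDiffWithinAt_polar a (mem_univ _) hV.contMDiffWithinAt
        (unflatVec_ne_zero _ v _) (by simp) ?_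
      rw [nhdsWithin_univ]
      filter_upwards [htev] with q hq
      exact unflatVec_last_nonpos _ _ q.2.2.1 hq
    refine ContMDiffAt.contMDiffWithinAt (hP.congr_of_eventuallyEq ?_)
    have hx4 : ∀ᶠ q : (Euc (k + 1) × Sph m) × Icc (0 : ℝ) 1 in 𝓝 ((0, v), t), ‖q.1.1‖ < 1 / 4 :=
      ContinuousAt.eventually_lt (by fun_prop) continuousAt_const (by simp)
    have hn : ∀ᶠ q : (Euc (k + 1) × Sph m) × Icc (0 : ℝ) 1 in 𝓝 ((0, v), t),
        ‖q.1.1‖ * ‖unflatVec ((q.1.1, (q.1.2 : Euc (m + 1))), (q.2 : ℝ))‖ < 1 := by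
      have := hV.continuousAt
      exact ContinuousAt.eventually_lt (this.fst.norm.mul this.snd.norm)
          continuousAt_const (by simp)
    filter_upwards [htev, hx4, hn] with q h1 h2 h3
    exact D.unflat_jN a q.1.2 h1 h2.le h3

/-! ### Smoothness of `bridge` -/

theorem isOpen_bridgeZone : IsOpen D.bridgeZone := by
  refine IsOpen.union ?_ (isOpen_iUnion fun a => ?_)
  · have hU : IsOpen {q : M × Icc (0 : ℝ) 1 | q.1 ∈ D.f '' tube k m univ ∧ 0 < (q.2 : ℝ) ∧
        (q.2 : ℝ) < 1} :=
      (D.isOpen_f.preimage continuous_fst).and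
        ((isOpen_lt continuous_const (continuous_subtype_val.comp continuous_snd)).and
          (isOpen_lt (continuous_subtype_val.comp continuous_snd) continuous_const))
    have h := D.diffeo_iW.isOpen_image D.gluingW.isOpen_i hU
    rwa [inter_eq_right.2 fun q hq => D.notMem_endCores_of_Ioo q.1 hq.2] at h
  · have hU : IsOpen {q : Euc (k + 1) × Sph (m + 1) | (q.2 : Euc (m + 2)) (Fin.last (m + 1)) < 0} :=
      isOpen_lt (by fun_prop) continuous_const
    exact (D.gluingW.diffeo_j a).isOpen_image (D.gluingW.isOpen_j a) hU

theorem contMDiff_dropLast_coe_fst {d e : ℕ} : ContMDiff ((𝓡 d).prod 𝓘(ℝ, Euc e)) 𝓘(ℝ, Euc d) ∞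
    (fun q : Sph d × Euc e => dropLast (q.1 : Euc (d + 1))) :=
  contDiff_dropLast.contMDiff.comp (contMDiff_coe_sph.comp contMDiff_fst)

/-- Away from the poles `bridge` is given by polar coordinates on the sphere. -/
theorem contMDiffAt_bridge_of_ne [T2Space M] {w : Sph (k + 1)} {y : Euc (m + 1)} (hy : ‖y‖ < 1)
    (hw : dropLast (w : Euc (k + 2)) ≠ 0) :
    ContMDiffAt ((𝓡 (k + 1)).prod 𝓘(ℝ, Euc (m + 1))) J ∞ D.bridge (w, y) := by
  have hm := arccos_last_mem hw
  have hsq := sphere_coords_sq w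
  have h0 := norm_pos_iff.2 hw
  have h1 : ContMDiffAt ((𝓡 (k + 1)).prod 𝓘(ℝ, Euc (m + 1))) (𝓡 k) ∞
      (fun q : Sph (k + 1) × Euc (m + 1) => dir (dropLast (q.1 : Euc (k + 2)))) (w, y) :=
    contMDiffWithinAt_dir_comp contMDiff_dropLast_coe_fst.contMDiffAt hw
  have hF : ContDiffAt ℝ ∞ (fun p : Euc (k + 2) × Euc (m + 1) => (‖dropLast p.1‖ / 4) • p.2)
      ((w : Euc (k + 2)), y) := by
    have hd : ContDiffAt ℝ ∞ (fun p : Euc (k + 2) × Euc (m + 1) => dropLast p.1)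
        ((w : Euc (k + 2)), y) := (contDiff_dropLast.comp contDiff_fst).contDiffAt
    exact ((hd.norm ℝ hw).div_const _).smul contDiffAt_snd
  have h2 : ContMDiffAt ((𝓡 (k + 1)).prod 𝓘(ℝ, Euc (m + 1))) 𝓘(ℝ, Euc (m + 1)) ∞
      (fun q : Sph (k + 1) × Euc (m + 1) => (‖dropLast (q.1 : Euc (k + 2))‖ / 4) • q.2) (w, y) :=
    contMDiffWithinAt_of_contDiffAt
      (fun p : Euc (k + 2) × Euc (m + 1) => (‖dropLast p.1‖ / 4) • p.2)
      (c := fun q : Sph (k + 1) × Euc (m + 1) => ((q.1 : Euc (k + 2)), q.2)) (x := (w, y))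
      hF contMDiff_tube_coe.contMDiffAt
  have hG : ContDiffAt ℝ ∞ (fun p : Euc (k + 2) × Euc (m + 1) => arccos (p.1 (Fin.last (k + 1)))
      / π)
      ((w : Euc (k + 2)), y) :=
    ContDiffAt.div_const (ContDiffAt.comp (g := arccos) ((w : Euc (k + 2)), y)
      (contDiffAt_arccos (by simp only; nlinarith) (by simp only; nlinarith)) (by fun_prop)) _
  have h3 : ContMDiffAt ((𝓡 (k + 1)).prod 𝓘(ℝ, Euc (m + 1))) (𝓡∂ 1) ∞
      (fun q : Sph (k + 1) × Euc (m + 1) =>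
        clamp (arccos ((q.1 : Euc (k + 2)) (Fin.last (k + 1))) / π)) (w, y) := by
    refine contMDiffWithinAt_unitInterval ?_
    simp only [coe_clamp_arccos]
    exact contMDiffWithinAt_of_contDiffAt
      (fun p : Euc (k + 2) × Euc (m + 1) => arccos (p.1 (Fin.last (k + 1))) / π)
      (c := fun q : Sph (k + 1) × Euc (m + 1) => ((q.1 : Euc (k + 2)), q.2)) (x := (w, y))
      hG contMDiff_tube_coe.contMDiffAt
  have hf : ContMDiffAt ((𝓡 k).prod 𝓘(ℝ, Euc (m + 1))) I ∞ D.f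
      (dir (dropLast (w : Euc (k + 2))), (‖dropLast (w : Euc (k + 2))‖ / 4) • y) :=
    D.contMDiffAt_f (norm_scaled_lt hy)
  have h4 : ContMDiffAt ((𝓡 (k + 1)).prod 𝓘(ℝ, Euc (m + 1))) I ∞
      (fun q : Sph (k + 1) × Euc (m + 1) => D.f (dir (dropLast (q.1 : Euc (k + 2))),
        (‖dropLast (q.1 : Euc (k + 2))‖ / 4) • q.2)) (w, y) :=
    ContMDiffAt.comp (w, y) hf (h1.prodMk h2)
  have hi : ContMDiffAt (I.prod (𝓡∂ 1)) J ∞ D.iW (D.f (dir (dropLast (w : Euc (k + 2))),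
      (‖dropLast (w : Euc (k + 2))‖ / 4) • y),
      clamp (arccos ((w : Euc (k + 2)) (Fin.last (k + 1))) / π)) :=
    D.contMDiffAt_iW (D.notMem_endCores_of_Ioo _ (by rw [coe_clamp_arccos]; exact hm))
  refine (ContMDiffAt.comp (w, y) hi (h4.prodMk h3)).congr_of_eventuallyEq ?_
  have hc : ContinuousAt (fun q : Sph (k + 1) × Euc (m + 1) => dropLast (q.1 : Euc (k + 2)))
      (w, y) :=
    contMDiff_dropLast_coe_fst.continuous.continuousAt
  filter_upwards [hc.eventually_ne hw] with q hq
  exact D.bridge_of_ne hq q.2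

theorem contMDiffAt_bridge_of_eq {w : Sph (k + 1)} (hw : dropLast (w : Euc (k + 2)) = 0)
    (y : Euc (m + 1)) :
    ContMDiffAt ((𝓡 (k + 1)).prod 𝓘(ℝ, Euc (m + 1))) J ∞ D.bridge (w, y) := by
  obtain ⟨a, ha⟩ := pole_sign hw
  have hpos : 0 < endSign a * (w : Euc (k + 2)) (Fin.last (k + 1)) := by
    rw [ha, endSign_mul_self]; norm_num
  have hl : (w : Euc (k + 2)) (Fin.last (k + 1)) ≠ 0 := by
    intro h; rw [h, mul_zero] at hpos; exact hpos.false
  have hF : ContDiffAt ℝ ∞ (fun p : Euc (k + 2) × Euc (m + 1) => (dropLast p.1, bridgeVec p))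
      ((w : Euc (k + 2)), y) :=
    ContDiffAt.prodMk (contDiff_dropLast.comp contDiff_fst).contDiffAt (contDiffAt_bridgeVec hl)
  have hV : ContMDiffAt ((𝓡 (k + 1)).prod 𝓘(ℝ, Euc (m + 1))) 𝓘(ℝ, Euc (k + 1) × Euc (m + 2)) ∞
      (fun q : Sph (k + 1) × Euc (m + 1) =>
        (dropLast (q.1 : Euc (k + 2)), bridgeVec ((q.1 : Euc (k + 2)), q.2))) (w, y) :=
    contMDiffWithinAt_of_contDiffAt
      (fun p : Euc (k + 2) × Euc (m + 1) => (dropLast p.1, bridgeVec p))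
      (c := fun q : Sph (k + 1) × Euc (m + 1) => ((q.1 : Euc (k + 2)), q.2)) (x := (w, y))
      hF contMDiff_tube_coe.contMDiffAt
  have hP : ContMDiffAt ((𝓡 (k + 1)).prod 𝓘(ℝ, Euc (m + 1))) J ∞
      (fun q : Sph (k + 1) × Euc (m + 1) =>
        D.polar a (dropLast (q.1 : Euc (k + 2)), bridgeVec ((q.1 : Euc (k + 2)), q.2))) (w, y) :=
    D.contMDiffWithinAt_polar a (mem_univ _) hV.contMDiffWithinAt (bridgeVec_ne_zero hl y)
      (by simp [hw]) (Eventually.of_forall fun q => bridgeVec_last_nonpos _ _)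
  refine hP.congr_of_eventuallyEq ?_
  have h1 : ∀ᶠ q : Sph (k + 1) × Euc (m + 1) in 𝓝 (w, y),
      0 < endSign a * (q.1 : Euc (k + 2)) (Fin.last (k + 1)) :=
    ContinuousAt.eventually_lt continuousAt_const (by fun_prop) hpos
  have h2 : ∀ᶠ q : Sph (k + 1) × Euc (m + 1) in 𝓝 (w, y),
      ‖dropLast (q.1 : Euc (k + 2))‖ * ‖bridgeVec ((q.1 : Euc (k + 2)), q.2)‖ < 1 := by
    have := hV.continuousAt
    exact ContinuousAt.eventually_lt (this.fst.norm.mul this.snd.norm) continuousAt_const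
      (by simp [hw])
  filter_upwards [h1, h2] with q hq1 hq2
  exact D.bridge_pole a hq1 hq2

theorem contMDiffOn_bridge [T2Space M] :
    ContMDiffOn ((𝓡 (k + 1)).prod 𝓘(ℝ, Euc (m + 1))) J ∞ D.bridge (tube (k + 1) m univ) := by
  rintro ⟨w, y⟩ hy
  by_cases hw : dropLast (w : Euc (k + 2)) = 0
  · exact (D.contMDiffAt_bridge_of_eq hw y).contMDiffWithinAt
  · exact (D.contMDiffAt_bridge_of_ne hy.1 hw).contMDiffWithinAt

theorem contMDiffAt_unbridge_iW {u : Sph k} {y : Euc (m + 1)} (hy : ‖y‖ < 1) {t : Icc (0 : ℝ) 1}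
    (ht : 0 < (t : ℝ) ∧ (t : ℝ) < 1) :
    ContMDiffAt J ((𝓡 (k + 1)).prod 𝓘(ℝ, Euc (m + 1))) ∞ D.unbridge (D.iW (D.f (u, y), t)) := by
  have hq := D.notMem_endCores_of_Ioo (D.f (u, y)) ht
  refine D.diffeo_iW.contMDiffAt_of_comp D.gluingW.isOpen_i hq ?_
  refine ContMDiffAt.contMDiffWithinAt ?_
  refine D.diffeo_f.contMDiffAt_prod_of_comp D.isOpen_f (mem_tube hy)
    (F := fun q : M × Icc (0 : ℝ) 1 => D.unbridge (D.iW q)) ?_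
  have hs := sin_pi_mul_pos ht.1 ht.2
  let c : (Sph k × Euc (m + 1)) × Icc (0 : ℝ) 1 → (Euc (k + 1) × Euc (m + 1)) × ℝ :=
    fun q => (((q.1.1 : Euc (k + 1)), q.1.2), (q.2 : ℝ))
  have hc : ContMDiffAt (((𝓡 k).prod 𝓘(ℝ, Euc (m + 1))).prod (𝓡∂ 1))
      𝓘(ℝ, (Euc (k + 1) × Euc (m + 1)) × ℝ) ∞ c ((u, y), t) :=
    ((contMDiff_tube_coe.comp contMDiff_fst).prodMk_space
      (contMDiff_coe_unitInterval.comp contMDiff_snd)).contMDiffAt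
  have hsin : ContDiffAt ℝ ∞ (fun p : (Euc (k + 1) × Euc (m + 1)) × ℝ => sin (π * p.2))
      (c ((u, y), t)) := by fun_prop
  have hcos : ContDiffAt ℝ ∞ (fun p : (Euc (k + 1) × Euc (m + 1)) × ℝ => cos (π * p.2))
      (c ((u, y), t)) := by fun_prop
  have hA : ContDiffAt ℝ ∞ (fun p : (Euc (k + 1) × Euc (m + 1)) × ℝ =>
      appendLast (sin (π * p.2) • p.1.1) (cos (π * p.2))) (c ((u, y), t)) :=
    ContDiffAt.comp (g := fun p : Euc (k + 1) × ℝ => appendLast p.1 p.2) (c ((u, y), t))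
      contDiff_appendLast.contDiffAt ((hsin.smul (by fun_prop)).prodMk hcos)
  have hB : ContDiffAt ℝ ∞ (fun p : (Euc (k + 1) × Euc (m + 1)) × ℝ =>
      (4 / sin (π * p.2)) • p.1.2) (c ((u, y), t)) :=
    (contDiffAt_const.div hsin hs.ne').smul (by fun_prop)
  have h1 := contMDiffWithinAt_dir_comp (contMDiffWithinAt_of_contDiffAt _ hA hc) (by
    intro h
    have := norm_cylinder u (π * t)
    rw [show appendLast (sin (π * t) • (u : Euc (k + 1))) (cos (π * t)) = 0 from h, norm_zero]
        at this
    exact zero_ne_one this)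
  have h2 := contMDiffWithinAt_of_contDiffAt _ hB hc
  refine ((h1.prodMk h2).mono (subset_univ _)).congr_of_eventuallyEq_of_mem ?_
    ⟨mem_tube hy, mem_univ _⟩
  have hev : ∀ᶠ t' : Icc (0 : ℝ) 1 in 𝓝 t, 0 < (t' : ℝ) ∧ (t' : ℝ) < 1 :=
    (ContinuousAt.eventually_lt continuousAt_const (by fun_prop) ht.1).and
      (ContinuousAt.eventually_lt (by fun_prop) continuousAt_const ht.2)
  filter_upwards [nhdsWithin_le_nhds (continuous_snd.continuousAt.eventually hev),
      self_mem_nhdsWithin] with q hq1 hq2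
  exact D.unbridge_iW hq2.1.1 (D.notMem_endCores_of_Ioo _ hq1)

theorem contMDiffAt_unbridge_jW (a : Fin 2) {v : Sph (m + 1)}
    (hv : (v : Euc (m + 2)) (Fin.last (m + 1)) < 0) :
    ContMDiffAt J ((𝓡 (k + 1)).prod 𝓘(ℝ, Euc (m + 1))) ∞ D.unbridge (D.jW a (0, v)) := by
  have hq := zero_mem_handle (k := k) hv.le
  refine (D.gluingW.diffeo_j a).contMDiffAt_of_comp (D.gluingW.isOpen_j a) hq ?_
  refine ContMDiffWithinAt.congr_of_mem ?_ (fun q hq => D.unbridge_jW a hq) hq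
  let c : Euc (k + 1) × Sph (m + 1) → Euc (k + 1) × Euc (m + 2) :=
    fun q => (q.1, (q.2 : Euc (m + 2)))
  have hc : ContMDiffWithinAt (𝓘(ℝ, Euc (k + 1)).prod (𝓡 (m + 1)))
      𝓘(ℝ, Euc (k + 1) × Euc (m + 2)) ∞ c (handle k (m + 1) (lowerHalf (m + 1))) (0, v) :=
    contMDiff_handle_coe.contMDiffAt.contMDiffWithinAt
  have hS : ContDiffAt ℝ ∞ (fun p : Euc (k + 1) × Euc (m + 2) =>
      -(π * p.2 (Fin.last (m + 1)) / 2) * sinc ‖(-(π * p.2 (Fin.last (m + 1)) / 2)) • p.1‖)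
      (c (0, v)) := (contDiff_halfAngle.mul contDiff_sinc_halfAngle).contDiffAt
  have hA : ContDiffAt ℝ ∞ (fun p : Euc (k + 1) × Euc (m + 2) =>
      appendLast ((-(π * p.2 (Fin.last (m + 1)) / 2) *
        sinc ‖(-(π * p.2 (Fin.last (m + 1)) / 2)) • p.1‖) • p.1)
        (endSign a * cos ‖(-(π * p.2 (Fin.last (m + 1)) / 2)) • p.1‖)) (c (0, v)) :=
    ContDiffAt.comp (g := fun p : Euc (k + 1) × ℝ => appendLast p.1 p.2) (c (0, v))
      contDiff_appendLast.contDiffAt ((hS.smul contDiffAt_fst).prodMk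
        (contDiffAt_const.mul contDiff_cos_halfAngle.contDiffAt))
  have hB : ContDiffAt ℝ ∞ (fun p : Euc (k + 1) × Euc (m + 2) =>
      (4 / (-(π * p.2 (Fin.last (m + 1)) / 2) *
        sinc ‖(-(π * p.2 (Fin.last (m + 1)) / 2)) • p.1‖)) • dropLast p.2) (c (0, v)) := by
    refine (contDiffAt_const.div hS ?_).smul (contDiff_dropLast.comp contDiff_snd).contDiffAt
    have hne : -(π * (v : Euc (m + 2)) (Fin.last (m + 1)) / 2) ≠ 0 := by
      have := pi_pos
      have : π * (v : Euc (m + 2)) (Fin.last (m + 1)) < 0 := mul_neg_of_pos_of_neg this hv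
      linarith
    simpa [c] using hne
  have h1 := contMDiffWithinAt_dir_comp (contMDiffWithinAt_of_contDiffAt _ hA hc) (by
    simp only [c, smul_zero, norm_zero, cos_zero, mul_one]
    refine appendLast_ne_zero' _ fun h => ?_
    have := abs_endSign a
    rw [h] at this; simp at this)
  have h2 := contMDiffWithinAt_of_contDiffAt _ hB hc
  exact h1.prodMk h2

theorem contMDiffOn_unbridge :
    ContMDiffOn J ((𝓡 (k + 1)).prod 𝓘(ℝ, Euc (m + 1))) ∞ D.unbridge D.bridgeZone := by
  intro p hp
  rcases D.bridgeZone_cases hp with ⟨u, y, t, hy, ht, rfl⟩ | ⟨a, v, hv, rfl⟩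
  · exact (D.contMDiffAt_unbridge_iW hy ht).contMDiffWithinAt
  · exact (D.contMDiffAt_unbridge_jW a hv).contMDiffWithinAt

theorem isDiffeoOnto_bridge [T2Space M] :
    IsDiffeoOnto ((𝓡 (k + 1)).prod 𝓘(ℝ, Euc (m + 1))) J D.bridge (tube (k + 1) m univ) ∧
      IsOpen (D.bridge '' tube (k + 1) m univ) :=
  isDiffeoOnto_and_isOpen_image isOpen_tube_univ D.isOpen_bridgeZone (fun _ hp => D.bridge_mem hp.1)
    (fun _ hp => D.unbridge_bridge hp.1) (fun _ hp => D.bridge_unbridge hp) D.contMDiffOn_bridge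
    D.contMDiffOn_unbridge

/-! ### Smoothness of the handle of `N × [0, 1]` -/

theorem half_sub_arctan_mem (z : ℝ) : 0 < 1 / 2 - arctan z / π ∧ 1 / 2 - arctan z / π < 1 := by
  have h1 : arctan z / π < 1 / 2 := by
    rw [div_lt_iff₀ pi_pos]; linarith [arctan_lt_pi_div_two z]
  have h2 : -(1 / 2) < arctan z / π := by
    rw [lt_div_iff₀ pi_pos]; linarith [neg_pi_div_two_lt_arctan z]
  constructor <;> linarith

theorem coe_clamp_half_sub_arctan (z : ℝ) :
    (clamp (1 / 2 - arctan z / π) : ℝ) = 1 / 2 - arctan z / π :=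
  coe_clamp ⟨(half_sub_arctan_mem z).1.le, (half_sub_arctan_mem z).2.le⟩

theorem norm_quarter_lt {z : Euc (k + 2)} (hz : ‖z‖ < 1) : ‖(1 / 4 : ℝ) • dropLast z‖ < 1 := by
  rw [norm_smul, Real.norm_of_nonneg (by norm_num)]
  linarith [norm_dropLast_le z, norm_nonneg (dropLast z)]

/-- The inverse of `newHandle`. -/
def unhandle (q : N × Icc (0 : ℝ) 1) : Euc (k + 2) × Sph m :=
  extendOn D.jN (handle k m univ)
    (fun p => (appendLast ((4 : ℝ) • p.1) (4 * (cos (π * q.2) / sin (π * q.2))), p.2))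
    (fun _ => (0, dir 0)) q.1

theorem unhandle_jN {x : Euc (k + 1)} (hx : ‖x‖ < 1) (v : Sph m) (t : Icc (0 : ℝ) 1) :
    D.unhandle (D.jN (x, v), t) =
      (appendLast ((4 : ℝ) • x) (4 * (cos (π * t) / sin (π * t))), v) :=
  extendOn_apply D.diffeo_jN.injOn (mem_handle hx)

theorem unhandle_newHandle {z : Euc (k + 2)} (hz : ‖z‖ < 1) (v : Sph m) :
    D.unhandle (D.newHandle (z, v)) = (z, v) := by
  rw [newHandle, D.unhandle_jN (norm_quarter_lt hz), coe_clamp_half_sub_arctan, cot_half_sub_arctan]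
  refine Prod.ext ?_ rfl
  simp only
  rw [one_div, smul_smul, mul_inv_cancel₀ (by norm_num), one_smul,
    mul_div_cancel₀ _ (by norm_num : (4 : ℝ) ≠ 0), appendLast_dropLast]

theorem newHandle_unhandle {x : Euc (k + 1)} (hx : ‖x‖ < 1) (v : Sph m) {t : Icc (0 : ℝ) 1}
    (ht : 0 < (t : ℝ) ∧ (t : ℝ) < 1) :
    D.newHandle (D.unhandle (D.jN (x, v), t)) = (D.jN (x, v), t) := by
  have hpi := pi_pos
  rw [D.unhandle_jN hx, newHandle]
  simp only [dropLast_appendLast, appendLast_last, smul_smul]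
  rw [mul_div_cancel_left₀ _ (by norm_num : (4 : ℝ) ≠ 0), arctan_cot ht.1 ht.2]
  have : 1 / 2 - (π / 2 - π * t) / π = t := by field_simp; ring
  rw [this, clamp_coe]
  norm_num

theorem contMDiffOn_newHandle :
    ContMDiffOn (𝓘(ℝ, Euc (k + 2)).prod (𝓡 m)) (I'.prod (𝓡∂ 1)) ∞ D.newHandle
      (handle (k + 1) m univ) := by
  rintro ⟨z, v⟩ hz
  refine ContMDiffAt.contMDiffWithinAt ?_
  have hd : ContMDiffAt (𝓘(ℝ, Euc (k + 2)).prod (𝓡 m)) 𝓘(ℝ, Euc (k + 1)) ∞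
      (fun q : Euc (k + 2) × Sph m => (1 / 4 : ℝ) • dropLast q.1) (z, v) :=
    contMDiffWithinAt_of_contDiffAt (fun z : Euc (k + 2) => (1 / 4 : ℝ) • dropLast z)
      (c := fun q : Euc (k + 2) × Sph m => q.1) (x := (z, v))
      (by fun_prop) contMDiffAt_fst
  have h1 : ContMDiffAt (𝓘(ℝ, Euc (k + 2)).prod (𝓡 m)) I' ∞
      (fun q : Euc (k + 2) × Sph m => D.jN ((1 / 4 : ℝ) • dropLast q.1, q.2)) (z, v) :=
    ContMDiffAt.comp (z, v) (D.contMDiffAt_jN (v := v) (norm_quarter_lt hz.1))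
      (hd.prodMk contMDiffAt_snd)
  have h2 : ContMDiffAt (𝓘(ℝ, Euc (k + 2)).prod (𝓡 m)) (𝓡∂ 1) ∞ (fun q : Euc (k + 2) × Sph m =>
      clamp (1 / 2 - arctan (q.1 (Fin.last (k + 1)) / 4) / π)) (z, v) := by
    refine contMDiffWithinAt_unitInterval ?_
    simp only [coe_clamp_half_sub_arctan]
    exact contMDiffWithinAt_of_contDiffAt
      (fun z : Euc (k + 2) => 1 / 2 - arctan (z (Fin.last (k + 1)) / 4) / π)
      (c := fun q : Euc (k + 2) × Sph m => q.1) (x := (z, v))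
      (contDiffAt_const.sub (ContDiffAt.div_const (ContDiffAt.arctan (by fun_prop)) _))
      contMDiffAt_fst
  exact h1.prodMk h2

/-- The open set of `N × [0, 1]` containing the new handle. -/
def handleZone : Set (N × Icc (0 : ℝ) 1) :=
  {q | q.1 ∈ D.jN '' handle k m univ ∧ 0 < (q.2 : ℝ) ∧ (q.2 : ℝ) < 1}

theorem isOpen_handleZone : IsOpen D.handleZone :=
  (D.isOpen_jN.preimage continuous_fst).and
    ((isOpen_lt continuous_const (continuous_subtype_val.comp continuous_snd)).and
      (isOpen_lt (continuous_subtype_val.comp continuous_snd) continuous_const))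

theorem newHandle_mem {q : Euc (k + 2) × Sph m} (hq : ‖q.1‖ < 1) : D.newHandle q ∈ D.handleZone :=
    by
  refine ⟨⟨_, mem_handle (norm_quarter_lt hq), rfl⟩, ?_⟩
  rw [newHandle, coe_clamp_half_sub_arctan]
  exact half_sub_arctan_mem _

theorem contMDiffOn_unhandle :
    ContMDiffOn (I'.prod (𝓡∂ 1)) (𝓘(ℝ, Euc (k + 2)).prod (𝓡 m)) ∞ D.unhandle D.handleZone := by
  rintro ⟨_, t⟩ ⟨⟨⟨x, v⟩, hx, rfl⟩, ht⟩
  refine ContMDiffAt.contMDiffWithinAt ?_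
  refine D.diffeo_jN.contMDiffAt_prod_of_comp D.isOpen_jN hx ?_
  have hs := sin_pi_mul_pos ht.1 ht.2
  let c : (Euc (k + 1) × Sph m) × Icc (0 : ℝ) 1 → Euc (k + 1) × ℝ := fun q => (q.1.1, (q.2 : ℝ))
  have hc : ContMDiffAt ((𝓘(ℝ, Euc (k + 1)).prod (𝓡 m)).prod (𝓡∂ 1)) 𝓘(ℝ, Euc (k + 1) × ℝ) ∞ c
      ((x, v), t) :=
    ((contMDiff_fst.comp contMDiff_fst).prodMk_space
      (contMDiff_coe_unitInterval.comp contMDiff_snd)).contMDiffAt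
  have hF : ContDiffAt ℝ ∞ (fun p : Euc (k + 1) × ℝ =>
      appendLast ((4 : ℝ) • p.1) (4 * (cos (π * p.2) / sin (π * p.2)))) (c ((x, v), t)) := by
    have hsin : ContDiffAt ℝ ∞ (fun p : Euc (k + 1) × ℝ => sin (π * p.2)) (c ((x, v), t)) := by
      fun_prop
    have hcos : ContDiffAt ℝ ∞ (fun p : Euc (k + 1) × ℝ => cos (π * p.2)) (c ((x, v), t)) := by
      fun_prop
    exact ContDiffAt.comp (g := fun p : Euc (k + 1) × ℝ => appendLast p.1 p.2) (c ((x, v), t))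
      contDiff_appendLast.contDiffAt
      (ContDiffAt.prodMk (by fun_prop) (contDiffAt_const.mul (hcos.div hsin hs.ne')))
  have h1 := contMDiffWithinAt_of_contDiffAt _ hF hc
  have h2 : ContMDiffAt ((𝓘(ℝ, Euc (k + 1)).prod (𝓡 m)).prod (𝓡∂ 1)) (𝓡 m) ∞
      (fun q : (Euc (k + 1) × Sph m) × Icc (0 : ℝ) 1 => q.1.2) ((x, v), t) :=
    (contMDiff_snd.comp contMDiff_fst).contMDiffAt
  refine ((ContMDiffWithinAt.prodMk h1 h2).mono (subset_univ _)).congr_of_mem ?_ ⟨hx, mem_univ _⟩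
  exact fun q hq => D.unhandle_jN hq.1.1 q.1.2 q.2

theorem isDiffeoOnto_newHandle :
    IsDiffeoOnto (𝓘(ℝ, Euc (k + 2)).prod (𝓡 m)) (I'.prod (𝓡∂ 1)) D.newHandle
      (handle (k + 1) m univ) ∧ IsOpen (D.newHandle '' handle (k + 1) m univ) := by
  refine isDiffeoOnto_and_isOpen_image isOpen_handle_univ D.isOpen_handleZone
    (fun _ hq => D.newHandle_mem hq.1) (fun q hq => D.unhandle_newHandle hq.1 q.2) ?_
    D.contMDiffOn_newHandle D.contMDiffOn_unhandle
  rintro ⟨_, t⟩ ⟨⟨⟨x, v⟩, hx, rfl⟩, ht⟩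
  exact D.newHandle_unhandle hx.1 v ht

/-! ### The surgery on `W` -/

theorem isClosed_coreSphere [T2Space M] [T2Space W] : IsClosed D.coreSphere := by
  have : D.coreSphere = D.bridge '' (univ ×ˢ {0}) := by
    ext p
    rw [mem_coreSphere]
    constructor
    · rintro ⟨w, rfl⟩
      exact ⟨(w, 0), by simp, rfl⟩
    · rintro ⟨⟨w, y⟩, ⟨-, rfl : y = 0⟩, rfl⟩
      exact ⟨w, rfl⟩
  rw [this]
  refine IsCompact.isClosed ((isCompact_univ.prod isCompact_singleton).image_of_continuousOn
    (D.contMDiffOn_bridge.continuousOn.mono ?_))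
  rintro ⟨w, y⟩ ⟨-, rfl : y = 0⟩
  exact mem_tube (by simp)

theorem isClosed_middle [T2Space N] : IsClosed D.middle := by
  have hc : IsClosed (D.jN '' ({0} ×ˢ univ)) := by
    refine IsCompact.isClosed ((isCompact_singleton.prod isCompact_univ).image_of_continuousOn
      (D.diffeo_jN.contMDiffOn.continuousOn.mono ?_))
    rintro ⟨x, v⟩ ⟨rfl : x = 0, -⟩
    exact mem_handle (by simp)
  have : D.middle = (Prod.fst ⁻¹' (D.jN '' ({0} ×ˢ univ))) ∩
      {q : N × Icc (0 : ℝ) 1 | (q.2 : ℝ) = 1 / 2} := by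
    ext q
    constructor
    · rintro ⟨⟨v, hv⟩, ht⟩
      exact ⟨⟨(0, v), by simp, hv.symm⟩, ht⟩
    · rintro ⟨⟨⟨x, v⟩, ⟨rfl : x = 0, -⟩, hv⟩, ht⟩
      exact ⟨⟨v, hv.symm⟩, ht⟩
  rw [this]
  exact (hc.preimage continuous_fst).inter
    (isClosed_eq (continuous_subtype_val.comp continuous_snd) continuous_const)

theorem isDiffeoOnto_flat [T2Space M] :
    IsDiffeoOnto J (I'.prod (𝓡∂ 1)) D.flat D.coreSphereᶜ ∧ D.flat '' D.coreSphereᶜ = D.middleᶜ :=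
  isDiffeoOnto_of_inverse (fun _ hp => D.flat_notMem_middle hp)
      (fun _ hq => D.unflat_notMem_coreSphere hq)
    (fun _ hp => D.unflat_flat hp) (fun _ hq => D.flat_unflat hq) D.contMDiffOn_flat
    D.contMDiffOn_unflat

theorem newHandle_zero (v : Sph m) : D.newHandle (0, v) ∈ D.middle := by
  refine ⟨⟨v, by simp [newHandle]⟩, ?_⟩
  rw [newHandle, coe_clamp_half_sub_arctan]
  simp

theorem bridge_notMem_coreSphere {w : Sph (k + 1)} {y : Euc (m + 1)} (hy : ‖y‖ < 1) (h0 : y ≠ 0) :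
    D.bridge (w, y) ∉ D.coreSphere := by
  rw [mem_coreSphere]
  rintro ⟨w', h⟩
  have := congrArg D.unbridge h
  rw [D.unbridge_bridge hy, D.unbridge_bridge (by simp)] at this
  exact h0 (Prod.ext_iff.1 this).2

/-- `N × [0, 1]` arises from `W` by surgery along `bridge`. -/
theorem isGluing_bridge [T2Space M] [T2Space N] :
    IsGluing J (I'.prod (𝓡∂ 1)) univ (fun _ : Unit => D.bridge) D.flat (fun _ => D.newHandle) where
  diffeo_f _ := D.isDiffeoOnto_bridge.1
  isOpen_f _ := D.isDiffeoOnto_bridge.2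
  disjoint_f a b h := absurd (Subsingleton.elim a b) h
  diffeo_i := D.isDiffeoOnto_flat.1
  isOpen_i := D.isDiffeoOnto_flat.2 ▸ D.isClosed_middle.isOpen_compl
  diffeo_j _ := D.isDiffeoOnto_newHandle.1
  isOpen_j _ := D.isDiffeoOnto_newHandle.2
  disjoint_j a b h := absurd (Subsingleton.elim a b) h
  cover := by
    refine eq_univ_of_forall fun q => ?_
    by_cases hq : q ∈ D.middle
    · obtain ⟨y, t⟩ := q
      obtain ⟨⟨v, rfl : y = _⟩, ht : (t : ℝ) = 1 / 2⟩ := hq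
      refine Or.inr (mem_iUnion.2 ⟨(), (0, v), mem_handle (by simp), ?_⟩)
      have : t = clamp (1 / 2) := Subtype.ext (by rw [ht, coe_clamp (by norm_num)])
      simp [newHandle, this]
    · exact Or.inl (D.isDiffeoOnto_flat.2.symm ▸ hq)
  glue _ w v θ h0 h1 _ := D.flat_bridge w v h0 h1
  overlap := by
    rintro p hp - ⟨z, v⟩ hz h
    have hz0 : z ≠ 0 := by
      rintro rfl
      exact D.flat_notMem_middle hp (h ▸ D.newHandle_zero v)
    have hz' := norm_pos_iff.2 hz0
    refine ⟨dir z, ‖z‖, hz', hz.1, ?_, (norm_smul_dir z).symm⟩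
    have h1 := D.flat_bridge (dir z) v hz' hz.1
    rw [norm_smul_dir, ← h] at h1
    have hn : ‖‖z‖ • (v : Euc (m + 1))‖ = ‖z‖ := by rw [norm_smul, norm_norm, norm_coe_sph, mul_one]
    exact D.isDiffeoOnto_flat.1.injOn hp (D.bridge_notMem_coreSphere (by rw [hn]; exact hz.1)
      (smul_ne_zero hz'.ne' (coe_sph_ne_zero v))) h1.symm

theorem bridge_subset_interior [T2Space M] [IsManifold J ∞ W] :
    D.bridge '' tube (k + 1) m univ ⊆ J.interior W := by
  rintro _ ⟨p, hp, rfl⟩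
  exact (D.isDiffeoOnto_bridge.1.isInteriorPoint_iff isOpen_tube_univ D.isDiffeoOnto_bridge.2 hp).1
    BoundarylessManifold.isInteriorPoint

theorem isSurgeryAlong_bridge [T2Space M] [T2Space N] [IsManifold J ∞ W] :
    IsSurgeryAlong J (I'.prod (𝓡∂ 1)) D.bridge (N × Icc (0 : ℝ) 1) :=
  ⟨D.bridge_subset_interior, D.flat, fun _ => D.newHandle, D.isGluing_bridge⟩

/-! ### The boundary of `W` -/

/-- The two copies of `N` in the boundary of `W`. -/
def ends : N ⊕ N → W := Sum.elim (fun y => D.unflat (y, 0)) (fun y => D.unflat (y, 1))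

/-- The projection of `N × [0, 1]`, without the level `1/2`, to the nearest end. -/
def nearestEnd (q : N × Icc (0 : ℝ) 1) : N ⊕ N :=
  if (q.2 : ℝ) < 1 / 2 then Sum.inl q.1 else Sum.inr q.1

theorem zero_notMem_middle (y : N) : (y, (0 : Icc (0 : ℝ) 1)) ∉ D.middle := fun h => by
  have := h.2; norm_num at this

theorem one_notMem_middle (y : N) : (y, (1 : Icc (0 : ℝ) 1)) ∉ D.middle := fun h => by
  have := h.2; norm_num at this

theorem mem_range_ends {p : W} :
    p ∈ range D.ends ↔ p ∉ D.coreSphere ∧ ((D.flat p).2 = 0 ∨ (D.flat p).2 = 1) := by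
  constructor
  · rintro ⟨y | y, rfl⟩
    · refine ⟨D.unflat_notMem_coreSphere (D.zero_notMem_middle y), Or.inl ?_⟩
      simp [ends, D.flat_unflat (D.zero_notMem_middle y)]
    · refine ⟨D.unflat_notMem_coreSphere (D.one_notMem_middle y), Or.inr ?_⟩
      simp [ends, D.flat_unflat (D.one_notMem_middle y)]
  · rintro ⟨hp, h | h⟩
    · exact ⟨Sum.inl (D.flat p).1, by rw [ends, Sum.elim_inl, ← h, D.unflat_flat hp]⟩
    · exact ⟨Sum.inr (D.flat p).1, by rw [ends, Sum.elim_inr, ← h, D.unflat_flat hp]⟩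

theorem nearestEnd_flat_ends (z : N ⊕ N) : nearestEnd (D.flat (D.ends z)) = z := by
  rcases z with y | y
  · simp [ends, nearestEnd, D.flat_unflat (D.zero_notMem_middle y)]
  · norm_num [ends, nearestEnd, D.flat_unflat (D.one_notMem_middle y)]

theorem contMDiffAt_nearestEnd {q : N × Icc (0 : ℝ) 1} (hq : (q.2 : ℝ) ≠ 1 / 2) :
    ContMDiffAt (I'.prod (𝓡∂ 1)) I' ∞ nearestEnd q := by
  have hc : Continuous fun q : N × Icc (0 : ℝ) 1 => (q.2 : ℝ) :=
    continuous_subtype_val.comp continuous_snd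
  rcases lt_or_gt_of_ne hq with h | h
  · refine (ContMDiff.inl.comp contMDiff_fst).contMDiffAt.congr_of_eventuallyEq ?_
    filter_upwards [hc.continuousAt.eventually_lt continuousAt_const h] with q' hq'
    exact if_pos hq'
  · refine (ContMDiff.inr.comp contMDiff_fst).contMDiffAt.congr_of_eventuallyEq ?_
    filter_upwards [ContinuousAt.eventually_lt continuousAt_const hc.continuousAt h] with q' hq'
    exact if_neg (not_lt.2 hq'.le)

theorem isDiffeoOnto_ends [T2Space M] : IsDiffeoOnto I' J D.ends univ := by
  refine ⟨fun p => nearestEnd (D.flat p), fun z _ => D.nearestEnd_flat_ends z, ?_, ?_⟩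
  · have h : ∀ t : Icc (0 : ℝ) 1, (∀ y, (y, t) ∉ D.middle) →
        ContMDiff I' J ∞ fun y => D.unflat (y, t) := by
      intro t ht
      rw [← contMDiffOn_univ]
      exact ContMDiffOn.comp D.contMDiffOn_unflat
        (contMDiff_id.prodMk contMDiff_const).contMDiffOn fun y _ => ht y
    exact (ContMDiff.sumElim (h 0 D.zero_notMem_middle) (h 1 D.one_notMem_middle)).contMDiffOn
  · rw [image_univ]
    intro p hp
    obtain ⟨hb, h⟩ := D.mem_range_ends.1 hp
    have h2 : ((D.flat p).2 : ℝ) ≠ 1 / 2 := by rcases h with h | h <;> norm_num [h]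
    exact (contMDiffAt_nearestEnd h2).comp_contMDiffWithinAt p
      ((D.contMDiffOn_flat p hb).mono fun p' hp' => (D.mem_range_ends.1 hp').1)

theorem mem_boundary_prod_unitInterval [BoundarylessManifold I' N] {q : N × Icc (0 : ℝ) 1} :
    q ∈ (I'.prod (𝓡∂ 1)).boundary (N × Icc (0 : ℝ) 1) ↔ q.2 = 0 ∨ q.2 = 1 := by
  have h : (𝓡∂ 1).boundary (Icc (0 : ℝ) 1) = {⊥, ⊤} := boundary_Icc
  rw [ModelWithCorners.boundary_of_boundaryless_left, h]
  exact ⟨fun h => h.2, fun h => ⟨mem_univ _, h⟩⟩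

theorem range_ends [T2Space M] [T2Space N] [T2Space W] [IsManifold I' ∞ N] [IsManifold J ∞ W]
    [BoundarylessManifold I' N] : range D.ends = J.boundary W := by
  ext p
  rw [D.mem_range_ends, ← mem_boundary_prod_unitInterval (I' := I')]
  by_cases hp : p ∈ D.coreSphere
  · obtain ⟨w, rfl⟩ := D.mem_coreSphere.1 hp
    have h : D.bridge (w, 0) ∈ J.interior W :=
      D.bridge_subset_interior ⟨(w, 0), mem_tube (by simp), rfl⟩
    rw [← J.compl_interior]
    exact iff_of_false (fun h' => h'.1 hp) fun h' => h' h
  · have ho : IsOpen (D.flat '' D.coreSphereᶜ) :=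
      D.isDiffeoOnto_flat.2 ▸ D.isClosed_middle.isOpen_compl
    have h := D.isDiffeoOnto_flat.1.isInteriorPoint_iff D.isClosed_coreSphere.isOpen_compl ho hp
    rw [← J.compl_interior, ← ModelWithCorners.compl_interior]
    exact ⟨fun h' h'' => h'.2 (h.1 h''), fun h' => ⟨hp, fun h'' => h' (h.2 h'')⟩⟩

end DoubleTrace

end SmoothSurgery

end

theorem lemma2p4 {n k m : ℕ} (hn : n = k + m + 1)
    {M : Type*} [TopologicalSpace M] [T2Space M] [CompactSpace M]
    [ChartedSpace (EuclideanSpace ℝ (Fin n)) M] [IsManifold (𝓡 n) ∞ M]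
    {N : Type*} [TopologicalSpace N] [T2Space N] [CompactSpace N]
    [ChartedSpace (EuclideanSpace ℝ (Fin n)) N] [IsManifold (𝓡 n) ∞ N]
    (f : Sph k × Euc (m + 1) → M) (hf : IsSurgeryAlong (𝓡 n) (𝓡 n) f N)
    {Ω' : Type*} [TopologicalSpace Ω'] [T2Space Ω']
    [ChartedSpace (EuclideanHalfSpace (n + 1)) Ω'] [IsManifold (𝓡∂ (n + 1)) ∞ Ω']
    (hΩ' : IsHandleAttachment ((𝓡 n).prod (𝓡∂ 1)) (𝓡∂ (n + 1)) (endTubes f) Ω') :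
    (∃ e : N ⊕ N → Ω', IsDiffeoOnto (𝓡 n) (𝓡∂ (n + 1)) e Set.univ ∧
      Set.range e = (𝓡∂ (n + 1)).boundary Ω') ∧
    ∃ g : Sph (k + 1) × Euc (m + 1) → Ω',
      IsSurgeryAlong (𝓡∂ (n + 1)) ((𝓡 n).prod (𝓡∂ 1)) g (N × Set.Icc (0 : ℝ) 1) := by
  obtain ⟨-, iN, jN, hN⟩ := hf
  obtain ⟨iW, jW, hW⟩ := hΩ'
  let D : DoubleTrace (𝓡 n) (𝓡 n) (𝓡∂ (n + 1)) M N Ω' k m := ⟨f, iN, jN (), iW, jW, hN, hW⟩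
  exact ⟨⟨D.ends, D.isDiffeoOnto_ends, D.range_ends⟩, D.bridge, D.isSurgeryAlong_bridge⟩
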